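/- Consider the following logic, interpreted over the integers $\mathbb Z$. Terms are numerals $n$, parameters $M$ (free constants, among them a distinguished parameter $N$), individual variables $x$, $t+u$, $-t$, $a(t)$ for array identifiers $a$ (free unary function symbols), and $\sharp\{x\mid\varphi\}$. Formulae are built from the atoms $t<u$, $t=u$, $t\equiv_n u$ (congruence modulo $n$) by $\wedge$, $\neg$ and $\exists x$. An interpretation assigns integers to the parameters and to the free variables, and to each array identifier $a$ a function $\mathbb Z\to\mathbb Z$ that is $0$ outside $[0,N)=\{i\in\mathbb Z\mid 0\le i<N\}$; $\sharp\{x\mid\varphi\}$ denotes the number of $x\in[0,N)$ for which $\varphi$ holds. A formula is satisfiable if it is true under some interpretation. An arithmetic formula is one without array identifiers and without $\sharp$. A basic formula is one obtained from an arithmetic formula by simultaneously replacing, without capture, some of its free variables by terms $a(y)$ with $a$ an array identifier and $y$ a variable (so that $y$ is not bound at that place). An E-flat formula is a formula of the form $$\exists z_1\cdots\exists z_K.\ \alpha\ \wedge\ \sharp\{x\mid\beta_1\}=z_1\ \wedge\ \cdots\ \wedge\ \sharp\{x\mid\beta_K\}=z_K ,$$ where $K\ge 0$, $\alpha,\beta_1,\dots,\beta_K$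 are basic formulae and the variable $x$ does not occur free in $\alpha$. The formulae $\alpha,\beta_i$ may contain any of the $z_j$, further free variables $y$, and terms $a(y)$, $a(z_j)$, and the $\beta_i$ may contain $x$ and $a(x)$; in particular the graph with an arc $z_i\to z_j$ whenever $z_j$ occurs in $\beta_i$ may be cyclic. **Theorem.** Satisfiability of E-flat formulae is decidable: the set of all (Gödel numbers of) satisfiable E-flat formulae is a decidable set. -/

import Mathlib

/-! Presburger arithmetic with free unary function symbols (arrays) and cardinality terms,
interpreted over the integers. Variables, parameters and array identifiers are named by natural
numbers; parameter `0` is the distinguished parameter `N`, the length of the arrays. -/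

namespace ArrayCard

mutual

/-- Terms: numerals, parameters, individual variables, `t + u`, `-t`, `a(t)`, `♯{x | φ}`. -/
inductive Term : Type
  | num (n : ℕ)
  | par (p : ℕ)
  | var (x : ℕ)
  | add (t u : Term)
  | neg (t : Term)
  | app (a : ℕ) (t : Term)
  | card (x : ℕ) (φ : Formula)

/-- Formulae: `t < u`, `t = u`, `t ≡ u (mod n)`, `φ ∧ ψ`, `¬ φ`, `∃ x, φ`. -/
inductive Formula : Type
  | lt (t u : Term)
  | eq (t u : Term)
  | modEq (n : ℕ) (t u : Term)
  | and (φ ψ : Formula)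
  | not (φ : Formula)
  | ex (x : ℕ) (φ : Formula)

end

/-! ### Gödel numbering -/

mutual

/-- The Gödel number of a term. -/
def Term.code : Term → ℕ
  | .num n => 7 * n
  | .par p => 7 * p + 1
  | .var x => 7 * x + 2
  | .add t u => 7 * Nat.pair t.code u.code + 3
  | .neg t => 7 * t.code + 4
  | .app a t => 7 * Nat.pair a t.code + 5
  | .card x φ => 7 * Nat.pair x φ.code + 6

/-- The Gödel number of a formula. -/
def Formula.code : Formula → ℕ
  | .lt t u => 6 * Nat.pair t.code u.code
  | .eq t u => 6 * Nat.pair t.code u.code + 1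
  | .modEq n t u => 6 * Nat.pair n (Nat.pair t.code u.code) + 2
  | .and φ ψ => 6 * Nat.pair φ.code ψ.code + 3
  | .not φ => 6 * φ.code + 4
  | .ex x φ => 6 * Nat.pair x φ.code + 5

end

mutual

theorem Term.code_inj : ∀ t u : Term, t.code = u.code → t = u
  | .num n, u, h => by
    cases u <;> simp only [Term.code] at h <;> first | omega | (congr 1; omega)
  | .par n, u, h => by
    cases u <;> simp only [Term.code] at h <;> first | omega | (congr 1; omega)
  | .var n, u, h => by
    cases u <;> simp only [Term.code] at h <;> first | omega | (congr 1; omega)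
  | .add t₁ t₂, u, h => by
    cases u <;> simp only [Term.code] at h <;> try omega
    have h' := Nat.pair_eq_pair.1
      (Nat.eq_of_mul_eq_mul_left (by norm_num) (Nat.add_right_cancel h))
    rw [Term.code_inj t₁ _ h'.1, Term.code_inj t₂ _ h'.2]
  | .neg t, u, h => by
    cases u <;> simp only [Term.code] at h <;> try omega
    rw [Term.code_inj t _
      (Nat.eq_of_mul_eq_mul_left (by norm_num) (Nat.add_right_cancel h))]
  | .app a t, u, h => by
    cases u <;> simp only [Term.code] at h <;> try omega
    have h' := Nat.pair_eq_pair.1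
      (Nat.eq_of_mul_eq_mul_left (by norm_num) (Nat.add_right_cancel h))
    rw [h'.1, Term.code_inj t _ h'.2]
  | .card x φ, u, h => by
    cases u <;> simp only [Term.code] at h <;> try omega
    have h' := Nat.pair_eq_pair.1
      (Nat.eq_of_mul_eq_mul_left (by norm_num) (Nat.add_right_cancel h))
    rw [h'.1, Formula.code_inj φ _ h'.2]

theorem Formula.code_inj : ∀ φ ψ : Formula, φ.code = ψ.code → φ = ψ
  | .lt t₁ t₂, ψ, h => by
    cases ψ <;> simp only [Formula.code] at h <;> try omega
    have h' := Nat.pair_eq_pair.1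
      (Nat.eq_of_mul_eq_mul_left (by norm_num) h)
    rw [Term.code_inj t₁ _ h'.1, Term.code_inj t₂ _ h'.2]
  | .eq t₁ t₂, ψ, h => by
    cases ψ <;> simp only [Formula.code] at h <;> try omega
    have h' := Nat.pair_eq_pair.1
      (Nat.eq_of_mul_eq_mul_left (by norm_num) (Nat.add_right_cancel h))
    rw [Term.code_inj t₁ _ h'.1, Term.code_inj t₂ _ h'.2]
  | .modEq n t₁ t₂, ψ, h => by
    cases ψ <;> simp only [Formula.code] at h <;> try omega
    have h' := Nat.pair_eq_pair.1
      (Nat.eq_of_mul_eq_mul_left (by norm_num) (Nat.add_right_cancel h))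
    have h'' := Nat.pair_eq_pair.1 h'.2
    rw [h'.1, Term.code_inj t₁ _ h''.1, Term.code_inj t₂ _ h''.2]
  | .and φ₁ φ₂, ψ, h => by
    cases ψ <;> simp only [Formula.code] at h <;> try omega
    have h' := Nat.pair_eq_pair.1
      (Nat.eq_of_mul_eq_mul_left (by norm_num) (Nat.add_right_cancel h))
    rw [Formula.code_inj φ₁ _ h'.1, Formula.code_inj φ₂ _ h'.2]
  | .not φ, ψ, h => by
    cases ψ <;> simp only [Formula.code] at h <;> try omega
    rw [Formula.code_inj φ _
      (Nat.eq_of_mul_eq_mul_left (by norm_num) (Nat.add_right_cancel h))]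
  | .ex x φ, ψ, h => by
    cases ψ <;> simp only [Formula.code] at h <;> try omega
    have h' := Nat.pair_eq_pair.1
      (Nat.eq_of_mul_eq_mul_left (by norm_num) (Nat.add_right_cancel h))
    rw [h'.1, Formula.code_inj φ _ h'.2]

end

theorem code_surj (n : ℕ) : (∃ t : Term, t.code = n) ∧ ∃ φ : Formula, φ.code = n := by
  induction n using Nat.strong_induction_on with
  | _ n ih =>
    have hT : ∃ t : Term, t.code = n := by
      have hl := Nat.unpair_left_le (n / 7)
      have hr := Nat.unpair_right_le (n / 7)
      have hp := Nat.pair_unpair (n / 7)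
      have hc : n % 7 = 0 ∨ n % 7 = 1 ∨ n % 7 = 2 ∨ n % 7 = 3 ∨ n % 7 = 4 ∨ n % 7 = 5 ∨
        n % 7 = 6 := by omega
      rcases hc with h | h | h | h | h | h | h
      · exact ⟨.num (n / 7), by simp only [Term.code]; omega⟩
      · exact ⟨.par (n / 7), by simp only [Term.code]; omega⟩
      · exact ⟨.var (n / 7), by simp only [Term.code]; omega⟩
      · obtain ⟨t, ht⟩ := (ih (n / 7).unpair.1 (by omega)).1
        obtain ⟨u, hu⟩ := (ih (n / 7).unpair.2 (by omega)).1
        exact ⟨.add t u, by simp only [Term.code, ht, hu, hp]; omega⟩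
      · obtain ⟨t, ht⟩ := (ih (n / 7) (by omega)).1
        exact ⟨.neg t, by simp only [Term.code, ht]; omega⟩
      · obtain ⟨u, hu⟩ := (ih (n / 7).unpair.2 (by omega)).1
        exact ⟨.app (n / 7).unpair.1 u, by simp only [Term.code, hu, hp]; omega⟩
      · obtain ⟨u, hu⟩ := (ih (n / 7).unpair.2 (by omega)).2
        exact ⟨.card (n / 7).unpair.1 u, by simp only [Term.code, hu, hp]; omega⟩
    have hT' : ∀ m ≤ n, ∃ t : Term, t.code = m := by
      intro m hm
      rcases Nat.lt_or_eq_of_le hm with h | rfl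
      · exact (ih m h).1
      · exact hT
    refine ⟨hT, ?_⟩
    have hl := Nat.unpair_left_le (n / 6)
    have hr := Nat.unpair_right_le (n / 6)
    have hp := Nat.pair_unpair (n / 6)
    have hc : n % 6 = 0 ∨ n % 6 = 1 ∨ n % 6 = 2 ∨ n % 6 = 3 ∨ n % 6 = 4 ∨ n % 6 = 5 := by omega
    rcases hc with h | h | h | h | h | h
    · obtain ⟨t, ht⟩ := hT' (n / 6).unpair.1 (by omega)
      obtain ⟨u, hu⟩ := hT' (n / 6).unpair.2 (by omega)
      exact ⟨.lt t u, by simp only [Formula.code, ht, hu, hp]; omega⟩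
    · obtain ⟨t, ht⟩ := hT' (n / 6).unpair.1 (by omega)
      obtain ⟨u, hu⟩ := hT' (n / 6).unpair.2 (by omega)
      exact ⟨.eq t u, by simp only [Formula.code, ht, hu, hp]; omega⟩
    · have hl' := Nat.unpair_left_le (n / 6).unpair.2
      have hr' := Nat.unpair_right_le (n / 6).unpair.2
      obtain ⟨t, ht⟩ := hT' (n / 6).unpair.2.unpair.1 (by omega)
      obtain ⟨u, hu⟩ := hT' (n / 6).unpair.2.unpair.2 (by omega)
      refine ⟨.modEq (n / 6).unpair.1 t u, ?_⟩
      simp only [Formula.code, ht, hu, Nat.pair_unpair]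
      omega
    · obtain ⟨t, ht⟩ := (ih (n / 6).unpair.1 (by omega)).2
      obtain ⟨u, hu⟩ := (ih (n / 6).unpair.2 (by omega)).2
      exact ⟨.and t u, by simp only [Formula.code, ht, hu, hp]; omega⟩
    · obtain ⟨t, ht⟩ := (ih (n / 6) (by omega)).2
      exact ⟨.not t, by simp only [Formula.code, ht]; omega⟩
    · obtain ⟨u, hu⟩ := (ih (n / 6).unpair.2 (by omega)).2
      exact ⟨.ex (n / 6).unpair.1 u, by simp only [Formula.code, hu, hp]; omega⟩

/-- The Gödel numbering of formulae is a bijection onto `ℕ`. -/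
noncomputable def Formula.equivNat : Formula ≃ ℕ :=
  Equiv.ofBijective Formula.code ⟨fun φ ψ h => Formula.code_inj φ ψ h, fun n => (code_surj n).2⟩

/-- Algorithms receive a formula through its Gödel number; this also provides the instance
`Primcodable Formula`. -/
noncomputable instance : Denumerable Formula := Denumerable.mk' Formula.equivNat

theorem Formula.encode_eq (φ : Formula) : Encodable.encode φ = φ.code := rfl

/-! ### Semantics over the integers -/

/-- Values for the parameters and the array identifiers. Every array has value `0` outside the
interval `[0, N)`, where `N` is parameter `0`. -/
structure Interp where
  par : ℕ → ℤ
  arr : ℕ → ℤ → ℤ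
  arr_outside : ∀ (a : ℕ) (i : ℤ), ¬ (0 ≤ i ∧ i < par 0) → arr a i = 0

mutual

/-- The value of a term, where `v` assigns values to the variables. -/
noncomputable def Term.eval (I : Interp) : Term → (ℕ → ℤ) → ℤ
  | .num n, _ => n
  | .par p, _ => I.par p
  | .var x, v => v x
  | .add t u, v => t.eval I v + u.eval I v
  | .neg t, v => - t.eval I v
  | .app a t, v => I.arr a (t.eval I v)
  | .card x φ, v =>
    (Set.ncard {i : ℤ | (0 ≤ i ∧ i < I.par 0) ∧ φ.Holds I (Function.update v x i)} : ℤ)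

/-- Truth of a formula, where `v` assigns values to the variables. -/
noncomputable def Formula.Holds (I : Interp) : Formula → (ℕ → ℤ) → Prop
  | .lt t u, v => t.eval I v < u.eval I v
  | .eq t u, v => t.eval I v = u.eval I v
  | .modEq n t u, v => t.eval I v ≡ u.eval I v [ZMOD (n : ℤ)]
  | .and φ ψ, v => φ.Holds I v ∧ ψ.Holds I v
  | .not φ, v => ¬ φ.Holds I v
  | .ex x φ, v => ∃ i : ℤ, φ.Holds I (Function.update v x i)

end

/-- A formula is satisfiable if some values of the parameters, the arrays and the free variables
make it true in `ℤ`. -/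
def Formula.Satisfiable (φ : Formula) : Prop :=
  ∃ (I : Interp) (v : ℕ → ℤ), φ.Holds I v

/-! ### Basic and E-flat formulae -/

mutual

/-- The variable `x` occurs free in a term. -/
def Term.Free (x : ℕ) : Term → Prop
  | .num _ => False
  | .par _ => False
  | .var y => x = y
  | .add t u => t.Free x ∨ u.Free x
  | .neg t => t.Free x
  | .app _ t => t.Free x
  | .card y φ => x ≠ y ∧ φ.Free x

/-- The variable `x` occurs free in a formula. -/
def Formula.Free (x : ℕ) : Formula → Prop
  | .lt t u => t.Free x ∨ u.Free x
  | .eq t u => t.Free x ∨ u.Free x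
  | .modEq _ t u => t.Free x ∨ u.Free x
  | .and φ ψ => φ.Free x ∨ ψ.Free x
  | .not φ => φ.Free x
  | .ex y φ => x ≠ y ∧ φ.Free x

end

/-- A term of a basic formula lying in the scope of quantifiers that bind the variables `B`: it has
no cardinality operator, and arrays are applied only to variables that are not in `B`. -/
def Term.IsBasic (B : List ℕ) : Term → Prop
  | .num _ => True
  | .par _ => True
  | .var _ => True
  | .add t u => t.IsBasic B ∧ u.IsBasic B
  | .neg t => t.IsBasic B
  | .app _ t => ∃ y : ℕ, t = .var y ∧ y ∉ B
  | .card _ _ => False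

/-- A subformula of a basic formula lying in the scope of quantifiers that bind the
variables `B`. -/
def Formula.IsBasicIn : List ℕ → Formula → Prop
  | B, .lt t u => t.IsBasic B ∧ u.IsBasic B
  | B, .eq t u => t.IsBasic B ∧ u.IsBasic B
  | B, .modEq _ t u => t.IsBasic B ∧ u.IsBasic B
  | B, .and φ ψ => φ.IsBasicIn B ∧ ψ.IsBasicIn B
  | B, .not φ => φ.IsBasicIn B
  | B, .ex x φ => φ.IsBasicIn (x :: B)

/-- Basic formulae: those obtained from a formula without arrays and cardinality operators by
simultaneously replacing, without capture, some free variables by terms `a(y)` with `y` a variable.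
Absence of capture means that `y` is not bound at the place where `a(y)` occurs. -/
def Formula.IsBasic (φ : Formula) : Prop := φ.IsBasicIn []

/-- For `cs = [(z₁, β₁), …, (z_K, β_K)]`, the formula
`∃ z₁ … z_K, α ∧ ♯{x | β₁} = z₁ ∧ ⋯ ∧ ♯{x | β_K} = z_K`. -/
def Formula.eFlat (x : ℕ) (α : Formula) (cs : List (ℕ × Formula)) : Formula :=
  cs.foldr (fun c ψ => .ex c.1 ψ)
    (cs.foldl (fun ψ c => .and ψ (.eq (.card x c.2) (.var c.1))) α)

/-- Extended flat (E-flat) formulae. No condition is imposed on which of the `zⱼ` occur in which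
of the `βᵢ`. -/
def Formula.IsEFlat (φ : Formula) : Prop :=
  ∃ (x : ℕ) (α : Formula) (cs : List (ℕ × Formula)),
    α.IsBasic ∧ (∀ c ∈ cs, c.2.IsBasic) ∧ ¬ α.Free x ∧ φ = Formula.eFlat x α cs

end ArrayCard

-- Satisfiability is decided through a small model property with a primitive recursive bound.
--
-- The tool is a quantitative back-and-forth game for Presburger arithmetic. Two assignments are
-- similar at level `c` if affine forms with coefficients at most `c` have the same sign at both and
-- the entries agree modulo `c!`. If they are similar at level `lift c`, every new value on one side
-- has an answer of bounded size on the other side that preserves similarity at level `c`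
-- (`Sim.exists_update`). Hence every assignment is similar to a small one (`Sim.exists_small`),
-- basic formulae do not notice the difference (`Formula.sat_iff_of_sim`), and their quantifiers can
-- be bounded (`Formula.sat_bounded_iff`).
--
-- For the cardinalities, fix a model. The formulae `β k` read arrays only at `x` and at free
-- variables with fixed values, so their truth at a point `i` depends on a fixed finite tuple, on
-- `i` and on the array values at `i`. The type of `i` is the set of those `k` for which `β k` is
-- true there. The interval `[0, N)` is cut into boundedly many pieces such that points of one piece
-- and one residue class are indistinguishable before their array values are read (`exists_cells`).
-- For each piece, residue class and type, the number of points is recorded. Away from the values of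
-- free variables the array values at different points are independent, so only these numbers
-- matter, and the conditions on them are linear: over the types they add up to the size of the
-- class, which after multiplication by the modulus is affine in the end points of the piece
-- (`mul_card_filter_emod`), and the sum over the types containing `k` is the value of `z k`. The
-- values of the `z k` are coordinates of the same tuple, so cyclic dependencies among the
-- constraints do no harm.
--
-- The whole tuple of atomic terms, cut points and numbers is now replaced by a small similar one.
-- Types are distributed over the new pieces as the new numbers prescribe (`exists_types`). A number
-- is positive only if the old one is, so every prescribed type occurs at an original point of the
-- corresponding piece and class, and the array values there can be transferred (`exists_point`).
-- This gives `exists_small_model`.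
--
-- What remains is a search through boundedly many coded interpretations. Evaluation with bounded
-- quantifiers and recognition of E-flat formulae are course-of-values recursions on Gödel numbers,
-- hence primitive recursive.

namespace ArrayCard

open Function Finset

/-! ### Back-and-forth for affine forms with bounded coefficients -/

section Sim

open scoped Nat

variable {κ : Type*}

/-- Two assignments `a`, `b` are similar on `S` at level `c` if every affine form whose coefficients
have absolute value at most `c` has the same sign at `a` and at `b`, and `a`, `b` agree
modulo `c!`. -/
def Sim (S : Finset κ) (c : ℕ) (a b : κ → ℤ) : Prop :=
  (∀ (l : κ → ℤ) (k : ℤ), (∀ i ∈ S, |l i| ≤ c) → |k| ≤ c →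
    (0 < ∑ i ∈ S, l i * a i + k ↔ 0 < ∑ i ∈ S, l i * b i + k)) ∧
  ∀ i ∈ S, a i ≡ b i [ZMOD (c ! : ℕ)]

/-- A level sufficient for one back-and-forth step that ends at level `c`. -/
def lift (c : ℕ) : ℕ := 2 * (c ! * c + 1) + c ! * c !

/-- A bound for the value found in one back-and-forth step. -/
def grow (T : ℕ) : ℕ := T ! * T ! * ((T ! * T + 1) * (T * T + 1) + 1)

theorem Sim.refl (S : Finset κ) (c : ℕ) (a : κ → ℤ) : Sim S c a a :=
  ⟨fun _ _ _ _ => Iff.rfl, fun _ _ => rfl⟩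

theorem Sim.symm {S : Finset κ} {c : ℕ} {a b : κ → ℤ} (h : Sim S c a b) : Sim S c b a :=
  ⟨fun l k hl hk => (h.1 l k hl hk).symm, fun i hi => (h.2 i hi).symm⟩

theorem Sim.trans {S : Finset κ} {c : ℕ} {a b d : κ → ℤ} (h : Sim S c a b) (h' : Sim S c b d) :
    Sim S c a d :=
  ⟨fun l k hl hk => (h.1 l k hl hk).trans (h'.1 l k hl hk),
    fun i hi => (h.2 i hi).trans (h'.2 i hi)⟩

theorem Sim.mono {S : Finset κ} {c d : ℕ} (hcd : c ≤ d) {a b : κ → ℤ} (h : Sim S d a b) :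
    Sim S c a b := by
  have hcd' : (c : ℤ) ≤ d := by exact_mod_cast hcd
  refine ⟨fun l k hl hk => h.1 l k (fun i hi => (hl i hi).trans hcd') (hk.trans hcd'),
    fun i hi => (h.2 i hi).of_dvd ?_⟩
  exact_mod_cast Nat.factorial_dvd_factorial hcd

theorem Sim.congr {S : Finset κ} {c : ℕ} {a b a' b' : κ → ℤ} (h : Sim S c a b)
    (ha : ∀ i ∈ S, a' i = a i) (hb : ∀ i ∈ S, b' i = b i) : Sim S c a' b' := by
  refine ⟨fun l k hl hk => ?_, fun i hi => by rw [ha i hi, hb i hi]; exact h.2 i hi⟩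
  rw [Finset.sum_congr rfl (fun i hi => by rw [ha i hi] : ∀ i ∈ S, l i * a' i = l i * a i),
    Finset.sum_congr rfl (fun i hi => by rw [hb i hi] : ∀ i ∈ S, l i * b' i = l i * b i)]
  exact h.1 l k hl hk

theorem Sim.modEq {S : Finset κ} {c : ℕ} {a b : κ → ℤ} (h : Sim S c a b) {m : ℕ}
    (hm : m ∣ c !) {i : κ} (hi : i ∈ S) : a i ≡ b i [ZMOD m] :=
  (h.2 i hi).of_dvd (by exact_mod_cast hm)

/-- Similarity transfers equations. -/
theorem Sim.eq_zero_iff {S : Finset κ} {c : ℕ} {a b : κ → ℤ} (h : Sim S c a b) (l : κ → ℤ) (k : ℤ)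
    (hl : ∀ i ∈ S, |l i| ≤ c) (hk : |k| ≤ c) :
    ∑ i ∈ S, l i * a i + k = 0 ↔ ∑ i ∈ S, l i * b i + k = 0 := by
  have h₁ := h.1 l k hl hk
  have h₂ := h.1 (fun i => - l i) (-k) (fun i hi => by rw [abs_neg]; exact hl i hi)
    (by rwa [abs_neg])
  simp only [neg_mul, Finset.sum_neg_distrib] at h₂
  omega

/-- Similarity restricts along an injection of the index sets. -/
theorem Sim.comp {κ' : Type*} {S : Finset κ} {S' : Finset κ'} {c : ℕ} {a b : κ' → ℤ}
    (h : Sim S' c a b) (f : κ → κ') (hf : Injective f) (hS : ∀ i ∈ S, f i ∈ S') :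
    Sim S c (a ∘ f) (b ∘ f) := by
  classical
  refine ⟨fun l k hl hk => ?_, fun i hi => h.2 _ (hS i hi)⟩
  set l' : κ' → ℤ := fun j => ∑ i ∈ S with f i = j, l i with hl'
  have hval : ∀ i ∈ S, l' (f i) = l i := by
    intro i hi
    rw [hl']
    simp only [hf.eq_iff]
    rw [Finset.sum_filter, Finset.sum_ite_eq' S i, if_pos hi]
  have hzero : ∀ j, (∀ i ∈ S, f i ≠ j) → l' j = 0 := by
    intro j hj
    refine Finset.sum_eq_zero fun i hi => ?_
    rw [Finset.mem_filter] at hi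
    exact absurd hi.2 (hj i hi.1)
  have hsum : ∀ d : κ' → ℤ, ∑ i ∈ S, l i * (d ∘ f) i = ∑ j ∈ S', l' j * d j := by
    intro d
    have himg : S.image f ⊆ S' := by
      intro j hj
      obtain ⟨i, hi, rfl⟩ := Finset.mem_image.1 hj
      exact hS i hi
    rw [← Finset.sum_subset himg, Finset.sum_image (fun i _ j _ hij => hf hij)]
    · exact Finset.sum_congr rfl fun i hi => by rw [hval i hi, comp_apply]
    · intro j _ hj
      rw [hzero j, zero_mul]
      intro i hi hij
      exact hj (Finset.mem_image.2 ⟨i, hi, hij⟩)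
  rw [hsum, hsum]
  refine h.1 l' k (fun j _ => ?_) hk
  by_cases hj : ∃ i ∈ S, f i = j
  · obtain ⟨i, hi, rfl⟩ := hj
    rw [hval i hi]
    exact hl i hi
  · rw [hzero j (by push Not at hj; exact hj), abs_zero]
    exact_mod_cast Nat.zero_le c

theorem abs_sum_mul_le (S : Finset κ) (l b : κ → ℤ) (k : ℤ) {C T : ℕ} (hS : #S ≤ T)
    (hl : ∀ i ∈ S, |l i| ≤ C) (hk : |k| ≤ C) (hb : ∀ i ∈ S, |b i| ≤ T) :
    |∑ i ∈ S, l i * b i + k| ≤ C * (T * T + 1) := by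
  have h1 : |∑ i ∈ S, l i * b i| ≤ #S * (C * T) := by
    refine (Finset.abs_sum_le_sum_abs _ _).trans ?_
    refine (Finset.sum_le_card_nsmul S _ ((C : ℤ) * T) fun i hi => ?_).trans (by simp)
    rw [abs_mul]
    exact mul_le_mul (hl i hi) (hb i hi) (abs_nonneg _) (by positivity)
  have h2 : (#S : ℤ) * (C * T) ≤ T * (C * T) :=
    mul_le_mul_of_nonneg_right (by exact_mod_cast hS) (by positivity)
  have h3 := abs_add_le (∑ i ∈ S, l i * b i) k
  nlinarith

/-- The back-and-forth step for forms that all have the same coefficient at the new variable. -/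
theorem Sim.exists_cut {S : Finset κ} {c T : ℕ} {a b : κ → ℤ} (h : Sim S (lift c) a b)
    (hc : c ≤ T) (hS : #S ≤ T) (hb : ∀ i ∈ S, |b i| ≤ T) (X : ℤ) :
    ∃ Y : ℤ, |Y| ≤ grow T ∧ Y ≡ X [ZMOD ((c ! * c ! : ℕ) : ℤ)] ∧
      ∀ (l : κ → ℤ) (k : ℤ), (∀ i ∈ S, |l i| ≤ (c ! * c + 1 : ℕ)) → |k| ≤ (c ! * c + 1 : ℕ) →
        (∑ i ∈ S, l i * a i + k < X ↔ ∑ i ∈ S, l i * b i + k < Y) := by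
  classical
  set C : ℕ := c ! * c + 1 with hC
  set M : ℕ := c ! * c ! with hM
  have hMpos : 0 < M := Nat.mul_pos (Nat.factorial_pos c) (Nat.factorial_pos c)
  have hMz : (0 : ℤ) < M := by exact_mod_cast hMpos
  have hlift : lift c = 2 * C + M := rfl
  set R : ℕ := C * (T * T + 1) with hR
  have hgrow : M * (R + 1) ≤ grow T := by
    have := Nat.factorial_le hc
    rw [hM, hR, hC]
    unfold grow
    gcongr
  have hgrowz : (M : ℤ) * (R + 1) ≤ grow T := by exact_mod_cast hgrow
  have hbd : ∀ (l : κ → ℤ) (k : ℤ), (∀ i ∈ S, |l i| ≤ (C : ℤ)) → |k| ≤ (C : ℤ) →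
      |∑ i ∈ S, l i * b i + k| ≤ (R : ℤ) := by
    intro l k hl hk
    have := abs_sum_mul_le S l b k hS hl hk hb
    rw [hR]
    push_cast
    exact this
  by_cases hex : ∃ z : ℤ, ∃ (l : κ → ℤ) (k : ℤ), (∀ i ∈ S, |l i| ≤ (C : ℤ)) ∧ |k| ≤ (C : ℤ) ∧
      ∑ i ∈ S, l i * a i + k = z ∧ z < X
  -- `A` is the greatest value below `X` that an admissible form takes at `a`, and `B` is the value
  -- of the same form at `b`. The cut goes to `B + r`, where `r` is the representative of `X - A`
  -- modulo `M` in `[1, M]`; thus `A + r ≤ X`.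
  · obtain ⟨A, ⟨l₀, k₀, hl₀, hk₀, hA, hAX⟩, hmax⟩ :=
      Int.exists_greatest_of_bdd (P := fun z : ℤ => ∃ (l : κ → ℤ) (k : ℤ),
        (∀ i ∈ S, |l i| ≤ (C : ℤ)) ∧ |k| ≤ (C : ℤ) ∧ ∑ i ∈ S, l i * a i + k = z ∧ z < X)
        ⟨X, fun z ⟨_, _, _, _, _, hz⟩ => hz.le⟩ hex
    set B : ℤ := ∑ i ∈ S, l₀ i * b i + k₀ with hB
    set r : ℤ := (X - A - 1) % M + 1 with hr
    have hr0 : 0 ≤ (X - A - 1) % M := Int.emod_nonneg _ hMz.ne'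
    have hr1 : (X - A - 1) % M < M := Int.emod_lt_of_pos _ hMz
    have hr2 : (X - A - 1) % M ≤ X - A - 1 := by
      have := Int.emod_add_mul_ediv (X - A - 1) M
      have : 0 ≤ (X - A - 1) / M := Int.ediv_nonneg (by omega) hMz.le
      nlinarith
    have hBA : B ≡ A [ZMOD M] := by
      have hdvd : M ∣ (lift c)! := Nat.dvd_factorial hMpos (by omega)
      rw [hB, ← hA]
      refine Int.ModEq.add_right _ ?_
      refine Int.ModEq.sum fun i hi => ?_
      exact ((h.modEq hdvd hi).symm).mul_left _
    have hBR := hbd l₀ k₀ hl₀ hk₀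
    -- The difference of two admissible forms has coefficients at most `2 * C`, and the shift `s`
    -- adds at most `M` to the constant. This is the origin of the value `lift c = 2 * C + M`.
    have key : ∀ (l : κ → ℤ) (k s : ℤ), (∀ i ∈ S, |l i| ≤ (C : ℤ)) → |k| ≤ (C : ℤ) → |s| ≤ M →
        (0 < (∑ i ∈ S, l i * a i + k) - A + s ↔ 0 < (∑ i ∈ S, l i * b i + k) - B + s) := by
      intro l k s hl hk hs
      have := h.1 (fun i => l i - l₀ i) (k - k₀ + s) (fun i hi => ?_) ?_
      · simp only [sub_mul, Finset.sum_sub_distrib] at this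
        rw [hB, ← hA]
        convert this using 2 <;> ring
      · have h1 := abs_sub (l i) (l₀ i)
        have h2 := hl i hi
        have h3 := hl₀ i hi
        rw [hlift]
        push_cast
        omega
      · have h1 := abs_sub k k₀
        have h2 := abs_add_le (k - k₀) s
        rw [hlift]
        push_cast
        omega
    refine ⟨B + r, ?_, ?_, ?_⟩
    · have h1 := abs_add_le B r
      have h2 : |r| ≤ M := by rw [abs_of_pos (by omega)]; omega
      have h3 : (0 : ℤ) ≤ R := by positivity
      nlinarith
    · have h1 : r ≡ X - A [ZMOD M] := by
        have : (X - A - 1) % M ≡ X - A - 1 [ZMOD M] := Int.mod_modEq _ _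
        simpa [hr] using this.add_right 1
      simpa using hBA.add h1
    · intro l k hl hk
      constructor
      · intro hlt
        have h1 := hmax _ ⟨l, k, hl, hk, rfl, hlt⟩
        have h2 := key l k 0 hl hk (by simp)
        omega
      · intro hlt
        -- Here the form is at least `X ≥ A + r` at `a`; the shift `1 - r` turns `≥ A + r` into a
        -- strict inequality, which then holds at `b` with `B` in place of `A`.
        by_contra hge
        have h2 := key l k (1 - r) hl hk (by rw [abs_le]; constructor <;> omega)
        omega
  -- No admissible form lies below `X` at `a`, so `Y` has to lie below all their values at `b`,
  -- which are at least `-R`.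
  · refine ⟨X % M - M * (R + 1), ?_, ?_, ?_⟩
    · have h1 := Int.emod_nonneg X hMz.ne'
      have h2 := Int.emod_lt_of_pos X hMz
      have h3 : (0 : ℤ) ≤ R := by positivity
      rw [abs_le]
      constructor <;> nlinarith
    · have : X % M - M * (R + 1) ≡ X % M - 0 [ZMOD M] :=
        Int.ModEq.sub_left _ (Int.modEq_zero_iff_dvd.2 (Dvd.intro _ rfl))
      rw [sub_zero] at this
      exact this.trans (Int.mod_modEq _ _)
    · intro l k hl hk
      constructor
      · intro hlt
        exact absurd ⟨_, l, k, hl, hk, rfl, hlt⟩ hex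
      · intro hlt
        have h1 := (abs_le.1 (hbd l k hl hk)).1
        have h2 := Int.emod_lt_of_pos X hMz
        have h3 : (0 : ℤ) ≤ R := by positivity
        nlinarith

-- Answering one or several new coordinates

variable [DecidableEq κ]

theorem sum_mul_update {S : Finset κ} {i : κ} (hi : i ∈ S) (l a : κ → ℤ) (x : ℤ) :
    ∑ j ∈ S, l j * update a i x j = ∑ j ∈ S, update l i 0 j * a j + l i * x := by
  rw [← Finset.add_sum_erase S _ hi, ← Finset.add_sum_erase S (fun j => update l i 0 j * a j) hi]
  have : ∑ j ∈ S.erase i, l j * update a i x j = ∑ j ∈ S.erase i, update l i 0 j * a j :=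
    Finset.sum_congr rfl fun j hj => by
      rw [update_of_ne (Finset.ne_of_mem_erase hj), update_of_ne (Finset.ne_of_mem_erase hj)]
  rw [this]
  simp only [update_self]
  ring

theorem le_lift (c : ℕ) : c ≤ lift c := by
  have := Nat.factorial_pos c
  unfold lift
  nlinarith [Nat.zero_le (c ! * c !)]

theorem factorial_le_lift (c : ℕ) : c ! ≤ lift c := by
  have := Nat.factorial_pos c
  unfold lift
  nlinarith [Nat.zero_le (c ! * c)]

theorem le_grow (T : ℕ) : T ≤ grow T := by
  have h := Nat.self_le_factorial T
  have h1 := Nat.factorial_pos T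
  unfold grow
  calc T ≤ T ! := h
    _ = T ! * 1 * 1 := by ring
    _ ≤ T ! * T ! * ((T ! * T + 1) * (T * T + 1) + 1) :=
      Nat.mul_le_mul (Nat.mul_le_mul_left _ h1) (Nat.le_add_left _ _)

/-- The back-and-forth step. -/
theorem Sim.exists_update {S : Finset κ} {c T : ℕ} {a b : κ → ℤ} (h : Sim S (lift c) a b)
    (hc : c ≤ T) (hS : #S ≤ T) (hb : ∀ i ∈ S, |b i| ≤ T) {i : κ} (hi : i ∈ S) (x : ℤ) :
    ∃ y : ℤ, |y| ≤ grow T ∧ Sim S c (update a i x) (update b i y) := by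
  have hE : (0 : ℤ) < (c ! : ℕ) := by exact_mod_cast Nat.factorial_pos c
  -- Since `l i` divides `c!` whenever `0 < |l i| ≤ c`, every form containing the new variable can
  -- be scaled to have coefficient `±c!` there. All conditions on `x` thereby become cuts for the
  -- single number `c! * x`. The congruence modulo `c! * c!` makes `Y` divisible by `c!`, with a
  -- quotient congruent to `x` modulo `c!`.
  obtain ⟨Y, hY, hmod, hcut⟩ := h.exists_cut hc hS hb ((c ! : ℕ) * x)
  have hmod' : ((c ! : ℕ) : ℤ) * (c ! : ℕ) ∣ (c ! : ℕ) * x - Y := by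
    have := hmod.dvd
    push_cast at this ⊢
    exact this
  obtain ⟨y, rfl⟩ : ((c ! : ℕ) : ℤ) ∣ Y := by
    have h1 := (dvd_mul_right ((c ! : ℕ) : ℤ) (c ! : ℕ)).trans hmod'
    have h2 : ((c ! : ℕ) : ℤ) ∣ (c ! : ℕ) * x := dvd_mul_right _ _
    simpa using (dvd_sub h2 h1)
  refine ⟨y, ?_, ?_, ?_⟩
  · rw [abs_mul, abs_of_pos hE] at hY
    nlinarith [abs_nonneg y]
  · intro l k hl hk
    rw [sum_mul_update hi, sum_mul_update hi]
    have hli := hl i hi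
    have hcoef : ∀ d : ℤ, |d| ≤ (c ! : ℕ) → ∀ j ∈ S, |d * update l i 0 j| ≤ (c ! * c : ℕ) := by
      intro d hd j hj
      rw [abs_mul]
      push_cast
      refine mul_le_mul hd ?_ (abs_nonneg _) (by positivity)
      by_cases hji : j = i
      · subst hji; simp
      · rw [update_of_ne hji]; exact hl j hj
    have hconst : ∀ d : ℤ, |d| ≤ (c ! : ℕ) → |d * k| ≤ (c ! * c : ℕ) := by
      intro d hd
      rw [abs_mul]
      push_cast
      exact mul_le_mul hd hk (abs_nonneg _) (by positivity)
    have hsum : ∀ (d : ℤ) (f : κ → ℤ), ∑ j ∈ S, d * update l i 0 j * f j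
        = d * ∑ j ∈ S, update l i 0 j * f j := by
      intro d f
      rw [Finset.mul_sum]
      exact Finset.sum_congr rfl fun j _ => by ring
    rcases lt_trichotomy (l i) 0 with hneg | hzero | hpos
    · obtain ⟨d, hd⟩ : -l i ∣ ((c ! : ℕ) : ℤ) := by
        have h1 : (l i).natAbs ∣ c ! :=
          Nat.dvd_factorial (by omega) (by rw [← Int.natCast_natAbs] at hli; omega)
        have h2 : ((l i).natAbs : ℤ) ∣ ((c ! : ℕ) : ℤ) := by exact_mod_cast h1
        simpa using h2
      have hd0 : 0 < d := by nlinarith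
      have hdle : |d| ≤ (c ! : ℕ) := by rw [abs_of_pos hd0]; nlinarith
      -- For a negative coefficient the condition reads `c! * x < s`, with `s` the scaled rest of
      -- the form. This is the negation of `s - 1 < c! * x`, so the constant shifts by one; hence
      -- the summand `1` in the bound `c! * c + 1`.
      have := hcut (fun j => d * update l i 0 j) (d * k - 1)
        (fun j hj => (hcoef d hdle j hj).trans (by push_cast; omega))
        (by
          have h1 := hconst d hdle
          have h2 := abs_sub (d * k) 1
          simp only [abs_one] at h2
          push_cast at h1 ⊢
          omega)
      rw [hsum, hsum, hd] at this
      constructor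
      · intro h0
        by_contra h1
        have h2 : ¬ d * ∑ j ∈ S, update l i 0 j * a j + (d * k - 1) < -l i * d * x := by
          nlinarith
        rw [this] at h2
        apply h1
        have h3 : 0 < d * (∑ j ∈ S, update l i 0 j * b j + l i * y + k) := by nlinarith
        exact pos_of_mul_pos_right h3 hd0.le
      · intro h0
        by_contra h1
        have h2 : ¬ d * ∑ j ∈ S, update l i 0 j * b j + (d * k - 1) < -l i * d * y := by
          nlinarith
        rw [← this] at h2
        apply h1
        have h3 : 0 < d * (∑ j ∈ S, update l i 0 j * a j + l i * x + k) := by nlinarith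
        exact pos_of_mul_pos_right h3 hd0.le
    · rw [hzero, zero_mul, zero_mul, add_zero, add_zero]
      have hup : update l i 0 = l := by rw [← hzero]; exact update_eq_self i l
      rw [hup]
      exact (h.mono (le_lift c)).1 l k hl hk
    · obtain ⟨d, hd⟩ : l i ∣ ((c ! : ℕ) : ℤ) := by
        have h1 : (l i).natAbs ∣ c ! :=
          Nat.dvd_factorial (by omega) (by rw [← Int.natCast_natAbs] at hli; omega)
        have h2 : ((l i).natAbs : ℤ) ∣ ((c ! : ℕ) : ℤ) := by exact_mod_cast h1
        simpa using h2
      have hd0 : 0 < d := by nlinarith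
      have hdle : |-d| ≤ (c ! : ℕ) := by rw [abs_neg, abs_of_pos hd0]; nlinarith
      have := hcut (fun j => -d * update l i 0 j) (-d * k)
        (fun j hj => (hcoef (-d) hdle j hj).trans (by push_cast; omega))
        ((hconst (-d) hdle).trans (by push_cast; omega))
      rw [hsum, hsum, hd] at this
      have e1 : ∀ s z : ℤ, 0 < s + l i * z + k ↔ -d * s + -d * k < l i * d * z := by
        intro s z
        rw [← mul_pos_iff_of_pos_left hd0, ← sub_pos (a := l i * d * z)]
        ring_nf
      rw [e1, e1]
      exact this
  · intro j hj
    by_cases hji : j = i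
    · subst hji
      rw [update_self, update_self]
      refine (Int.modEq_iff_dvd.2 ?_).symm
      rw [← mul_sub] at hmod'
      exact (mul_dvd_mul_iff_left hE.ne').1 hmod'
    · rw [update_of_ne hji, update_of_ne hji]
      exact (h.mono (le_lift c)).2 j hj

theorem le_iterate {f : ℕ → ℕ} (hf : ∀ x, x ≤ f x) (k x : ℕ) : x ≤ f^[k] x := by
  induction k with
  | zero => exact le_rfl
  | succ k ih => rw [iterate_succ_apply']; exact ih.trans (hf _)

theorem iterate_le_iterate {f : ℕ → ℕ} (hf : ∀ x, x ≤ f x) {j k : ℕ} (hjk : j ≤ k) (x : ℕ) :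
    f^[j] x ≤ f^[k] x := by
  obtain ⟨d, rfl⟩ := Nat.exists_eq_add_of_le hjk
  rw [Nat.add_comm, iterate_add_apply]
  exact le_iterate hf d _

/-- The values of `a'` at all coordinates in `s` are answered at once. -/
theorem Sim.exists_extend {S : Finset κ} (s : Finset κ) : s ⊆ S → ∀ {c T : ℕ} {a b a' : κ → ℤ},
    Sim S (lift^[#s] c) a b → (∀ j ∈ S, j ∉ s → a' j = a j) → lift^[#s] c ≤ T → #S ≤ T →
    (∀ i ∈ S, |b i| ≤ T) →
    ∃ b' : κ → ℤ, (∀ j ∉ s, b' j = b j) ∧ (∀ i ∈ S, |b' i| ≤ (grow^[#s] T : ℕ)) ∧ Sim S c a' b' := by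
  induction s using Finset.induction_on with
  | empty =>
    intro _ c T a b a' h ha' _ _ hb
    exact ⟨b, fun _ _ => rfl, hb, h.congr (fun i hi => ha' i hi (by simp)) fun _ _ => rfl⟩
  | insert i s hi ih =>
    intro hsS c T a b a' h ha' hcT hST hb
    rw [Finset.card_insert_of_notMem hi] at h hcT ⊢
    rw [iterate_succ_apply'] at h hcT
    have hiS : i ∈ S := hsS (Finset.mem_insert_self _ _)
    obtain ⟨y, hy, hsim⟩ := h.exists_update ((le_lift _).trans hcT) hST hb hiS (a' i)
    obtain ⟨b', hb', hbd, hsim'⟩ := ih (fun j hj => hsS (Finset.mem_insert_of_mem hj))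
      (T := grow T) (a' := a') hsim
      (fun j hjS hj => by
        by_cases hji : j = i
        · subst hji; rw [update_self]
        · rw [update_of_ne hji]
          exact ha' j hjS (by simp [hji, hj]))
      ((le_lift _).trans (hcT.trans (le_grow T))) (hST.trans (le_grow T))
      (fun j hj => by
        by_cases hji : j = i
        · subst hji; rw [update_self]; exact hy
        · rw [update_of_ne hji]
          exact (hb j hj).trans (by exact_mod_cast le_grow T))
    refine ⟨b', fun j hj => ?_, by rwa [← iterate_succ_apply] at hbd, hsim'⟩
    rw [Finset.mem_insert, not_or] at hj
    rw [hb' j hj.2, update_of_ne hj.1]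

/-- Every assignment is similar to a small one. -/
theorem Sim.exists_small (S : Finset κ) {c T : ℕ} (hc : lift^[#S] c ≤ T) (hS : #S ≤ T)
    (a : κ → ℤ) : ∃ b : κ → ℤ, (∀ i ∈ S, |b i| ≤ (grow^[#S] T : ℕ)) ∧ Sim S c a b := by
  -- The game starts from the zero assignment on both sides, which is similar to itself at every
  -- level, and all coordinates of `a` are played.
  obtain ⟨b, -, hb, h⟩ := Sim.exists_extend S subset_rfl (c := c) (T := T) (a := 0) (b := 0) (a' := a)
    (Sim.refl _ _ _) (fun j hj hj' => absurd hj hj') hc hS (fun i _ => by simp)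
  exact ⟨b, hb, h⟩

/-! ### Decomposition of an interval into cells -/

/-- An interval can be cut so that the elements of a finite set separate no two points of the same
piece. -/
theorem exists_cuts (C : Finset ℤ) {lo hi : ℤ} (h : lo ≤ hi) :
    ∃ p : ℕ → ℤ, Monotone p ∧ p 0 = lo ∧ (∀ j, #C < j → p j = hi) ∧
      ∀ (j : ℕ), ∀ i ∈ Set.Ioc (p j) (p (j + 1)), ∀ i' ∈ Set.Ioc (p j) (p (j + 1)),
        ∀ q ∈ C, (i ≤ q ↔ i' ≤ q) := by
  induction C using Finset.induction_on with
  | empty =>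
    refine ⟨fun j => if j = 0 then lo else hi, ?_, by simp, fun j hj => ?_, by simp⟩
    · refine monotone_nat_of_le_succ fun j => ?_
      simp only [Nat.add_eq_zero_iff, one_ne_zero, and_false, if_false]
      split_ifs <;> simp [h]
    · simp at hj; simp [hj.ne']
  | insert q C hq ih =>
    obtain ⟨p, hmono, h0, hhi, hsep⟩ := ih
    have hstep : ∀ j, p j ≤ p (j + 1) := fun j => hmono (Nat.le_succ j)
    -- The new point `q` is inserted in order: the cut with index `j + 1` is `q` clamped to `[p j, p
    -- (j + 1)]`. Cuts to the left of `q` keep their index, those to the right move up by one.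
    refine ⟨fun j => Nat.casesOn j (p 0) fun j => max (min q (p (j + 1))) (p j), ?_, h0, ?_, ?_⟩
    · refine monotone_nat_of_le_succ fun j => ?_
      rcases j with _ | j
      · simp
      · have := hstep j
        have := hstep (j + 1)
        simp only
        omega
    · intro j hj
      rw [Finset.card_insert_of_notMem hq] at hj
      rcases j with _ | j
      · omega
      · have h1 := hhi j (by omega)
        have h2 := hhi (j + 1) (by omega)
        simp only
        omega
    · intro j i hi i' hi' r hr
      simp only [Set.mem_Ioc] at hi hi'
      rw [Finset.mem_insert] at hr
      rcases j with _ | j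
      · have := hstep 0
        change p 0 < i ∧ i ≤ max (min q (p (0 + 1))) (p 0) at hi
        change p 0 < i' ∧ i' ≤ max (min q (p (0 + 1))) (p 0) at hi'
        rcases hr with rfl | hr
        · omega
        · exact hsep 0 i ⟨by omega, by omega⟩ i' ⟨by omega, by omega⟩ r hr
      · have h1 := hstep j
        have h2 := hstep (j + 1)
        simp only at hi hi'
        rcases hr with rfl | hr
        · omega
        · by_cases hqj : q ≤ p (j + 1)
          · exact hsep j i ⟨by omega, by omega⟩ i' ⟨by omega, by omega⟩ r hr
          · exact hsep (j + 1) i ⟨by omega, by omega⟩ i' ⟨by omega, by omega⟩ r hr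

/-- A number of pieces that suffices for `exists_cells`. -/
def cellCount (s c : ℕ) : ℕ := (2 * c + 1) ^ s * ((2 * c + 3) * c) + 1

/-- An interval can be cut so that points of one piece that are congruent modulo `c!` are
indistinguishable at level `c` from the outside. -/
theorem exists_cells {S : Finset κ} {c s : ℕ} (hs : #S ≤ s) (w : κ → ℤ) {x : κ} (hx : x ∈ S)
    {lo hi : ℤ} (h : lo ≤ hi) :
    ∃ p : ℕ → ℤ, Monotone p ∧ p 0 = lo ∧ p (cellCount s c) = hi ∧
      ∀ (j : ℕ), ∀ i ∈ Set.Ioc (p j) (p (j + 1)), ∀ i' ∈ Set.Ioc (p j) (p (j + 1)),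
        i ≡ i' [ZMOD (c ! : ℕ)] → Sim S c (update w x i) (update w x i') := by
  -- As a function of the value `i` of `x`, a form changes sign where `i` passes the floor of a
  -- quotient `(rest of the form) / |l x|`; these floors are the cuts. Constants up to `c + 1` are
  -- admitted because a strict inequality with negative `l x` is rewritten as a weak one with `k -
  -- 1`.
  let forms : Finset ((∀ j ∈ S, ℤ) × ℤ × ℤ) :=
    S.pi (fun _ => Icc (-(c : ℤ)) c) ×ˢ Icc (-((c : ℤ) + 1)) (c + 1) ×ˢ Icc 1 (c : ℤ)
  let cut : ((∀ j ∈ S, ℤ) × ℤ × ℤ) → ℤ := fun f =>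
    (∑ j ∈ S.attach, update (fun j : κ => if hj : j ∈ S then f.1 j hj else 0) x 0 j * w j + f.2.1)
      / f.2.2
  have hcut : ∀ (l : κ → ℤ) (k e : ℤ), (∀ j ∈ S, |l j| ≤ c) → |k| ≤ c + 1 → 0 < e → e ≤ c →
      (∑ j ∈ S, update l x 0 j * w j + k) / e ∈ forms.image cut := by
    intro l k e hl hk he he'
    refine Finset.mem_image.2 ⟨⟨fun j _ => l j, k, e⟩, ?_, ?_⟩
    · simp only [forms, Finset.mem_product, Finset.mem_pi, Finset.mem_Icc]
      exact ⟨fun j hj => abs_le.1 (hl j hj), abs_le.1 hk, by omega, he'⟩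
    · simp only [cut]
      rw [← Finset.sum_attach S (fun j => update l x 0 j * w j)]
      congr 2
      refine Finset.sum_congr rfl fun j _ => ?_
      by_cases hj : (j : κ) = x
      · rw [hj, update_self, update_self]
      · rw [update_of_ne hj, update_of_ne hj, dif_pos j.2]
  have hcard : #(forms.image cut) < cellCount s c := by
    refine Nat.lt_succ_of_le (Finset.card_image_le.trans ?_)
    simp only [forms, Finset.card_product, Finset.card_pi, Int.card_Icc, Finset.prod_const]
    have e1 : ((c : ℤ) + 1 - -(c : ℤ)).toNat = 2 * c + 1 := by omega
    have e2 : ((c : ℤ) + 1 + 1 - -((c : ℤ) + 1)).toNat = 2 * c + 3 := by omega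
    have e3 : ((c : ℤ) + 1 - 1).toNat = c := by omega
    rw [e1, e2, e3]
    exact Nat.mul_le_mul_right _ (Nat.pow_le_pow_right (by omega) hs)
  obtain ⟨p, hmono, h0, hhi, hsep⟩ := exists_cuts (forms.image cut) h
  refine ⟨p, hmono, h0, hhi _ hcard, fun j i hi i' hi' hmod => ⟨fun l k hl hk => ?_, fun y hy => ?_⟩⟩
  · rw [sum_mul_update hx, sum_mul_update hx]
    have hlx := hl x hx
    rcases lt_trichotomy (l x) 0 with hneg | hzero | hpos
    · have hq := hsep j i hi i' hi' _ (hcut l (k - 1) (-l x) hl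
        (by have := abs_sub k 1; simp only [abs_one] at this; omega) (by omega)
        (by have := neg_le_abs (l x); omega))
      rw [Int.le_ediv_iff_mul_le (by omega), Int.le_ediv_iff_mul_le (by omega)] at hq
      constructor
      · intro h1
        have := hq.1 (by nlinarith)
        nlinarith
      · intro h1
        have := hq.2 (by nlinarith)
        nlinarith
    · rw [hzero, zero_mul, zero_mul]
    · have hq := hsep j i hi i' hi' _ (hcut (fun y => - l y) (-k) (l x)
        (fun y hy => by rw [abs_neg]; exact hl y hy)
        (by rw [abs_neg]; omega) hpos (by have := le_abs_self (l x); omega))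
      have hneg : ∑ y ∈ S, update (fun y => - l y) x 0 y * w y = - ∑ y ∈ S, update l x 0 y * w y := by
        rw [← Finset.sum_neg_distrib]
        refine Finset.sum_congr rfl fun y _ => ?_
        by_cases hyx : y = x
        · rw [hyx, update_self, update_self, zero_mul, neg_zero]
        · rw [update_of_ne hyx, update_of_ne hyx, neg_mul]
      rw [Int.le_ediv_iff_mul_le hpos, Int.le_ediv_iff_mul_le hpos, hneg] at hq
      rw [← not_iff_not]
      constructor
      · intro h1
        have := hq.1 (by nlinarith)
        nlinarith
      · intro h1
        have := hq.2 (by nlinarith)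
        nlinarith
  · by_cases hyx : y = x
    · subst hyx; rw [update_self, update_self]; exact hmod
    · rw [update_of_ne hyx, update_of_ne hyx]

end Sim

/-! ### Evaluation of basic formulae -/

/-- The atomic terms of basic formulae: parameters, variables, and terms `a(y)`. -/
inductive Ix : Type
  | par (p : ℕ)
  | var (y : ℕ)
  | app (a y : ℕ)
  deriving DecidableEq

/-- The atomic terms in which all names are below `n`. -/
def Idx (n : ℕ) : Finset Ix :=
  (range n).image Ix.par ∪ ((range n).image Ix.var ∪
    (range n ×ˢ range n).image fun q => Ix.app q.1 q.2)

@[simp] theorem par_mem_Idx {n p : ℕ} : Ix.par p ∈ Idx n ↔ p < n := by simp [Idx]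

@[simp] theorem var_mem_Idx {n y : ℕ} : Ix.var y ∈ Idx n ↔ y < n := by simp [Idx]

@[simp] theorem app_mem_Idx {n a y : ℕ} : Ix.app a y ∈ Idx n ↔ a < n ∧ y < n := by simp [Idx]

theorem card_Idx_le (n : ℕ) : #(Idx n) ≤ n + (n + n * n) := by
  refine (card_union_le _ _).trans (Nat.add_le_add ?_ ((card_union_le _ _).trans
    (Nat.add_le_add ?_ ?_)))
  · exact card_image_le.trans (card_range n).le
  · exact card_image_le.trans (card_range n).le
  · exact card_image_le.trans (by simp)

/-- The value of a basic term, given values of the atomic terms. -/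
def Term.aval (e : Ix → ℤ) : Term → ℤ
  | .num n => n
  | .par p => e (.par p)
  | .var y => e (.var y)
  | .add t u => t.aval e + u.aval e
  | .neg t => - t.aval e
  | .app a (.var y) => e (.app a y)
  | .app _ _ => 0
  | .card _ _ => 0

/-- Truth of a basic formula, given values of the atomic terms; quantifiers over the subformula with
Gödel number `m` range over the `i` that satisfy `Q m i`. -/
def Formula.Sat (Q : ℕ → ℤ → Prop) : Formula → (Ix → ℤ) → Prop
  | .lt t u, e => t.aval e < u.aval e
  | .eq t u, e => t.aval e = u.aval e
  | .modEq n t u, e => t.aval e ≡ u.aval e [ZMOD (n : ℤ)]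
  | .and φ ψ, e => φ.Sat Q e ∧ ψ.Sat Q e
  | .not φ, e => ¬ φ.Sat Q e
  | .ex x φ, e => ∃ i : ℤ, Q (Formula.ex x φ).code i ∧ φ.Sat Q (update e (.var x) i)

-- Semantics with restricted quantifiers

mutual

/-- The value of a term when quantifiers are restricted by `Q`. -/
noncomputable def Term.reval (Q : ℕ → ℤ → Prop) (I : Interp) : Term → (ℕ → ℤ) → ℤ
  | .num n, _ => n
  | .par p, _ => I.par p
  | .var x, v => v x
  | .add t u, v => t.reval Q I v + u.reval Q I v
  | .neg t, v => - t.reval Q I v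
  | .app a t, v => I.arr a (t.reval Q I v)
  | .card x φ, v =>
    (Set.ncard {i : ℤ | (0 ≤ i ∧ i < I.par 0) ∧ φ.RHolds Q I (Function.update v x i)} : ℤ)

/-- Truth of a formula when quantifiers are restricted by `Q`. -/
noncomputable def Formula.RHolds (Q : ℕ → ℤ → Prop) (I : Interp) : Formula → (ℕ → ℤ) → Prop
  | .lt t u, v => t.reval Q I v < u.reval Q I v
  | .eq t u, v => t.reval Q I v = u.reval Q I v
  | .modEq n t u, v => t.reval Q I v ≡ u.reval Q I v [ZMOD (n : ℤ)]
  | .and φ ψ, v => φ.RHolds Q I v ∧ ψ.RHolds Q I v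
  | .not φ, v => ¬ φ.RHolds Q I v
  | .ex x φ, v => ∃ i : ℤ, Q (Formula.ex x φ).code i ∧ φ.RHolds Q I (Function.update v x i)

end

mutual

theorem Term.reval_true (I : Interp) : ∀ (t : Term) (v : ℕ → ℤ),
    t.reval (fun _ _ => True) I v = t.eval I v
  | .num n, v => by simp only [Term.reval, Term.eval]
  | .par p, v => by simp only [Term.reval, Term.eval]
  | .var x, v => by simp only [Term.reval, Term.eval]
  | .add t u, v => by
    simp only [Term.reval, Term.eval, Term.reval_true I t, Term.reval_true I u]
  | .neg t, v => by simp only [Term.reval, Term.eval, Term.reval_true I t]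
  | .app a t, v => by simp only [Term.reval, Term.eval, Term.reval_true I t]
  | .card x φ, v => by simp only [Term.reval, Term.eval, Formula.rHolds_true I φ]

theorem Formula.rHolds_true (I : Interp) : ∀ (φ : Formula) (v : ℕ → ℤ),
    φ.RHolds (fun _ _ => True) I v ↔ φ.Holds I v
  | .lt t u, v => by
    simp only [Formula.RHolds, Formula.Holds, Term.reval_true I t, Term.reval_true I u]
  | .eq t u, v => by
    simp only [Formula.RHolds, Formula.Holds, Term.reval_true I t, Term.reval_true I u]
  | .modEq n t u, v => by
    simp only [Formula.RHolds, Formula.Holds, Term.reval_true I t, Term.reval_true I u]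
  | .and φ ψ, v => by
    simp only [Formula.RHolds, Formula.Holds, Formula.rHolds_true I φ, Formula.rHolds_true I ψ]
  | .not φ, v => by simp only [Formula.RHolds, Formula.Holds, Formula.rHolds_true I φ]
  | .ex x φ, v => by
    simp only [Formula.RHolds, Formula.Holds, Formula.rHolds_true I φ, true_and]

end

/-- Every name in a term is at most its Gödel number, so agreement on names below `n` suffices.
Array values are required only at variables outside `B`, since a basic term applies arrays to no
others; this lets the values of `a(y)` stay unchanged while a quantifier over `y` changes the value
of `y`. -/
theorem Term.reval_eq_aval {Q : ℕ → ℤ → Prop} {I : Interp} {n : ℕ} {v : ℕ → ℤ} {e : Ix → ℤ}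
    {B : List ℕ} (hp : ∀ p < n, e (.par p) = I.par p) : ∀ t : Term, t.IsBasic B → t.code < n →
    (∀ y < n, t.Free y → e (.var y) = v y) →
    (∀ y < n, y ∉ B → t.Free y → ∀ a < n, e (.app a y) = I.arr a (v y)) →
    t.reval Q I v = t.aval e
  | .num m, _, _, _, _ => by simp only [Term.reval, Term.aval]
  | .par p, _, hn, _, _ => by
    simp only [Term.code] at hn
    simp only [Term.reval, Term.aval]
    exact (hp p (by omega)).symm
  | .var y, _, hn, hv, _ => by
    simp only [Term.code] at hn
    simp only [Term.reval, Term.aval]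
    exact (hv y (by omega) rfl).symm
  | .add t u, hB, hn, hv, ha => by
    simp only [Term.code] at hn
    have h1 := Nat.left_le_pair t.code u.code
    have h2 := Nat.right_le_pair t.code u.code
    simp only [Term.reval, Term.aval]
    rw [Term.reval_eq_aval hp t hB.1 (by omega) (fun y hy h => hv y hy (Or.inl h))
        (fun y hy hb h => ha y hy hb (Or.inl h)),
      Term.reval_eq_aval hp u hB.2 (by omega) (fun y hy h => hv y hy (Or.inr h))
        (fun y hy hb h => ha y hy hb (Or.inr h))]
  | .neg t, hB, hn, hv, ha => by
    simp only [Term.code] at hn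
    simp only [Term.reval, Term.aval]
    rw [Term.reval_eq_aval hp t hB (by omega) hv ha]
  | .app a t, hB, hn, hv, ha => by
    obtain ⟨y, rfl, hy⟩ := hB
    simp only [Term.code] at hn
    have h1 := Nat.left_le_pair a (7 * y + 2)
    have h2 := Nat.right_le_pair a (7 * y + 2)
    simp only [Term.reval, Term.aval]
    exact (ha y (by omega) hy rfl a (by omega)).symm
  | .card _ _, hB, _, _, _ => hB.elim

/-- A basic formula depends only on the values of the atomic terms that occur free in it. -/
theorem Formula.rHolds_iff_sat {Q : ℕ → ℤ → Prop} {I : Interp} {n : ℕ} {v : ℕ → ℤ} {e : Ix → ℤ}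
    {B : List ℕ} {φ : Formula} (hB : φ.IsBasicIn B) (hn : φ.code < n)
    (hp : ∀ p < n, e (.par p) = I.par p)
    (hv : ∀ y < n, φ.Free y → e (.var y) = v y)
    (ha : ∀ y < n, y ∉ B → φ.Free y → ∀ a < n, e (.app a y) = I.arr a (v y)) :
    φ.RHolds Q I v ↔ φ.Sat Q e := by
  match φ, hB with
  | .lt t u, hB | .eq t u, hB =>
    simp only [Formula.code] at hn
    have h1 := Nat.left_le_pair t.code u.code
    have h2 := Nat.right_le_pair t.code u.code
    simp only [Formula.RHolds, Formula.Sat]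
    rw [Term.reval_eq_aval hp t hB.1 (by omega) (fun y hy h => hv y hy (Or.inl h))
        (fun y hy hb h => ha y hy hb (Or.inl h)),
      Term.reval_eq_aval hp u hB.2 (by omega) (fun y hy h => hv y hy (Or.inr h))
        (fun y hy hb h => ha y hy hb (Or.inr h))]
  | .modEq m t u, hB =>
    simp only [Formula.code] at hn
    have h1 := Nat.left_le_pair t.code u.code
    have h2 := Nat.right_le_pair t.code u.code
    have h3 := Nat.right_le_pair m (Nat.pair t.code u.code)
    simp only [Formula.RHolds, Formula.Sat]
    rw [Term.reval_eq_aval hp t hB.1 (by omega) (fun y hy h => hv y hy (Or.inl h))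
        (fun y hy hb h => ha y hy hb (Or.inl h)),
      Term.reval_eq_aval hp u hB.2 (by omega) (fun y hy h => hv y hy (Or.inr h))
        (fun y hy hb h => ha y hy hb (Or.inr h))]
  | .and φ ψ, hB =>
    simp only [Formula.code] at hn
    have h1 := Nat.left_le_pair φ.code ψ.code
    have h2 := Nat.right_le_pair φ.code ψ.code
    simp only [Formula.RHolds, Formula.Sat]
    rw [Formula.rHolds_iff_sat hB.1 (by omega) hp (fun y hy h => hv y hy (Or.inl h))
        (fun y hy hb h => ha y hy hb (Or.inl h)),
      Formula.rHolds_iff_sat hB.2 (by omega) hp (fun y hy h => hv y hy (Or.inr h))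
        (fun y hy hb h => ha y hy hb (Or.inr h))]
  | .not φ, hB =>
    simp only [Formula.code] at hn
    simp only [Formula.RHolds, Formula.Sat]
    rw [Formula.rHolds_iff_sat (φ := φ) hB (by omega) hp hv ha]
  | .ex x φ, hB =>
    have hn' := hn
    simp only [Formula.code] at hn
    have h1 := Nat.left_le_pair x φ.code
    have h2 := Nat.right_le_pair x φ.code
    simp only [Formula.RHolds, Formula.Sat]
    refine exists_congr fun i => and_congr_right fun _ => ?_
    refine Formula.rHolds_iff_sat (n := n) (B := x :: B) (φ := φ) hB (by omega) (fun p hpn => ?_)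
      (fun y hy h => ?_) (fun y hy hb h a han => ?_)
    · rw [update_of_ne (by simp)]; exact hp p hpn
    · by_cases hyx : y = x
      · subst hyx; rw [update_self, update_self]
      · rw [update_of_ne (by simpa using hyx), update_of_ne hyx]
        exact hv y hy ⟨hyx, h⟩
    · rw [List.mem_cons, not_or] at hb
      rw [update_of_ne (by simp), update_of_ne hb.1]
      exact ha y hy hb.2 ⟨hb.1, h⟩ a han
termination_by φ.code
decreasing_by
  all_goals simp only [Formula.code]
  all_goals first
    | have := Nat.left_le_pair φ.code ψ.code
      have := Nat.right_le_pair φ.code ψ.code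
      omega
    | have := Nat.right_le_pair x φ.code
      omega
    | omega

/-! ### Basic formulae do not distinguish similar assignments -/

/-- The Gödel number itself bounds the coefficients, because `Nat.pair` dominates the sum of its
arguments. -/
theorem Term.exists_affine {n : ℕ} {B : List ℕ} : ∀ t : Term, t.IsBasic B → t.code < n →
    ∃ (l : Ix → ℤ) (k : ℤ), (∀ i, |l i| ≤ t.code) ∧ |k| ≤ t.code ∧
      ∀ e, t.aval e = ∑ i ∈ Idx n, l i * e i + k
  | .num m, _, _ => ⟨0, m, by simp, by simp only [Term.code, Nat.abs_cast]; omega,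
      fun e => by simp [Term.aval]⟩
  | .par p, _, hn => by
    simp only [Term.code] at hn
    refine ⟨Pi.single (.par p) 1, 0, fun i => ?_, by simp, fun e => ?_⟩
    · by_cases h : i = .par p
      · subst h; simp [Term.code]
      · rw [Pi.single_eq_of_ne h]; simp
    · rw [Finset.sum_eq_single_of_mem (Ix.par p) (by simp; omega)
        (fun b _ hb => by rw [Pi.single_eq_of_ne hb, zero_mul])]
      simp [Term.aval]
  | .var p, _, hn => by
    simp only [Term.code] at hn
    refine ⟨Pi.single (.var p) 1, 0, fun i => ?_, by simp, fun e => ?_⟩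
    · by_cases h : i = .var p
      · subst h; simp [Term.code]; omega
      · rw [Pi.single_eq_of_ne h]; simp
    · rw [Finset.sum_eq_single_of_mem (Ix.var p) (by simp; omega)
        (fun b _ hb => by rw [Pi.single_eq_of_ne hb, zero_mul])]
      simp [Term.aval]
  | .add t u, hB, hn => by
    simp only [Term.code] at hn
    have h1 := Nat.left_le_pair t.code u.code
    have h2 := Nat.right_le_pair t.code u.code
    have h3 := Nat.add_le_pair t.code u.code
    obtain ⟨l, k, hl, hk, h⟩ := Term.exists_affine (n := n) t hB.1 (by omega)
    obtain ⟨l', k', hl', hk', h'⟩ := Term.exists_affine (n := n) u hB.2 (by omega)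
    refine ⟨l + l', k + k', fun i => ?_, ?_, fun e => ?_⟩
    · have := abs_add_le (l i) (l' i)
      have := hl i
      have := hl' i
      simp only [Term.code, Pi.add_apply]; omega
    · have := abs_add_le k k'
      simp only [Term.code]; omega
    · simp only [Term.aval, h, h', Pi.add_apply, add_mul, Finset.sum_add_distrib]; ring
  | .neg t, hB, hn => by
    simp only [Term.code] at hn
    obtain ⟨l, k, hl, hk, h⟩ := Term.exists_affine (n := n) t hB (by omega)
    refine ⟨-l, -k, fun i => ?_, ?_, fun e => ?_⟩
    · have := hl i
      simp only [Term.code, Pi.neg_apply, abs_neg]; omega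
    · simp only [Term.code, abs_neg]; omega
    · simp only [Term.aval, h, Pi.neg_apply, neg_mul, Finset.sum_neg_distrib]; ring
  | .app a t, hB, hn => by
    obtain ⟨y, rfl, hy⟩ := hB
    simp only [Term.code] at hn
    have h1 := Nat.left_le_pair a (7 * y + 2)
    have h2 := Nat.right_le_pair a (7 * y + 2)
    refine ⟨Pi.single (.app a y) 1, 0, fun i => ?_, by simp, fun e => ?_⟩
    · by_cases h : i = .app a y
      · subst h; simp [Term.code]; omega
      · rw [Pi.single_eq_of_ne h]; simp
    · rw [Finset.sum_eq_single_of_mem (Ix.app a y) (by simp; omega)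
        (fun b _ hb => by rw [Pi.single_eq_of_ne hb, zero_mul])]
      simp [Term.aval]
  | .card _ _, hB, _ => hB.elim

/-- The difference of the two terms is one affine form whose coefficients are at most the sum of the
Gödel numbers, so its sign and vanishing transfer. The congruence needs no bound on the
coefficients. -/
theorem Sim.aval_sub {n c : ℕ} {B : List ℕ} {a b : Ix → ℤ} (h : Sim (Idx n) c a b) {t u : Term}
    (ht : t.IsBasic B) (hu : u.IsBasic B) (htn : t.code < n) (hun : u.code < n)
    (hc : t.code + u.code ≤ c) :
    (t.aval a < u.aval a ↔ t.aval b < u.aval b) ∧ (t.aval a = u.aval a ↔ t.aval b = u.aval b) ∧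
      t.aval a - u.aval a ≡ t.aval b - u.aval b [ZMOD (c.factorial : ℕ)] := by
  obtain ⟨l, k, hl, hk, h1⟩ := t.exists_affine ht htn
  obtain ⟨l', k', hl', hk', h2⟩ := u.exists_affine hu hun
  have hcz : (t.code : ℤ) + u.code ≤ c := by exact_mod_cast hc
  have key : ∀ e, u.aval e - t.aval e = ∑ i ∈ Idx n, (l' i - l i) * e i + (k' - k) := by
    intro e
    simp only [h1, h2, sub_mul, Finset.sum_sub_distrib]; ring
  have hL : ∀ i ∈ Idx n, |l' i - l i| ≤ c := by
    intro i _
    have := abs_sub (l' i) (l i)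
    have := hl i
    have := hl' i
    omega
  have hK : |k' - k| ≤ c := by
    have := abs_sub k' k
    omega
  have h3 := h.1 (fun i => l' i - l i) (k' - k) hL hK
  have h4 := h.eq_zero_iff (fun i => l' i - l i) (k' - k) hL hK
  rw [← key, ← key] at h3 h4
  refine ⟨by omega, by omega, ?_⟩
  have e1 : ∀ e, t.aval e - u.aval e = -(∑ i ∈ Idx n, (l' i - l i) * e i + (k' - k)) := by
    intro e; rw [← key]; ring
  rw [e1, e1]
  exact ((Int.ModEq.sum fun i hi => (h.2 i hi).mul_left _).add_right _).neg

/-- Basic formulae of bounded size do not distinguish assignments that are similar at a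
sufficiently high level. -/
theorem Formula.sat_iff_of_sim {n : ℕ} (φ : Formula) : ∀ {B : List ℕ} {c k : ℕ} {a b : Ix → ℤ},
    φ.IsBasicIn B → φ.code < n → φ.code ≤ c → φ.code ≤ k → Sim (Idx n) (lift^[k] c) a b →
    (φ.Sat (fun _ _ => True) a ↔ φ.Sat (fun _ _ => True) b) := by
  intro B c k a b hB hn hc hk h
  have hc' : φ.code ≤ lift^[k] c := hc.trans (le_iterate le_lift k c)
  match φ, hB with
  | .lt t u, hB =>
    simp only [Formula.code] at hn hc'
    have h3 := Nat.add_le_pair t.code u.code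
    exact (h.aval_sub hB.1 hB.2 (by omega) (by omega) (by omega)).1
  | .eq t u, hB =>
    simp only [Formula.code] at hn hc'
    have h3 := Nat.add_le_pair t.code u.code
    exact (h.aval_sub hB.1 hB.2 (by omega) (by omega) (by omega)).2.1
  | .modEq m t u, hB =>
    simp only [Formula.code] at hn hc'
    have h3 := Nat.add_le_pair t.code u.code
    have h4 := Nat.add_le_pair m (Nat.pair t.code u.code)
    have h5 := h.aval_sub hB.1 hB.2 (by omega) (by omega) (by omega)
    simp only [Formula.Sat]
    -- Congruence modulo `0` is equality; a positive modulus is at most the level and hence divides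
    -- its factorial.
    rcases Nat.eq_zero_or_pos m with rfl | hm
    · simpa [Int.modEq_zero_iff] using h5.2.1
    · have h6 : t.aval a - u.aval a ≡ t.aval b - u.aval b [ZMOD (m : ℤ)] :=
        h5.2.2.of_dvd (by exact_mod_cast Nat.dvd_factorial hm (by omega))
      rw [Int.modEq_iff_dvd, Int.modEq_iff_dvd, ← dvd_neg, ← dvd_neg (b := u.aval b - _),
        neg_sub, neg_sub]
      rw [Int.dvd_iff_emod_eq_zero, Int.dvd_iff_emod_eq_zero, h6.eq]
  | .and φ ψ, hB =>
    simp only [Formula.code] at hn hc hk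
    have h3 := Nat.add_le_pair φ.code ψ.code
    simp only [Formula.Sat]
    rw [Formula.sat_iff_of_sim φ hB.1 (by omega) (by omega) (by omega) h,
      Formula.sat_iff_of_sim ψ hB.2 (by omega) (by omega) (by omega) h]
  | .not φ, hB =>
    simp only [Formula.code] at hn hc hk
    simp only [Formula.Sat]
    rw [Formula.sat_iff_of_sim φ hB (by omega) (by omega) (by omega) h]
  | .ex x φ, hB =>
    simp only [Formula.code] at hn hc hk
    have h3 := Nat.add_le_pair x φ.code
    obtain ⟨k, rfl⟩ : ∃ k', k = k' + 1 := ⟨k - 1, by omega⟩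
    rw [iterate_succ_apply'] at h
    have key : ∀ {a b : Ix → ℤ}, Sim (Idx n) (lift (lift^[k] c)) a b →
        (∃ i : ℤ, True ∧ φ.Sat (fun _ _ => True) (update a (.var x) i)) →
        ∃ i : ℤ, True ∧ φ.Sat (fun _ _ => True) (update b (.var x) i) := by
      rintro a b h ⟨i, -, hi⟩
      -- The size of the answer is irrelevant here, so `T` is any number that bounds the entries of
      -- `b` and meets the other requirements.
      obtain ⟨j, -, hj⟩ := h.exists_update
        (T := lift^[k] c + #(Idx n) + ∑ i ∈ Idx n, (b i).natAbs) (by omega) (by omega)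
        (fun i hi => by
          have := Finset.single_le_sum (f := fun i => (b i).natAbs) (fun _ _ => Nat.zero_le _) hi
          rw [← Int.natCast_natAbs]; omega)
        (i := .var x) (by simp; omega) i
      exact ⟨j, trivial,
        (Formula.sat_iff_of_sim φ (B := x :: B) hB (by omega) (by omega) (by omega) hj).1 hi⟩
    exact ⟨key h, key h.symm⟩
termination_by φ.code
decreasing_by
  all_goals simp only [Formula.code]
  all_goals omega

/-- In basic formulae the quantifiers can be bounded. -/
theorem Formula.sat_bounded_iff {n : ℕ} {r : ℕ → ℕ} (hr : ∀ m < n, grow (r (m + 1)) ≤ r m)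
    (hL : lift^[n] n ≤ r n) (hS : #(Idx n) ≤ r n) (φ : Formula) :
    ∀ {B : List ℕ} {e : Ix → ℤ}, φ.IsBasicIn B → φ.code < n →
    (∀ i ∈ Idx n, |e i| ≤ r (φ.code + 1)) →
    (φ.Sat (fun m i => |i| ≤ r m) e ↔ φ.Sat (fun _ _ => True) e) := by
  intro B e hB hn he
  have hanti : ∀ {m m' : ℕ}, m ≤ m' → m' ≤ n → r m' ≤ r m := by
    intro m m' hm hm'
    induction m', hm using Nat.le_induction with
    | base => exact le_rfl
    | succ m' _ ih => exact ((le_grow _).trans (hr m' (by omega))).trans (ih (by omega))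
  have hanti' : ∀ {m m' : ℕ}, m ≤ m' → m' ≤ n → (r m' : ℤ) ≤ r m := fun h h' => by
    exact_mod_cast hanti h h'
  match φ, hB with
  | .lt t u, hB | .eq t u, hB | .modEq m t u, hB => exact Iff.rfl
  | .and φ ψ, hB =>
    have hn' := hn
    simp only [Formula.code] at hn he
    have h3 := Nat.add_le_pair φ.code ψ.code
    simp only [Formula.Sat]
    rw [Formula.sat_bounded_iff hr hL hS φ hB.1 (by omega)
        (fun i hi => (he i hi).trans (hanti' (by omega) (by omega))),
      Formula.sat_bounded_iff hr hL hS ψ hB.2 (by omega)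
        (fun i hi => (he i hi).trans (hanti' (by omega) (by omega)))]
  | .not φ, hB =>
    simp only [Formula.code] at hn he
    simp only [Formula.Sat]
    rw [Formula.sat_bounded_iff hr hL hS φ hB (by omega)
        (fun i hi => (he i hi).trans (hanti' (by omega) (by omega)))]
  | .ex x φ, hB =>
    have h3 := Nat.add_le_pair x φ.code
    have hcode : φ.code + 1 ≤ (Formula.ex x φ).code := by simp only [Formula.code]; omega
    have hx : x < n := by simp only [Formula.code] at hn; omega
    have hstep := hr _ hn
    simp only [Formula.Sat]
    have ih : ∀ i : ℤ, |i| ≤ r (Formula.ex x φ).code →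
        (φ.Sat (fun m i => |i| ≤ r m) (update e (.var x) i) ↔
          φ.Sat (fun _ _ => True) (update e (.var x) i)) := by
      intro i hi
      refine Formula.sat_bounded_iff hr hL hS φ (B := x :: B) hB (by omega) fun j hj => ?_
      by_cases hjx : j = .var x
      · subst hjx; rw [update_self]; exact hi.trans (hanti' hcode hn.le)
      · rw [update_of_ne hjx]; exact (he j hj).trans (hanti' (by omega) (by omega))
    constructor
    · rintro ⟨i, hi, h⟩
      exact ⟨i, trivial, (ih i hi).1 h⟩
    · rintro ⟨i, -, h⟩
      -- The game is played from `e` to itself: an arbitrary witness `i` is answered by a bounded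
      -- witness `j` that `φ` cannot tell from it.
      obtain ⟨j, hj, hsim⟩ := (Sim.refl (Idx n) (lift (lift^[n] n)) e).exists_update
        (T := r ((Formula.ex x φ).code + 1)) (hL.trans (hanti hn le_rfl))
        (hS.trans (hanti hn le_rfl)) he (i := .var x) (by simpa using hx) i
      have hj' : |j| ≤ r (Formula.ex x φ).code := hj.trans (by exact_mod_cast hstep)
      exact ⟨j, hj', (ih j hj').2 ((φ.sat_iff_of_sim (B := x :: B) hB (by omega) (by omega) (by omega) hsim).1 h)⟩
termination_by φ.code
decreasing_by
  all_goals simp only [Formula.code]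
  all_goals omega

/-! ### Distribution of types over cells -/

/-- Blocks of the prescribed sizes are split off one type at a time; the total size matches, so
nothing remains. -/
theorem exists_fun_card_fiber {ι τ : Type*} [DecidableEq ι] [DecidableEq τ] [Nonempty τ]
    (A : Finset τ) (f : τ → ℕ) : ∀ X : Finset ι, #X = ∑ t ∈ A, f t →
    ∃ g : ι → τ, (∀ x ∈ X, g x ∈ A) ∧ ∀ t ∈ A, #{x ∈ X | g x = t} = f t := by
  induction A using Finset.induction_on with
  | empty =>
    intro X hX
    rw [Finset.sum_empty, Finset.card_eq_zero] at hX
    subst hX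
    exact ⟨fun _ => Classical.arbitrary τ, by simp, by simp⟩
  | insert t A ht ih =>
    intro X hX
    rw [Finset.sum_insert ht] at hX
    obtain ⟨Y, hYX, hY⟩ := Finset.exists_subset_card_eq (s := X) (n := f t) (by omega)
    obtain ⟨g, hgA, hg⟩ := ih (X \ Y) (by rw [Finset.card_sdiff_of_subset hYX]; omega)
    refine ⟨fun x => if x ∈ Y then t else g x, fun x hx => ?_, fun u hu => ?_⟩
    · by_cases hxY : x ∈ Y
      · simp [hxY]
      · simp only [hxY, if_false]
        exact Finset.mem_insert_of_mem (hgA x (by simp [hx, hxY]))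
    · rcases Finset.mem_insert.1 hu with rfl | huA
      · rw [← hY]
        congr 1
        ext x
        simp only [Finset.mem_filter]
        constructor
        · rintro ⟨hx, hx'⟩
          by_contra hxY
          rw [if_neg hxY] at hx'
          exact ht (hx' ▸ hgA x (by simp [hx, hxY]))
        · intro hx
          exact ⟨hYX hx, if_pos hx⟩
      · rw [← hg u huA]
        congr 1
        ext x
        have htu : t ≠ u := fun h => ht (h ▸ huA)
        by_cases hxY : x ∈ Y <;> simp [hxY, htu]

theorem card_filter_Ioc_eq_sum {p : ℕ → ℤ} (hp : Monotone p) (P : ℤ → Prop) [DecidablePred P]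
    (r : ℕ) : #{i ∈ Ioc (p 0) (p r) | P i} = ∑ j ∈ range r, #{i ∈ Ioc (p j) (p (j + 1)) | P i} := by
  induction r with
  | zero => simp
  | succ r ih =>
    rw [Finset.sum_range_succ, ← ih,
      ← Finset.Ioc_union_Ioc_eq_Ioc (hp (Nat.zero_le r)) (hp (Nat.le_succ r)),
      Finset.filter_union, Finset.card_union_of_disjoint]
    refine Finset.disjoint_filter_filter (Finset.disjoint_left.2 fun i hi hi' => ?_)
    rw [Finset.mem_Ioc] at hi hi'
    omega

theorem exists_mem_Ioc {p : ℕ → ℤ} {i : ℤ} : ∀ {r : ℕ}, i ∈ Ioc (p 0) (p r) →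
    ∃ j < r, i ∈ Ioc (p j) (p (j + 1))
  | 0, h => by simp at h
  | r + 1, h => by
    rw [Finset.mem_Ioc] at h
    by_cases hi : i ≤ p r
    · obtain ⟨j, hj, hij⟩ := exists_mem_Ioc (p := p) (i := i) (r := r) (Finset.mem_Ioc.2 ⟨h.1, hi⟩)
      exact ⟨j, by omega, hij⟩
    · exact ⟨r, by omega, Finset.mem_Ioc.2 ⟨by omega, h.2⟩⟩

theorem card_filter_eq_sum_residues (X : Finset ℤ) {m : ℕ} (hm : 0 < m) (P : ℤ → Prop)
    [DecidablePred P] :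
    #{i ∈ X | P i} = ∑ ρ ∈ range m, #{i ∈ X | (i % (m : ℤ)).toNat = ρ ∧ P i} := by
  have hmz : (0 : ℤ) < m := by exact_mod_cast hm
  rw [Finset.card_eq_sum_card_fiberwise (f := fun i : ℤ => (i % (m : ℤ)).toNat) (t := range m)]
  · refine Finset.sum_congr rfl fun ρ _ => ?_
    rw [Finset.filter_filter]
    congr 1
    ext i
    simp only [Finset.mem_filter]
    tauto
  · intro i _
    have h1 := Int.emod_nonneg i hmz.ne'
    have h2 := Int.emod_lt_of_pos i hmz
    simp only [Finset.coe_range, Set.mem_Iio]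
    omega

/-- If in every piece and every residue class the prescribed numbers of points of the various types
add up to the number of points, then types can be assigned with these numbers. -/
theorem exists_types {τ : Type*} [DecidableEq τ] [Nonempty τ] {p : ℕ → ℤ} (hp : Monotone p) {r m : ℕ}
    (hm : 0 < m) (A : Finset τ) (f : ℕ → ℕ → τ → ℕ)
    (hf : ∀ j < r, ∀ ρ < m,
      #{i ∈ Ioc (p j) (p (j + 1)) | (i % (m : ℤ)).toNat = ρ} = ∑ t ∈ A, f j ρ t) :
    ∃ g : ℤ → τ, (∀ j < r, ∀ i ∈ Ioc (p j) (p (j + 1)), g i ∈ A ∧ 0 < f j (i % (m : ℤ)).toNat (g i)) ∧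
      ∀ t ∈ A, #{i ∈ Ioc (p 0) (p r) | g i = t} = ∑ j ∈ range r, ∑ ρ ∈ range m, f j ρ t := by
  have hmz : (0 : ℤ) < m := by exact_mod_cast hm
  have hex : ∀ j ρ, ∃ g : ℤ → τ, j < r → ρ < m →
      (∀ i ∈ {i ∈ Ioc (p j) (p (j + 1)) | (i % (m : ℤ)).toNat = ρ}, g i ∈ A) ∧
      ∀ t ∈ A, #{i ∈ {i ∈ Ioc (p j) (p (j + 1)) | (i % (m : ℤ)).toNat = ρ} | g i = t} = f j ρ t := by
    intro j ρ
    by_cases h : j < r ∧ ρ < m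
    · obtain ⟨g, hg⟩ := exists_fun_card_fiber A (f j ρ) _ (hf j h.1 ρ h.2)
      exact ⟨g, fun _ _ => hg⟩
    · exact ⟨fun _ => Classical.arbitrary τ, fun h1 h2 => absurd ⟨h1, h2⟩ h⟩
  choose g hg using hex
  -- The index of the piece containing `i` is the number of pieces whose right end lies strictly
  -- below `i`.
  let idx : ℤ → ℕ := fun i => #{j ∈ range r | p (j + 1) < i}
  have hidx : ∀ j < r, ∀ i ∈ Ioc (p j) (p (j + 1)), idx i = j := by
    intro j hj i hi
    rw [Finset.mem_Ioc] at hi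
    have : {j ∈ range r | p (j + 1) < i} = range j := by
      ext j'
      simp only [Finset.mem_filter, Finset.mem_range]
      constructor
      · rintro ⟨_, h⟩
        by_contra hjj
        have := hp (show j + 1 ≤ j' + 1 by omega)
        omega
      · intro h
        have := hp (show j' + 1 ≤ j by omega)
        exact ⟨by omega, by omega⟩
    simp only [idx]
    rw [this, Finset.card_range]
  have hres : ∀ i : ℤ, (i % (m : ℤ)).toNat < m := fun i => by
    have h1 := Int.emod_nonneg i hmz.ne'
    have h2 := Int.emod_lt_of_pos i hmz
    omega
  have hcount : ∀ j < r, ∀ ρ < m, ∀ t ∈ A,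
      #{i ∈ Ioc (p j) (p (j + 1)) | (i % (m : ℤ)).toNat = ρ ∧ g (idx i) (i % (m : ℤ)).toNat i = t} = f j ρ t := by
    intro j hj ρ hρ t ht
    rw [← (hg j ρ hj hρ).2 t ht, Finset.filter_filter]
    congr 1
    refine Finset.filter_congr fun i hi => ?_
    rw [hidx j hj i hi]
    constructor
    · rintro ⟨rfl, h⟩; exact ⟨rfl, h⟩
    · rintro ⟨rfl, h⟩; exact ⟨rfl, h⟩
  refine ⟨fun i => g (idx i) (i % (m : ℤ)).toNat i, fun j hj i hi => ?_, fun t ht => ?_⟩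
  · have hmem : g (idx i) (i % (m : ℤ)).toNat i ∈ A := by
      rw [hidx j hj i hi]
      exact (hg j _ hj (hres i)).1 i (Finset.mem_filter.2 ⟨hi, rfl⟩)
    refine ⟨hmem, ?_⟩
    simp only
    rw [← hcount j hj _ (hres i) _ hmem]
    exact Finset.card_pos.2 ⟨i, Finset.mem_filter.2 ⟨hi, rfl, rfl⟩⟩
  · rw [card_filter_Ioc_eq_sum hp]
    refine Finset.sum_congr rfl fun j hj => ?_
    rw [card_filter_eq_sum_residues _ hm]
    exact Finset.sum_congr rfl fun ρ hρ =>
      hcount j (Finset.mem_range.1 hj) ρ (Finset.mem_range.1 hρ) t ht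

theorem card_filter_mem_eq_sum (X : Finset ℤ) (g : ℤ → Finset ℕ) (A : Finset (Finset ℕ))
    (hg : ∀ i ∈ X, g i ∈ A) (k : ℕ) :
    #{i ∈ X | k ∈ g i} = ∑ t ∈ A with k ∈ t, #{i ∈ X | g i = t} := by
  rw [Finset.card_eq_sum_card_fiberwise (f := g) (t := {t ∈ A | k ∈ t})]
  · refine Finset.sum_congr rfl fun t ht => ?_
    rw [Finset.filter_filter]
    congr 1
    refine Finset.filter_congr fun i _ => ⟨fun h => h.2, fun h => ⟨?_, h⟩⟩
    rw [h]; exact (Finset.mem_filter.1 ht).2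
  · intro i hi
    simp only [Finset.coe_filter, Set.mem_ofPred_eq] at hi ⊢
    exact ⟨hg i hi.1, hi.2⟩

/-- The number of points of an interval in a residue class, up to a correction that depends only on
the residues of the end points. -/
theorem mul_card_filter_emod {m ρ : ℕ} (hm : 0 < m) (hρ : ρ < m) {a b : ℤ} (h : a ≤ b) :
    (m : ℤ) * #{i ∈ Ioc a b | (i % (m : ℤ)).toNat = ρ} = b - a + ((a - ρ) % m - (b - ρ) % m) := by
  have hmz : (0 : ℤ) < m := by exact_mod_cast hm
  have h1 : {i ∈ Ioc a b | (i % (m : ℤ)).toNat = ρ} = {i ∈ Ioc a b | i ≡ ρ [ZMOD m]} := by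
    refine Finset.filter_congr fun i _ => ?_
    have h2 := Int.emod_nonneg i hmz.ne'
    have h3 : (ρ : ℤ) % m = ρ := Int.emod_eq_of_lt (by omega) (by omega)
    unfold Int.ModEq
    rw [h3]
    omega
  have h2 := Int.Ioc_filter_modEq_card a b hmz ρ
  have h3 : ∀ c : ℤ, ⌊((c - (ρ : ℤ) : ℤ) : ℚ) / ((m : ℤ) : ℚ)⌋ = (c - ρ) / m := fun c =>
    Rat.floor_intCast_div_natCast (c - ρ) m
  push_cast at h2 h3
  rw [h1, h2, h3, h3, max_eq_left]
  · have e1 := Int.emod_add_mul_ediv (a - ρ) m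
    have e2 := Int.emod_add_mul_ediv (b - ρ) m
    linarith
  · exact sub_nonneg.2 (Int.ediv_le_ediv hmz (by omega))

/-! ### Small models -/

/-- With the next two lemmas, this carries the order of the cut points, the ends of the interval and
the vanishing of array values over to the small tuple. -/
theorem Sim.add_lt_iff {κ : Type*} {S : Finset κ} {c : ℕ} {a b : κ → ℤ} (h : Sim S c a b)
    (hc : 1 ≤ c) {i j : κ} (hi : i ∈ S) (hj : j ∈ S) {k : ℤ} (hk : |k| ≤ c) :
    a i + k < a j ↔ b i + k < b j := by
  classical
  have h1 := h.1 (Pi.single j 1 - Pi.single i 1) (-k) (fun t _ => ?_) (by rwa [abs_neg])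
  · simp only [Pi.sub_apply, sub_mul, Finset.sum_sub_distrib, Pi.single_apply, ite_mul, one_mul,
      zero_mul, Finset.sum_ite_eq', hi, hj, if_true] at h1
    omega
  · simp only [Pi.sub_apply, Pi.single_apply]
    have : (1 : ℤ) ≤ c := by exact_mod_cast hc
    split_ifs <;> simp <;> omega

theorem Sim.const_lt_iff {κ : Type*} {S : Finset κ} {c : ℕ} {a b : κ → ℤ} (h : Sim S c a b)
    (hc : 1 ≤ c) {i : κ} (hi : i ∈ S) {k : ℤ} (hk : |k| ≤ c) : k < a i ↔ k < b i := by
  classical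
  have h1 := h.1 (Pi.single i 1) (-k) (fun t _ => ?_) (by rwa [abs_neg])
  · simp only [Pi.single_apply, ite_mul, one_mul, zero_mul, Finset.sum_ite_eq', hi, if_true] at h1
    omega
  · simp only [Pi.single_apply]
    have : (1 : ℤ) ≤ c := by exact_mod_cast hc
    split_ifs <;> (simp; try omega)

theorem Sim.eq_iff {κ : Type*} {S : Finset κ} {c : ℕ} {a b : κ → ℤ} (h : Sim S c a b)
    (hc : 1 ≤ c) {i j : κ} (hi : i ∈ S) (hj : j ∈ S) : a i = a j ↔ b i = b j := by
  have h1 := h.add_lt_iff hc hi hj (k := 0) (by simp)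
  have h2 := h.add_lt_iff hc hj hi (k := 0) (by simp)
  omega

/-- The values of the atomic terms in an interpretation. -/
def Interp.env (I : Interp) (v : ℕ → ℤ) : Ix → ℤ
  | .par p => I.par p
  | .var y => v y
  | .app a y => I.arr a (v y)

theorem Formula.holds_iff_sat_env {φ : Formula} (hφ : φ.IsBasic) (I : Interp) (v : ℕ → ℤ) :
    φ.Holds I v ↔ φ.Sat (fun _ _ => True) (I.env v) := by
  rw [← Formula.rHolds_true]
  exact Formula.rHolds_iff_sat hφ (Nat.lt_succ_self _) (fun _ _ => rfl) (fun _ _ _ => rfl)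
    (fun _ _ _ _ _ _ => rfl)

/-- An interpretation is assembled from values `w` of the atomic terms and, for every `i` below the
length of the arrays, values `E i` of the atomic terms when the variable `x` has value `i`. -/
theorem exists_interp {n x T : ℕ} (hn : 0 < n) (w : Ix → ℤ) (E : ℤ → Ix → ℤ)
    (hw : ∀ i ∈ Idx n, |w i| ≤ T)
    (hE : ∀ i, 0 ≤ i → i < w (.par 0) →
      (∀ j, (∀ a < n, j ≠ .app a x) → E i j = update w (.var x) i j) ∧
      (∀ a < n, |E i (.app a x)| ≤ T) ∧
      ∀ y < n, y ≠ x → i = w (.var y) → ∀ a < n, E i (.app a x) = w (.app a y))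
    (hout : ∀ y < n, y ≠ x → ¬ (0 ≤ w (.var y) ∧ w (.var y) < w (.par 0)) →
      ∀ a < n, w (.app a y) = 0) :
    ∃ (I : Interp) (v : ℕ → ℤ), I.par 0 = w (.par 0) ∧ (∀ p, |I.par p| ≤ T) ∧
      (∀ a i, |I.arr a i| ≤ T) ∧ (∀ y, |v y| ≤ T) ∧ (∀ y < n, v y = w (.var y)) ∧
      (∀ φ : Formula, φ.IsBasic → φ.code < n → ¬ φ.Free x →
        (φ.Holds I v ↔ φ.Sat (fun _ _ => True) w)) ∧
      ∀ φ : Formula, φ.IsBasic → φ.code < n → ∀ i, 0 ≤ i → i < w (.par 0) →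
        (φ.Holds I (update v x i) ↔ φ.Sat (fun _ _ => True) (E i)) := by
  classical
  -- The array values at `i` are read off from `E i`. They agree with the values `w` prescribes for
  -- `a(y)`: inside the interval by the last clause of `hE`, outside by `hout`.
  let I : Interp :=
    { par := fun p => if p < n then w (.par p) else 0
      arr := fun a i => if a < n ∧ 0 ≤ i ∧ i < w (.par 0) then E i (.app a x) else 0
      arr_outside := fun a i hi => by
        rw [if_pos hn] at hi
        rw [if_neg fun h => hi h.2] }
  have hT : |(0 : ℤ)| ≤ T := by simp
  have harr : ∀ y < n, y ≠ x → ∀ a < n, I.arr a (w (.var y)) = w (.app a y) := by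
    intro y hy hyx a ha
    by_cases hi : 0 ≤ w (.var y) ∧ w (.var y) < w (.par 0)
    · simp only [I, ha, hi, and_self, if_true]
      exact (hE _ hi.1 hi.2).2.2 y hy hyx rfl a ha
    · simp only [I]
      rw [if_neg fun h => hi h.2, hout y hy hyx hi a ha]
  refine ⟨I, fun y => if y < n then w (.var y) else 0, if_pos hn, fun p => ?_, fun a i => ?_,
    fun y => ?_, fun y hy => if_pos hy, fun φ hφ hφn hx => ?_, fun φ hφ hφn i hi0 hi1 => ?_⟩
  · by_cases hp : p < n
    · simp only [I, hp, if_true]; exact hw _ (by simpa using hp)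
    · simp only [I, hp, if_false]; exact hT
  · by_cases h : a < n ∧ 0 ≤ i ∧ i < w (.par 0)
    · simp only [I]; rw [if_pos h]; exact (hE i h.2.1 h.2.2).2.1 a h.1
    · simp only [I]; rw [if_neg h]; exact hT
  · by_cases hy : y < n
    · simp only [hy, if_true]; exact hw _ (by simpa using hy)
    · simp only [hy, if_false]; exact hT
  · rw [← Formula.rHolds_true]
    refine Formula.rHolds_iff_sat hφ hφn (fun p hp => by simp [I, hp]) (fun y hy _ => by simp [hy])
      (fun y hy _ hfree a ha => ?_)
    have hyx : y ≠ x := fun h => hx (h ▸ hfree)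
    simp only [hy, if_true]
    exact (harr y hy hyx a ha).symm
  · rw [← Formula.rHolds_true]
    obtain ⟨h1, h2, h3⟩ := hE i hi0 hi1
    refine Formula.rHolds_iff_sat hφ hφn (fun p hp => ?_) (fun y hy _ => ?_)
      (fun y hy _ _ a ha => ?_)
    · rw [h1 _ (by simp), update_of_ne (by simp)]
      simp [I, hp]
    · rw [h1 _ (by simp)]
      by_cases hyx : y = x
      · subst hyx; rw [update_self, update_self]
      · rw [update_of_ne (by simpa using hyx), update_of_ne hyx]; simp [hy]
    · by_cases hyx : y = x
      · subst hyx
        rw [update_self]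
        simp [I, ha, hi0, hi1]
      · rw [h1 _ (by simp [hyx]), update_of_ne (by simp), update_of_ne hyx]
        simp only [hy, if_true]
        exact (harr y hy hyx a ha).symm

-- Levels and bounds for the small model

/-- The similarity level that determines the truth of basic formulae with Gödel number
below `n`. -/
def satLevel (n : ℕ) : ℕ := lift^[n] n

/-- The similarity level at which the values of the arrays at a point can be transferred. -/
def pointLevel (n : ℕ) : ℕ := lift^[n] (satLevel n)

/-- A bound for the number of atomic terms. -/
def termCount (n : ℕ) : ℕ := n + (n + n * n)

/-- The number of pieces into which `[0, N)` is cut. -/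
def pieceCount (n : ℕ) : ℕ := cellCount (termCount n) (pointLevel n)

/-- A bound for the number of atomic terms, cuts and cell sizes. -/
def dimension (n : ℕ) : ℕ :=
  termCount n + (pieceCount n + 1 + pieceCount n * ((pointLevel n).factorial * 2 ^ n))

/-- A bound for the values of atomic terms in a small model. -/
def tupleBound (n : ℕ) : ℕ :=
  grow^[dimension n] (dimension n + lift^[dimension n] (lift (pointLevel n)))

/-- A bound for all values in a small model. -/
def modelBound (n : ℕ) : ℕ := grow^[n] (tupleBound n)

theorem le_satLevel (n : ℕ) : n ≤ satLevel n := le_iterate le_lift n n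

theorem satLevel_le_pointLevel (n : ℕ) : satLevel n ≤ pointLevel n := le_iterate le_lift n _

theorem pointLevel_le_tupleBound (n : ℕ) : pointLevel n ≤ tupleBound n :=
  (le_lift _).trans ((le_iterate le_lift (dimension n) _).trans
    ((Nat.le_add_left _ _).trans (le_iterate le_grow _ _)))

theorem dimension_le_tupleBound (n : ℕ) : dimension n ≤ tupleBound n :=
  (Nat.le_add_right _ _).trans (le_iterate le_grow _ _)

theorem tupleBound_le_modelBound (n : ℕ) : tupleBound n ≤ modelBound n := le_iterate le_grow _ _

/-- Values of the arrays at a point are transferred between similar assignments. -/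
theorem exists_point_values {n x T : ℕ} (hx : x < n) (hT : pointLevel n ≤ T) (hT' : #(Idx n) ≤ T)
    {a w a' : Ix → ℤ}
    (h : Sim (Idx n) (pointLevel n) a w) (hw : ∀ i ∈ Idx n, |w i| ≤ T)
    (ha' : ∀ j ∈ Idx n, (∀ b < n, j ≠ .app b x) → a' j = a j) :
    ∃ w' : Ix → ℤ, (∀ j, (∀ b < n, j ≠ .app b x) → w' j = w j) ∧
      (∀ i ∈ Idx n, |w' i| ≤ (grow^[n] T : ℕ)) ∧ Sim (Idx n) (satLevel n) a' w' := by
  have hcard : #((range n).image fun b => Ix.app b x) = n := by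
    rw [Finset.card_image_of_injective _ (fun b b' h => by simpa using h), Finset.card_range]
  have hsub : (range n).image (fun b => Ix.app b x) ⊆ Idx n := by
    intro j hj
    obtain ⟨b, hb, rfl⟩ := Finset.mem_image.1 hj
    simpa using ⟨Finset.mem_range.1 hb, hx⟩
  have hmem : ∀ j, j ∉ (range n).image (fun b => Ix.app b x) ↔ ∀ b < n, j ≠ .app b x := by
    intro j
    simp only [Finset.mem_image, Finset.mem_range, not_exists, not_and]
    exact forall₂_congr fun b _ => ne_comm
  -- Only the `n` coordinates `b(x)` are replayed, each at the cost of one `lift`; this is why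
  -- `pointLevel n` is `n` lifts above `satLevel n`.
  have := Sim.exists_extend ((range n).image fun b => Ix.app b x) hsub (c := satLevel n) (T := T)
    (a := a) (b := w) (a' := a') (by rw [hcard]; exact h)
    (fun j hjS hj => ha' j hjS ((hmem j).1 hj)) (by rw [hcard]; exact hT) hT' hw
  rw [hcard] at this
  obtain ⟨w', h1, h2, h3⟩ := this
  exact ⟨w', fun j hj => h1 j ((hmem j).2 hj), h2, h3⟩

open Classical in
/-- The set of those formulae in a list that are true. -/
noncomputable def typeOf (K : ℕ) (β : ℕ → Formula) (e : Ix → ℤ) : Finset ℕ :=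
  {k ∈ range K | (β k).Sat (fun _ _ => True) e}

theorem mem_typeOf {K : ℕ} {β : ℕ → Formula} {e : Ix → ℤ} {k : ℕ} :
    k ∈ typeOf K β e ↔ k < K ∧ (β k).Sat (fun _ _ => True) e := by
  simp [typeOf]

theorem typeOf_eq_of_sim {n K : ℕ} {β : ℕ → Formula}
    (hβ : ∀ k < K, (β k).IsBasic ∧ (β k).code < n) {a b : Ix → ℤ}
    (h : Sim (Idx n) (satLevel n) a b) : typeOf K β a = typeOf K β b := by
  ext k
  rw [mem_typeOf, mem_typeOf]
  refine and_congr_right fun hk => ?_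
  have := hβ k hk
  exact (β k).sat_iff_of_sim this.1 this.2 this.2.le this.2.le h

/-- Transfer of the type of a point. -/
theorem exists_point {n x K T : ℕ} (hx : x < n) (hT : pointLevel n ≤ T)
    (hT' : #(Idx n) ≤ T) {β : ℕ → Formula} (hβ : ∀ k < K, (β k).IsBasic ∧ (β k).code < n)
    {I : Interp} {v : ℕ → ℤ} {i₀ i : ℤ} {w : Ix → ℤ}
    (h : Sim (Idx n) (pointLevel n) (update (I.env v) (.var x) i₀) (update w (.var x) i))
    (hw : ∀ j ∈ Idx n, |w j| ≤ T) (hi : |i| ≤ T) :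
    ∃ e : Ix → ℤ, ((∀ j, (∀ a < n, j ≠ .app a x) → e j = update w (.var x) i j) ∧
      (∀ a < n, |e (.app a x)| ≤ (grow^[n] T : ℕ)) ∧
      ∀ y < n, y ≠ x → i = w (.var y) → ∀ a < n, e (.app a x) = w (.app a y)) ∧
      typeOf K β e = typeOf K β (I.env (update v x i₀)) := by
  obtain ⟨e, h1, h2, h3⟩ := exists_point_values hx hT hT' (a' := I.env (update v x i₀)) h
    (fun j hj => by
      by_cases hjx : j = .var x
      · subst hjx; rwa [update_self]
      · rw [update_of_ne hjx]; exact hw j hj)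
    (fun j hjS hj => by
      cases j with
      | par p => rw [update_of_ne (by simp)]; rfl
      | var y =>
        by_cases hyx : y = x
        · subst hyx; rw [update_self]; simp [Interp.env]
        · rw [update_of_ne (by simpa using hyx)]; simp [Interp.env, hyx]
      | app a y =>
        rw [update_of_ne (by simp)]
        by_cases hyx : y = x
        · subst hyx
          exact absurd rfl (hj a (by simp at hjS; exact hjS.1))
        · simp [Interp.env, hyx])
  refine ⟨e, ⟨h1, fun a ha => h2 _ (by simp [ha, hx]), fun y hy hyx hiy a ha => ?_⟩,
    (typeOf_eq_of_sim hβ h3).symm⟩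
  have hc : 1 ≤ satLevel n := (by omega : 1 ≤ n).trans (le_satLevel n)
  -- If the new point is the value of `y`, then by similarity the old point was too. Hence `a(x) =
  -- a(y)` held in the old model, and this equation transfers back, so the array values chosen at
  -- the point do not conflict with those already fixed.
  have e1 := h3.eq_iff hc (i := .var x) (j := .var y) (by simpa using hx) (by simpa using hy)
  have e2 := h3.eq_iff hc (i := .app a x) (j := .app a y) (by simp [hx, ha]) (by simp [hy, ha])
  rw [h1 _ (by simp), h1 _ (by simp), update_self, update_of_ne (by simpa using hyx)] at e1
  have e3 := e1.2 hiy
  simp only [Interp.env, update_self, update_of_ne hyx] at e3 e2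
  rw [h1 (.app a y) (by simp [hyx]), update_of_ne (by simp)] at e2
  exact e2.1 (by rw [e3])

/-- This turns a cardinality constraint into a linear equation between the recorded numbers and the
value of `z k`. -/
theorem card_filter_typeOf {p : ℕ → ℤ} (hp : Monotone p) {r m : ℕ} (hm : 0 < m)
    (A : Finset (Finset ℕ)) (g : ℤ → Finset ℕ) (hg : ∀ i, g i ∈ A) (k : ℕ) :
    #{i ∈ Ioc (p 0) (p r) | k ∈ g i} = ∑ j ∈ range r, ∑ ρ ∈ range m, ∑ t ∈ A with k ∈ t,
      #{i ∈ Ioc (p j) (p (j + 1)) | (i % (m : ℤ)).toNat = ρ ∧ g i = t} := by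
  rw [card_filter_mem_eq_sum _ g A (fun i _ => hg i),
    Finset.sum_congr rfl fun t _ => card_filter_Ioc_eq_sum hp (fun i => g i = t) r, Finset.sum_comm]
  refine Finset.sum_congr rfl fun j _ => ?_
  rw [Finset.sum_congr rfl fun t _ => card_filter_eq_sum_residues _ hm (fun i => g i = t),
    Finset.sum_comm]

theorem ncard_eq_card_filter (N : ℤ) (P : ℤ → Prop) [DecidablePred P] :
    Set.ncard {i : ℤ | (0 ≤ i ∧ i < N) ∧ P i} = #{i ∈ Ico 0 N | P i} := by
  rw [← Set.ncard_coe_finset]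
  congr 1
  ext i
  simp

/-- Small model property: a basic formula together with cardinality constraints has a small model
if it has one at all. -/
theorem exists_small_model {n x K : ℕ} (hx : x < n) (hK : K ≤ n) {α : Formula} {β : ℕ → Formula}
    {z : ℕ → ℕ} (hα : α.IsBasic) (hαn : α.code < n) (hαx : ¬ α.Free x)
    (hβ : ∀ k < K, (β k).IsBasic ∧ (β k).code < n) (hz : ∀ k < K, z k < n) {I : Interp}
    {v : ℕ → ℤ} (hIα : α.Holds I v)
    (hIβ : ∀ k < K, (Set.ncard {i : ℤ | (0 ≤ i ∧ i < I.par 0) ∧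
      (β k).Holds I (update v x i)} : ℤ) = v (z k)) :
    ∃ (J : Interp) (u : ℕ → ℤ), (∀ p, |J.par p| ≤ modelBound n) ∧
      (∀ a i, |J.arr a i| ≤ modelBound n) ∧ (∀ y, |u y| ≤ modelBound n) ∧ α.Holds J u ∧
      ∀ k < K, (Set.ncard {i : ℤ | (0 ≤ i ∧ i < J.par 0) ∧
        (β k).Holds J (update u x i)} : ℤ) = u (z k) := by
  classical
  have hn : 0 < n := by omega
  set S := Idx n with hS
  set c := pointLevel n with hc
  have hc1 : 1 ≤ c := (by omega : 1 ≤ n).trans ((le_satLevel n).trans (satLevel_le_pointLevel n))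
  set m := c.factorial with hm
  have hmpos : 0 < m := Nat.factorial_pos c
  have hmz : (0 : ℤ) < m := by exact_mod_cast hmpos
  set r := pieceCount n with hr
  set A := (range K).powerset with hA
  set e := I.env v with he
  have hxS : Ix.var x ∈ S := by simpa [hS] using hx
  -- Pieces are open on the left, so `[0, N)` is written as `(-1, N - 1]`; the maximum with `-1`
  -- covers the case of an empty array.
  obtain ⟨p, hpmono, hp0, hpr, hcell⟩ := exists_cells (c := c) (card_Idx_le n) e hxS
    (le_max_right (I.par 0 - 1) (-1))
  change p r = _ at hpr
  set g : ℤ → Finset ℕ := fun i => typeOf K β (I.env (update v x i)) with hg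
  have hgA : ∀ i, g i ∈ A := fun i => by
    rw [hA, Finset.mem_powerset]
    intro k hk
    exact Finset.mem_range.2 (mem_typeOf.1 hk).1
  let f : ℕ → ℕ → Finset ℕ → ℕ := fun j ρ t =>
    #{i ∈ Ioc (p j) (p (j + 1)) | (i % (m : ℤ)).toNat = ρ ∧ g i = t}
  have hIoc : Ioc (p 0) (p r) = Ico 0 (I.par 0) := by
    ext i
    rw [hp0, hpr]
    simp only [Finset.mem_Ioc, Finset.mem_Ico]
    omega
  have hfβ : ∀ k < K, ((∑ j ∈ range r, ∑ ρ ∈ range m, ∑ t ∈ A with k ∈ t, f j ρ t : ℕ) : ℤ)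
      = e (.var (z k)) := by
    intro k hk
    have h1 := hIβ k hk
    rw [ncard_eq_card_filter] at h1
    rw [← card_filter_typeOf hpmono hmpos A g hgA k, hIoc]
    change _ = v (z k)
    rw [← h1]
    congr 2
    refine Finset.filter_congr fun i _ => ?_
    rw [hg, mem_typeOf, Formula.holds_iff_sat_env (hβ k hk).1]
    simp [hk]
  have hfcard : ∀ j ρ, #{i ∈ Ioc (p j) (p (j + 1)) | (i % (m : ℤ)).toNat = ρ} = ∑ t ∈ A, f j ρ t := by
    intro j ρ
    rw [Finset.card_eq_sum_card_fiberwise (f := g) (t := A) (fun i _ => hgA i)]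
    refine Finset.sum_congr rfl fun t _ => ?_
    rw [Finset.filter_filter]
  -- the tuple of all relevant numbers, and a small tuple similar to it
  let W : Ix ⊕ (ℕ ⊕ (ℕ × ℕ × Finset ℕ)) → ℤ :=
    Sum.elim e (Sum.elim p fun q => (f q.1 q.2.1 q.2.2 : ℤ))
  let S' : Finset (Ix ⊕ (ℕ ⊕ (ℕ × ℕ × Finset ℕ))) :=
    S.disjSum ((range (r + 1)).disjSum (range r ×ˢ range m ×ˢ A))
  have hcardS' : #S' ≤ dimension n := by
    have h1 := card_Idx_le n
    have h2 : 2 ^ K ≤ 2 ^ n := Nat.pow_le_pow_right (by norm_num) hK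
    simp only [S', Finset.card_disjSum, Finset.card_product, Finset.card_range, hA,
      Finset.card_powerset]
    unfold dimension
    exact Nat.add_le_add h1 (Nat.add_le_add_left
      (Nat.mul_le_mul_left _ (Nat.mul_le_mul_left _ h2)) _)
  have hcardS : #S ≤ tupleBound n := by
    refine le_trans ?_ (dimension_le_tupleBound n)
    exact (card_Idx_le n).trans (Nat.le_add_right _ _)
  -- One `lift` beyond `c = pointLevel n` is kept in reserve for the round in which a point of the
  -- small model is answered in the original one.
  obtain ⟨W', hW'b, hsim⟩ := Sim.exists_small S' (c := lift c)
    (T := dimension n + lift^[dimension n] (lift c))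
    ((iterate_le_iterate le_lift hcardS' _).trans (Nat.le_add_left _ _))
    (hcardS'.trans (Nat.le_add_right _ _)) W
  have hW'T : ∀ i ∈ S', |W' i| ≤ tupleBound n := fun i hi =>
    (hW'b i hi).trans (by exact_mod_cast iterate_le_iterate le_grow hcardS' _)
  clear hW'b
  have hinl : ∀ {i}, i ∈ S → (Sum.inl i : Ix ⊕ (ℕ ⊕ (ℕ × ℕ × Finset ℕ))) ∈ S' := by
    intro i hi; simpa [S'] using hi
  have hcut : ∀ {j}, j ≤ r → (Sum.inr (Sum.inl j) : Ix ⊕ (ℕ ⊕ (ℕ × ℕ × Finset ℕ))) ∈ S' := by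
    intro j hj; simp [S']; omega
  have hflow : ∀ {j ρ t}, j < r → ρ < m → t ∈ A →
      (Sum.inr (Sum.inr (j, ρ, t)) : Ix ⊕ (ℕ ⊕ (ℕ × ℕ × Finset ℕ))) ∈ S' := by
    intro j ρ t hj hρ ht; simp [S', hj, hρ, ht]
  have hl1 : 1 ≤ lift c := hc1.trans (le_lift c)
  have hml : m ≤ lift c := factorial_le_lift c
  have hmlz : (m : ℤ) ≤ lift c := by exact_mod_cast hml
  have hmdvd : m ∣ (lift c).factorial := Nat.factorial_dvd_factorial (le_lift c)
  set w : Ix → ℤ := fun i => W' (Sum.inl i) with hw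
  -- Only the cuts with index at most `r` belong to the tuple; the minimum makes the sequence
  -- constant afterwards, so that it is monotone on all of `ℕ`.
  set p' : ℕ → ℤ := fun j => W' (Sum.inr (Sum.inl (min j r))) with hp'
  set f' : ℕ → ℕ → Finset ℕ → ℕ := fun j ρ t => (W' (Sum.inr (Sum.inr (j, ρ, t)))).toNat with hf'
  have hsimw : Sim S (lift c) e w := by
    have := hsim.comp (S := S) Sum.inl Sum.inl_injective (fun i hi => hinl hi)
    exact this
  have hf'val : ∀ {j ρ t}, j < r → ρ < m → t ∈ A →
      (f' j ρ t : ℤ) = W' (Sum.inr (Sum.inr (j, ρ, t))) ∧ (0 < f' j ρ t ↔ 0 < f j ρ t) := by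
    intro j ρ t hj hρ ht
    have h1 := hsim.const_lt_iff hl1 (hflow hj hρ ht) (k := -1) (by simpa using hl1)
    have h2 := hsim.const_lt_iff hl1 (hflow hj hρ ht) (k := 0) (by simp)
    simp only [W, Sum.elim_inr] at h1 h2
    simp only [hf']
    omega
  have hp'eq : ∀ {j}, j ≤ r → p' j = W' (Sum.inr (Sum.inl j)) := by
    intro j hj; simp only [hp', min_eq_left hj]
  have hpp' : ∀ {j}, j ≤ r → p' j ≡ p j [ZMOD m] := by
    intro j hj
    rw [hp'eq hj]
    exact (hsim.modEq hmdvd (hcut hj)).symm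
  have hp'mono : Monotone p' := by
    refine monotone_nat_of_le_succ fun j => ?_
    by_cases hj : j < r
    · rw [hp'eq hj.le, hp'eq (j := j + 1) hj]
      have h1 := hsim.add_lt_iff hl1 (hcut (j := j + 1) hj) (hcut hj.le) (k := 0) (by simp)
      simp only [W, Sum.elim_inr, Sum.elim_inl] at h1
      have := hpmono (Nat.le_succ j)
      simp only [Nat.succ_eq_add_one] at this
      omega
    · simp only [hp']
      rw [min_eq_right (by omega), min_eq_right (by omega)]
  have hpar : Ix.par 0 ∈ S := by simpa [hS] using hn
  have hIoc' : Ioc (p' 0) (p' r) = Ico 0 (w (.par 0)) := by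
    have h1 := hsim.const_lt_iff hl1 (hcut (Nat.zero_le r)) (k := -1) (by simpa using hl1)
    have h2 := hsim.const_lt_iff hl1 (hcut (Nat.zero_le r)) (k := 0) (by simp)
    have h2' := hsim.add_lt_iff hl1 (hcut (le_refl r)) (hcut (Nat.zero_le r)) (k := 0) (by simp)
    have h3 := hsim.const_lt_iff hl1 (hcut le_rfl) (k := -1) (by simpa using hl1)
    have h4 := hsim.const_lt_iff hl1 (hcut (le_refl r)) (k := 0) (by simp)
    have h5 := hsim.add_lt_iff hl1 (hcut (le_refl r)) (hinl hpar) (k := 0) (by simp)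
    have h6 := hsim.add_lt_iff hl1 (hcut (le_refl r)) (hinl hpar) (k := 1) (by simpa using hl1)
    have h7 := hsim.const_lt_iff hl1 (hinl hpar) (k := 0) (by simp)
    have h8 := hsim.const_lt_iff hl1 (hinl hpar) (k := -1) (by simpa using hl1)
    -- Together with the comparison with `-1` this pins the first cut to the value `-1`.
    have h9 : -2 < W (Sum.inr (Sum.inl 0)) ↔ -2 < W' (Sum.inr (Sum.inl 0)) :=
      hsim.const_lt_iff hl1 (hcut (Nat.zero_le r)) (by
        have : 2 ≤ lift c := by
          have := Nat.factorial_pos c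
          unfold lift; nlinarith [Nat.zero_le (c.factorial * c.factorial)]
        simpa using this)
    simp only [W, Sum.elim_inr, Sum.elim_inl] at h1 h2 h2' h3 h4 h5 h6 h7 h8 h9
    rw [hp0] at h1 h2 h2' h9
    rw [hpr] at h2' h3 h4 h5 h6
    have e0 : e (.par 0) = I.par 0 := rfl
    rw [e0] at h5 h6 h7 h8
    ext i
    rw [hp'eq (Nat.zero_le r), hp'eq le_rfl, Finset.mem_Ioc, Finset.mem_Ico]
    simp only [hw]
    omega
  have hsum : ∀ (l : Ix → ℤ) (l' : ℕ → ℤ) (l'' : ℕ × ℕ × Finset ℕ → ℤ)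
      (d : Ix ⊕ (ℕ ⊕ (ℕ × ℕ × Finset ℕ)) → ℤ),
      ∑ i ∈ S', Sum.elim l (Sum.elim l' l'') i * d i = ∑ i ∈ S, l i * d (Sum.inl i) +
        (∑ j ∈ range (r + 1), l' j * d (Sum.inr (Sum.inl j)) +
          ∑ j ∈ range r, ∑ ρ ∈ range m, ∑ t ∈ A,
            l'' (j, ρ, t) * d (Sum.inr (Sum.inr (j, ρ, t)))) := by
    intro l l' l'' d
    simp only [S', Finset.sum_disjSum, Sum.elim_inl, Sum.elim_inr, Finset.sum_product]
  have hf'card : ∀ j < r, ∀ ρ < m,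
      #{i ∈ Ioc (p' j) (p' (j + 1)) | (i % (m : ℤ)).toNat = ρ} = ∑ t ∈ A, f' j ρ t := by
    intro j hj ρ hρ
    have h1 := mul_card_filter_emod hmpos hρ (hpmono (Nat.le_succ j))
    have h2 := mul_card_filter_emod hmpos hρ (hp'mono (Nat.le_succ j))
    simp only [Nat.succ_eq_add_one] at h1 h2
    have h3 : (p' j - ρ) % (m : ℤ) = (p j - ρ) % (m : ℤ) := (hpp' hj.le).sub_right _
    have h4 : (p' (j + 1) - ρ) % (m : ℤ) = (p (j + 1) - ρ) % (m : ℤ) := (hpp' hj).sub_right _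
    rw [hfcard] at h1
    rw [h3, h4] at h2
    set δ := (p j - ρ) % (m : ℤ) - (p (j + 1) - ρ) % (m : ℤ) with hδ
    have hδ' : |-δ| ≤ lift c := by
      have := Int.emod_nonneg (p j - ρ) hmz.ne'
      have := Int.emod_lt_of_pos (p j - ρ) hmz
      have := Int.emod_nonneg (p (j + 1) - ρ) hmz.ne'
      have := Int.emod_lt_of_pos (p (j + 1) - ρ) hmz
      rw [abs_neg, abs_le]; omega
    -- The transferred equation is `m * ∑ t, f j ρ t = p (j + 1) - p j + δ`. Its coefficients are at
    -- most `m = c! ≤ lift c`, and `δ` depends only on residues modulo `m`, so it is the same number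
    -- for the old and the new cuts.
    have h5 := hsim.eq_zero_iff (Sum.elim 0 (Sum.elim (Pi.single j 1 - Pi.single (j + 1) 1)
      fun q => if q.1 = j then (if q.2.1 = ρ then (m : ℤ) else 0) else 0)) (-δ)
      (fun i _ => by
        have : (1 : ℤ) ≤ lift c := by exact_mod_cast hl1
        rcases i with i | i | i
        · simp
        · simp only [Sum.elim_inr, Sum.elim_inl, Pi.sub_apply, Pi.single_apply]
          split_ifs <;> (simp; try omega)
        · simp only [Sum.elim_inr]
          split_ifs <;> (simp; try omega)) hδ'
    rw [hsum, hsum] at h5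
    have hj1 : j < r + 1 := by omega
    simp only [Pi.zero_apply, zero_mul, Finset.sum_const_zero, zero_add, Pi.sub_apply, sub_mul,
      Finset.sum_sub_distrib, Pi.single_apply, ite_mul, one_mul, Finset.sum_ite_irrel,
      Finset.sum_ite_eq', Finset.mem_range, hj, hρ, hj1, if_true,
      Nat.add_lt_add_iff_right, ← Finset.mul_sum, W, Sum.elim_inr, Sum.elim_inl] at h5
    rw [← hp'eq hj.le, ← hp'eq (j := j + 1) hj] at h5
    have h6 : ∑ t ∈ A, W' (Sum.inr (Sum.inr (j, ρ, t))) = ((∑ t ∈ A, f' j ρ t : ℕ) : ℤ) := by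
      push_cast
      exact Finset.sum_congr rfl fun t ht => (hf'val hj hρ ht).1.symm
    rw [h6] at h5
    push_cast at h1 h2 h5
    have h7 := h5.1 (by linarith)
    have h8 : (m : ℤ) * #{i ∈ Ioc (p' j) (p' (j + 1)) | (i % (m : ℤ)).toNat = ρ}
        = m * ∑ t ∈ A, (f' j ρ t : ℤ) := by linarith
    have h9 := mul_left_cancel₀ hmz.ne' h8
    exact_mod_cast h9
  have hf'β : ∀ k < K, ((∑ j ∈ range r, ∑ ρ ∈ range m, ∑ t ∈ A with k ∈ t, f' j ρ t : ℕ) : ℤ)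
      = w (.var (z k)) := by
    intro k hk
    have hzS : Ix.var (z k) ∈ S := by simpa [hS] using hz k hk
    -- The constraint as a form: coefficient `1` at the numbers of types containing `k`, and `-1` at
    -- `z k`. It is linear no matter which of the counted variables occur in `β k`.
    have h5 := hsim.eq_zero_iff (Sum.elim (Pi.single (.var (z k)) (-1)) (Sum.elim 0
      fun q => if k ∈ q.2.2 then 1 else 0)) 0
      (fun i _ => by
        have : (1 : ℤ) ≤ lift c := by exact_mod_cast hl1
        rcases i with i | i | i
        · simp only [Sum.elim_inl, Pi.single_apply]
          split_ifs <;> simp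
          omega
        · simp
        · simp only [Sum.elim_inr]
          split_ifs <;> simp
          omega) (by simp)
    rw [hsum, hsum] at h5
    simp only [Pi.zero_apply, zero_mul, Finset.sum_const_zero, zero_add, Pi.single_apply, ite_mul,
      one_mul, Finset.sum_ite_eq', hzS, if_true, add_zero, ← Finset.sum_filter, W, Sum.elim_inr,
      Sum.elim_inl] at h5
    have h6 := hfβ k hk
    push_cast at h6 ⊢
    rw [h6] at h5
    have h7 := h5.1 (by ring)
    have h8 : ∑ j ∈ range r, ∑ ρ ∈ range m, ∑ t ∈ A with k ∈ t, (f' j ρ t : ℤ) =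
        ∑ j ∈ range r, ∑ ρ ∈ range m, ∑ t ∈ A with k ∈ t, W' (Sum.inr (Sum.inr (j, ρ, t))) :=
      Finset.sum_congr rfl fun j hj => Finset.sum_congr rfl fun ρ hρ =>
        Finset.sum_congr rfl fun t ht =>
          (hf'val (Finset.mem_range.1 hj) (Finset.mem_range.1 hρ) (Finset.mem_filter.1 ht).1).1
    rw [h8]
    simp only [hw]
    linarith
  -- types for the points of the small model, and values that realize them
  obtain ⟨g', hg'1, hg'2⟩ := exists_types hp'mono hmpos A f' hf'card
  have hpoint : ∀ i, ∃ E : Ix → ℤ, 0 ≤ i → i < w (.par 0) →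
      ((∀ j, (∀ a < n, j ≠ .app a x) → E j = update w (.var x) i j) ∧
      (∀ a < n, |E (.app a x)| ≤ (modelBound n : ℕ)) ∧
      ∀ y < n, y ≠ x → i = w (.var y) → ∀ a < n, E (.app a x) = w (.app a y)) ∧
      typeOf K β E = g' i := by
    intro i
    by_cases hi : 0 ≤ i ∧ i < w (.par 0)
    swap
    · exact ⟨0, fun h1 h2 => absurd ⟨h1, h2⟩ hi⟩
    have hiIoc : i ∈ Ioc (p' 0) (p' r) := by rw [hIoc']; exact Finset.mem_Ico.2 hi
    obtain ⟨j, hj, hij⟩ := exists_mem_Ioc hiIoc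
    obtain ⟨h1, h2⟩ := hg'1 j hj i hij
    have hres : (i % (m : ℤ)).toNat < m := by
      have := Int.emod_nonneg i hmz.ne'
      have := Int.emod_lt_of_pos i hmz
      omega
    rw [(hf'val hj hres h1).2] at h2
    obtain ⟨i₀, hi₀⟩ := Finset.card_pos.1 h2
    simp only [Finset.mem_filter] at hi₀
    obtain ⟨hi₀j, hi₀m, hi₀g⟩ := hi₀
    -- Two original points are compared: `i₀` has the type prescribed for `i`, while `i₁` is the
    -- answer to `i` in the game. Since the cuts belong to the tuple, `i₁` lies in the same piece
    -- and residue class as `i₀`, and the cell property makes them indistinguishable at level `c`.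
    -- The size of `i₁` plays no role.
    obtain ⟨i₁, -, hi₁⟩ := hsim.symm.exists_update
      (T := c + #S' + ∑ i ∈ S', (W i).natAbs) (by omega) (by omega)
      (fun i hi => by
        have := Finset.single_le_sum (f := fun i => (W i).natAbs) (fun _ _ => Nat.zero_le _) hi
        rw [← Int.natCast_natAbs]; omega) (hinl hxS) i
    have hcutlt : ∀ {j'}, j' ≤ r → (p j' < i₁ ↔ p' j' < i) := by
      intro j' hj'
      have := hi₁.add_lt_iff hc1 (hcut hj') (hinl hxS) (k := 0) (by simp)
      rw [update_self, update_self, update_of_ne (by simp), update_of_ne (by simp)] at this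
      simp only [W, Sum.elim_inr, Sum.elim_inl, add_zero] at this
      rw [hp'eq hj', this]
    have hi₁j : i₁ ∈ Set.Ioc (p j) (p (j + 1)) := by
      have h3 := hcutlt hj.le
      have h4 := hcutlt (j' := j + 1) hj
      rw [Finset.mem_Ioc] at hij
      constructor
      · exact h3.2 hij.1
      · by_contra h5; have := h4.1 (by omega); omega
    have hi₁m : i₁ ≡ i [ZMOD m] := by
      have := hi₁.2 _ (hinl hxS)
      rw [update_self, update_self] at this
      exact this.symm
    have hi₀i : i₀ ≡ i [ZMOD m] := by
      have := Int.emod_nonneg i hmz.ne'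
      have := Int.emod_nonneg i₀ hmz.ne'
      unfold Int.ModEq
      omega
    have hs1 := hcell j i₀ (Finset.mem_Ioc.1 hi₀j) i₁ hi₁j (hi₀i.trans hi₁m.symm)
    have hs2 : Sim S c (update e (.var x) i₁) (update w (.var x) i) := by
      have := (hi₁.comp (S := S) Sum.inl Sum.inl_injective (fun i hi => hinl hi)).symm
      refine this.congr (fun t _ => ?_) fun t _ => ?_
      · by_cases ht : t = .var x
        · subst ht; simp
        · rw [update_of_ne ht, comp_apply, update_of_ne (by simpa using ht)]; rfl
      · by_cases ht : t = .var x
        · subst ht; simp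
        · rw [update_of_ne ht, comp_apply, update_of_ne (by simpa using ht)]
    have hwN := hW'T _ (hinl hpar)
    obtain ⟨E, hE1, hE2⟩ := exists_point (K := K) hx (pointLevel_le_tupleBound n) hcardS hβ
      (hs1.trans hs2) (fun j hj => hW'T _ (hinl hj)) (by
        have hi2 := hi.2
        simp only [hw] at hi2
        rw [abs_of_nonneg hi.1]
        rw [abs_of_pos (by omega)] at hwN
        omega)
    exact ⟨E, fun _ _ => ⟨hE1, hE2.trans hi₀g⟩⟩
  choose E hE using hpoint
  obtain ⟨J, u, hJ0, hJp, hJa, hu, huw, hJα, hJβ⟩ := exists_interp (x := x) (T := modelBound n) hn w E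
    (fun i hi => (hW'T _ (hinl hi)).trans (by exact_mod_cast tupleBound_le_modelBound n))
    (fun i h0 h1 => (hE i h0 h1).1)
    -- That `y` lies outside `[0, N)` and that `a(y) = 0` are both sign conditions on coordinates,
    -- hence preserved.
    (fun y hy _ hout a ha => by
      have hyS : Ix.var y ∈ S := by simpa [hS] using hy
      have haS : Ix.app a y ∈ S := by simpa [hS] using And.intro ha hy
      have h1 := hsimw.const_lt_iff hl1 hyS (k := -1) (by simpa using hl1)
      have h2 := hsimw.add_lt_iff hl1 hyS hpar (k := 0) (by simp)
      have h3 : e (.app a y) = 0 := I.arr_outside a (v y) (by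
        change ¬ (0 ≤ e (.var y) ∧ e (.var y) < e (.par 0))
        omega)
      have h4 := hsimw.const_lt_iff hl1 haS (k := -1) (by simpa using hl1)
      have h5 := hsimw.const_lt_iff hl1 haS (k := 0) (by simp)
      omega)
  refine ⟨J, u, hJp, hJa, hu, ?_, fun k hk => ?_⟩
  · rw [hJα α hα hαn hαx, ← α.sat_iff_of_sim hα hαn hαn.le hαn.le
      (hsimw.mono ((satLevel_le_pointLevel n).trans (le_lift c)))]
    exact (Formula.holds_iff_sat_env hα I v).1 hIα
  · rw [huw _ (hz k hk), ← hf'β k hk, ncard_eq_card_filter, hJ0]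
    congr 1
    have h1 : #{i ∈ Ico 0 (w (.par 0)) | (β k).Holds J (update u x i)} =
        #{i ∈ Ico 0 (w (.par 0)) | k ∈ g' i} := by
      congr 1
      refine Finset.filter_congr fun i hi => ?_
      rw [Finset.mem_Ico] at hi
      rw [hJβ _ (hβ k hk).1 (hβ k hk).2 i hi.1 hi.2, ← (hE i hi.1 hi.2).2, mem_typeOf]
      simp [hk]
    rw [h1, ← hIoc', card_filter_mem_eq_sum _ g' A (fun i hi => ?_),
      Finset.sum_congr rfl fun t ht => hg'2 t (Finset.mem_filter.1 ht).1, Finset.sum_comm]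
    · exact Finset.sum_congr rfl fun j _ => Finset.sum_comm
    · obtain ⟨j, hj, hij⟩ := exists_mem_Ioc hi
      exact (hg'1 j hj i hij).1

/-! ### Bounded satisfiability of E-flat formulae -/

/-- The matrix of an E-flat formula. -/
def Formula.eFlatBody (x : ℕ) (α : Formula) (cs : List (ℕ × Formula)) : Formula :=
  cs.foldl (fun ψ c => .and ψ (.eq (.card x c.2) (.var c.1))) α

/-- Existential closure of a formula with respect to the first components of a list. -/
def Formula.exPrefix (cs : List (ℕ × Formula)) (ψ : Formula) : Formula :=
  cs.foldr (fun c ψ => .ex c.1 ψ) ψ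

theorem Formula.code_lt_ex (x : ℕ) (φ : Formula) :
    φ.code < (Formula.ex x φ).code ∧ x < (Formula.ex x φ).code := by
  have := Nat.left_le_pair x φ.code
  have := Nat.right_le_pair x φ.code
  simp only [Formula.code]
  omega

theorem Formula.code_lt_and_card (ψ : Formula) (x : ℕ) (c : ℕ × Formula) :
    ψ.code < (Formula.and ψ (.eq (.card x c.2) (.var c.1))).code ∧
    x < (Formula.and ψ (.eq (.card x c.2) (.var c.1))).code ∧
    c.1 < (Formula.and ψ (.eq (.card x c.2) (.var c.1))).code ∧
    c.2.code < (Formula.and ψ (.eq (.card x c.2) (.var c.1))).code := by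
  simp only [Formula.code, Term.code]
  have h1 := Nat.left_le_pair x c.2.code
  have h2 := Nat.right_le_pair x c.2.code
  have h3 := Nat.left_le_pair (7 * Nat.pair x c.2.code + 6) (7 * c.1 + 2)
  have h4 := Nat.right_le_pair (7 * Nat.pair x c.2.code + 6) (7 * c.1 + 2)
  have h5 := Nat.left_le_pair ψ.code (6 * Nat.pair (7 * Nat.pair x c.2.code + 6) (7 * c.1 + 2) + 1)
  have h6 := Nat.right_le_pair ψ.code (6 * Nat.pair (7 * Nat.pair x c.2.code + 6) (7 * c.1 + 2) + 1)
  omega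

/-- All names and subformulae that the small model theorem mentions lie below the Gödel number.
Without constraints `x` need not occur at all, whence the condition `cs ≠ []`. -/
theorem Formula.code_eFlatBody (x : ℕ) (cs : List (ℕ × Formula)) : ∀ α : Formula,
    α.code ≤ (Formula.eFlatBody x α cs).code ∧ (cs ≠ [] → x < (Formula.eFlatBody x α cs).code) ∧
      ∀ c ∈ cs, c.1 < (Formula.eFlatBody x α cs).code ∧
        c.2.code < (Formula.eFlatBody x α cs).code := by
  induction cs with
  | nil => intro α; exact ⟨le_rfl, by simp, by simp⟩
  | cons c cs ih =>
    intro α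
    obtain ⟨h1, h2, h3⟩ := ih (.and α (.eq (.card x c.2) (.var c.1)))
    obtain ⟨k1, k2, k3, k4⟩ := Formula.code_lt_and_card α x c
    refine ⟨(k1.trans_le h1).le, fun _ => k2.trans_le h1, fun d hd => ?_⟩
    rcases List.mem_cons.1 hd with rfl | hd
    · exact ⟨k3.trans_le h1, k4.trans_le h1⟩
    · exact h3 d hd

theorem Formula.code_exPrefix (cs : List (ℕ × Formula)) (ψ : Formula) :
    ψ.code + cs.length ≤ (Formula.exPrefix cs ψ).code := by
  induction cs with
  | nil => exact le_rfl
  | cons c cs ih =>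
    have := (Formula.code_lt_ex c.1 (Formula.exPrefix cs ψ)).1
    change _ ≤ (Formula.ex c.1 (Formula.exPrefix cs ψ)).code
    rw [List.length_cons]
    omega

theorem Formula.rHolds_eFlatBody (Q : ℕ → ℤ → Prop) (I : Interp) (v : ℕ → ℤ) (x : ℕ)
    (cs : List (ℕ × Formula)) : ∀ α : Formula,
    (Formula.eFlatBody x α cs).RHolds Q I v ↔ α.RHolds Q I v ∧ ∀ c ∈ cs,
      (Set.ncard {i : ℤ | (0 ≤ i ∧ i < I.par 0) ∧ c.2.RHolds Q I (update v x i)} : ℤ) = v c.1 := by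
  induction cs with
  | nil => intro α; simp [Formula.eFlatBody]
  | cons c cs ih =>
    intro α
    refine (ih (.and α (.eq (.card x c.2) (.var c.1)))).trans ?_
    simp only [Formula.RHolds, Term.reval, List.forall_mem_cons]
    exact and_assoc

/-- Each quantifier is witnessed by the current value of its variable, so repeated variables in the
prefix cause no difficulty. -/
theorem Formula.rHolds_exPrefix_of {Q : ℕ → ℤ → Prop} {I : Interp} {v : ℕ → ℤ} {ψ : Formula}
    (hQ : ∀ y m, Q m (v y)) (h : ψ.RHolds Q I v) (cs : List (ℕ × Formula)) :
    (Formula.exPrefix cs ψ).RHolds Q I v := by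
  induction cs with
  | nil => exact h
  | cons c cs ih =>
    change (Formula.ex c.1 (Formula.exPrefix cs ψ)).RHolds Q I v
    simp only [Formula.RHolds]
    exact ⟨v c.1, hQ _ _, by rwa [update_eq_self]⟩

/-- The final assignment differs from `v` only at values admitted by a quantifier of the prefix.
Such a quantifier has a Gödel number above that of `ψ`, which provides the bound needed to evaluate
`ψ` next. -/
theorem Formula.exists_of_rHolds_exPrefix {Q : ℕ → ℤ → Prop} {I : Interp} {ψ : Formula}
    (cs : List (ℕ × Formula)) : ∀ {v : ℕ → ℤ}, (Formula.exPrefix cs ψ).RHolds Q I v →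
    ∃ u : ℕ → ℤ, ψ.RHolds Q I u ∧ ∀ y, u y = v y ∨ ∃ m > ψ.code,
      m ≤ (Formula.exPrefix cs ψ).code ∧ Q m (u y) := by
  induction cs with
  | nil => intro v h; exact ⟨v, h, fun _ => Or.inl rfl⟩
  | cons c cs ih =>
    intro v h
    change (Formula.ex c.1 (Formula.exPrefix cs ψ)).RHolds Q I v at h
    have hlt := (Formula.code_lt_ex c.1 (Formula.exPrefix cs ψ)).1
    simp only [Formula.RHolds] at h
    obtain ⟨i, hi, h⟩ := h
    obtain ⟨u, hu, hu'⟩ := ih h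
    refine ⟨u, hu, fun y => ?_⟩
    rcases hu' y with hy | ⟨m, hm, hm', hQ⟩
    · by_cases hyc : y = c.1
      · subst hyc
        rw [update_self] at hy
        refine Or.inr ⟨_, ?_, le_rfl, by rw [hy]; exact hi⟩
        have := Formula.code_exPrefix cs ψ
        exact lt_of_le_of_lt (by omega) hlt
      · rw [update_of_ne hyc] at hy
        exact Or.inl hy
    · exact Or.inr ⟨m, hm, hm'.trans hlt.le, hQ⟩

/-- The range of the quantifiers in the subformula with Gödel number `m` of a formula with Gödel
number below `n`. -/
def quantBound (n m : ℕ) : ℕ := grow^[n - m] (modelBound n)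

theorem grow_quantBound {n m : ℕ} (h : m < n) : grow (quantBound n (m + 1)) = quantBound n m := by
  unfold quantBound
  rw [← iterate_succ_apply' grow]
  congr 2
  omega

theorem modelBound_le_quantBound (n m : ℕ) : modelBound n ≤ quantBound n m :=
  le_iterate le_grow _ _

theorem quantBound_anti {n m m' : ℕ} (h : m ≤ m') : quantBound n m' ≤ quantBound n m :=
  iterate_le_iterate le_grow (by omega) _

/-- The restriction of the quantifiers to bounded ranges. -/
def BoundedBy (n m : ℕ) (i : ℤ) : Prop := |i| ≤ quantBound n m

/-- For basic formulae of bounded size and bounded values, the quantifiers may be bounded. -/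
theorem Formula.rHolds_bounded_iff {n : ℕ} {φ : Formula} (hφ : φ.IsBasic) (hn : φ.code < n)
    {I : Interp} {v : ℕ → ℤ} (hp : ∀ p, |I.par p| ≤ modelBound n)
    (ha : ∀ a i, |I.arr a i| ≤ modelBound n) (hv : ∀ y, |v y| ≤ quantBound n (φ.code + 1)) :
    φ.RHolds (BoundedBy n) I v ↔ φ.Holds I v := by
  have hle : ∀ m, (modelBound n : ℤ) ≤ quantBound n m := fun m => by
    exact_mod_cast modelBound_le_quantBound n m
  rw [Formula.holds_iff_sat_env hφ, Formula.rHolds_iff_sat (v := v) (e := I.env v) hφ hn (fun _ _ => rfl)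
    (fun _ _ _ => rfl) (fun _ _ _ _ _ _ => rfl)]
  refine Formula.sat_bounded_iff (r := quantBound n) (fun m hm => (grow_quantBound hm).le) ?_ ?_
    φ hφ hn (fun i _ => ?_)
  · exact (satLevel_le_pointLevel n).trans ((pointLevel_le_tupleBound n).trans
      ((tupleBound_le_modelBound n).trans (modelBound_le_quantBound n n)))
  · exact (card_Idx_le n).trans ((Nat.le_add_right _ _).trans ((dimension_le_tupleBound n).trans
      ((tupleBound_le_modelBound n).trans (modelBound_le_quantBound n n))))
  · cases i with
    | par p => exact (hp p).trans (hle _)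
    | var y => exact hv y
    | app a y => exact (ha a (v y)).trans (hle _)

/-- The matrix of an E-flat formula may be evaluated with bounded quantifiers. -/
theorem Formula.rHolds_eFlatBody_bounded_iff {n x : ℕ} {α : Formula} {cs : List (ℕ × Formula)}
    (hα : α.IsBasic) (hcs : ∀ c ∈ cs, c.2.IsBasic) (hn : (Formula.eFlatBody x α cs).code < n)
    {I : Interp} {v : ℕ → ℤ} (hp : ∀ p, |I.par p| ≤ modelBound n)
    (ha : ∀ a i, |I.arr a i| ≤ modelBound n)
    (hv : ∀ y, |v y| ≤ quantBound n ((Formula.eFlatBody x α cs).code + 1)) :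
    (Formula.eFlatBody x α cs).RHolds (BoundedBy n) I v ↔
      (Formula.eFlatBody x α cs).Holds I v := by
  obtain ⟨h1, -, h3⟩ := Formula.code_eFlatBody x cs α
  have hanti : ∀ {m m'}, m ≤ m' → (quantBound n m' : ℤ) ≤ quantBound n m := fun h => by
    exact_mod_cast quantBound_anti h
  rw [← Formula.rHolds_true, Formula.rHolds_eFlatBody, Formula.rHolds_eFlatBody,
    Formula.rHolds_bounded_iff hα (by omega) hp ha fun y => (hv y).trans (hanti (by omega)),
    Formula.rHolds_true]
  refine and_congr_right fun _ => forall₂_congr fun c hc => ?_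
  -- The counted points lie in `[0, N)` and `N` is at most `modelBound n`, so giving `x` such a
  -- value respects the bound on assignments.
  have hset : {i : ℤ | (0 ≤ i ∧ i < I.par 0) ∧ c.2.RHolds (BoundedBy n) I (update v x i)} =
      {i : ℤ | (0 ≤ i ∧ i < I.par 0) ∧ c.2.RHolds (fun _ _ => True) I (update v x i)} := by
    ext i
    refine and_congr_right fun hi => ?_
    rw [Formula.rHolds_true]
    have := h3 c hc
    refine Formula.rHolds_bounded_iff (hcs c hc) (by omega) hp ha fun y => ?_
    by_cases hyx : y = x
    · subst hyx
      rw [update_self]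
      have h4 := hp 0
      have h5 : (modelBound n : ℤ) ≤ quantBound n (c.2.code + 1) := by
        exact_mod_cast modelBound_le_quantBound n _
      rw [abs_of_nonneg hi.1]
      have := le_abs_self (I.par 0)
      omega
    · rw [update_of_ne hyx]
      exact (hv y).trans (hanti (by omega))
  rw [hset]

/-- Satisfiability of E-flat formulae is satisfiability by bounded values and with bounded
quantifiers. -/
theorem Formula.satisfiable_eFlat_iff {x n : ℕ} {α : Formula} {cs : List (ℕ × Formula)}
    (hα : α.IsBasic) (hcs : ∀ c ∈ cs, c.2.IsBasic) (hαx : ¬ α.Free x) (hx : x < n)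
    (hn : (Formula.eFlat x α cs).code < n) :
    (Formula.eFlat x α cs).Satisfiable ↔ ∃ (I : Interp) (v : ℕ → ℤ),
      (∀ p, |I.par p| ≤ modelBound n) ∧ (∀ a i, |I.arr a i| ≤ modelBound n) ∧
      (∀ y, |v y| ≤ modelBound n) ∧ (Formula.eFlat x α cs).RHolds (BoundedBy n) I v := by
  have he : Formula.eFlat x α cs = Formula.exPrefix cs (Formula.eFlatBody x α cs) := rfl
  obtain ⟨h1, -, h3⟩ := Formula.code_eFlatBody x cs α
  have h4 := Formula.code_exPrefix cs (Formula.eFlatBody x α cs)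
  rw [he] at hn ⊢
  have hle : ∀ m, (modelBound n : ℤ) ≤ quantBound n m := fun m => by
    exact_mod_cast modelBound_le_quantBound n m
  constructor
  · rintro ⟨I, v₀, hv₀⟩
    rw [← Formula.rHolds_true] at hv₀
    obtain ⟨v, hv, -⟩ := Formula.exists_of_rHolds_exPrefix cs hv₀
    rw [Formula.rHolds_eFlatBody, Formula.rHolds_true] at hv
    simp only [Formula.rHolds_true] at hv
    -- A default entry for list access; only indices below the length are used.
    let d : ℕ × Formula := (0, .lt (.num 0) (.num 0))
    have hmem : ∀ k < cs.length, cs.getD k d ∈ cs := fun k hk => by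
      rw [List.getD_eq_getElem _ _ hk]; exact List.getElem_mem hk
    obtain ⟨J, u, hp, ha, hu, hJα, hJβ⟩ := exists_small_model (n := n) (x := x) (K := cs.length)
      (α := α) (β := fun k => (cs.getD k d).2) (z := fun k => (cs.getD k d).1) hx (by omega) hα
      (by omega) hαx (fun k hk => ⟨hcs _ (hmem k hk), by have := h3 _ (hmem k hk); omega⟩)
      (fun k hk => by have := h3 _ (hmem k hk); omega) hv.1 (fun k hk => hv.2 _ (hmem k hk))
    refine ⟨J, u, hp, ha, hu, Formula.rHolds_exPrefix_of (Q := BoundedBy n)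
      (fun y m => (hu y).trans (hle m)) ?_ cs⟩
    rw [Formula.rHolds_eFlatBody_bounded_iff hα hcs (by omega) hp ha
      fun y => (hu y).trans (hle _), ← Formula.rHolds_true, Formula.rHolds_eFlatBody,
      Formula.rHolds_true]
    simp only [Formula.rHolds_true]
    refine ⟨hJα, fun c hc => ?_⟩
    obtain ⟨k, hk, rfl⟩ := List.getElem_of_mem hc
    have := hJβ k hk
    rwa [List.getD_eq_getElem _ _ hk] at this
  · rintro ⟨I, v₀, hp, ha, hv₀, h⟩
    obtain ⟨v, hv, hv'⟩ := Formula.exists_of_rHolds_exPrefix cs h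
    rw [Formula.rHolds_eFlatBody_bounded_iff hα hcs (by omega) hp ha fun y => ?_,
      ← Formula.rHolds_true] at hv
    · refine ⟨I, v, ?_⟩
      rw [← Formula.rHolds_true]
      exact Formula.rHolds_exPrefix_of (fun _ _ => trivial) hv cs
    · rcases hv' y with hy | ⟨m, hm, -, hQ⟩
      · rw [hy]; exact (hv₀ y).trans (hle _)
      · exact hQ.trans (by exact_mod_cast quantBound_anti hm)

/-! ### Free variables are bounded by the Gödel number -/

mutual

theorem Term.lt_code_of_free {x : ℕ} : ∀ t : Term, t.Free x → x < t.code + 1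
  | .num _, h => h.elim
  | .par _, h => h.elim
  | .var y, h => by simp only [Term.Free] at h; simp only [Term.code]; omega
  | .add t u, h => by
    have h1 := Nat.left_le_pair t.code u.code
    have h2 := Nat.right_le_pair t.code u.code
    simp only [Term.Free] at h
    simp only [Term.code]
    rcases h with h | h
    · have := Term.lt_code_of_free t h; omega
    · have := Term.lt_code_of_free u h; omega
  | .neg t, h => by
    simp only [Term.Free] at h
    have := Term.lt_code_of_free t h
    simp only [Term.code]; omega
  | .app a t, h => by
    simp only [Term.Free] at h
    have := Term.lt_code_of_free t h
    have h2 := Nat.right_le_pair a t.code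
    simp only [Term.code]; omega
  | .card y φ, h => by
    simp only [Term.Free] at h
    have := Formula.lt_code_of_free φ h.2
    have h2 := Nat.right_le_pair y φ.code
    simp only [Term.code]; omega

theorem Formula.lt_code_of_free {x : ℕ} : ∀ φ : Formula, φ.Free x → x < φ.code + 1
  | .lt t u, h | .eq t u, h => by
    have h1 := Nat.left_le_pair t.code u.code
    have h2 := Nat.right_le_pair t.code u.code
    simp only [Formula.Free] at h
    simp only [Formula.code]
    rcases h with h | h
    · have := Term.lt_code_of_free t h; omega
    · have := Term.lt_code_of_free u h; omega
  | .modEq m t u, h => by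
    have h1 := Nat.left_le_pair t.code u.code
    have h2 := Nat.right_le_pair t.code u.code
    have h3 := Nat.right_le_pair m (Nat.pair t.code u.code)
    simp only [Formula.Free] at h
    simp only [Formula.code]
    rcases h with h | h
    · have := Term.lt_code_of_free t h; omega
    · have := Term.lt_code_of_free u h; omega
  | .and φ ψ, h => by
    have h1 := Nat.left_le_pair φ.code ψ.code
    have h2 := Nat.right_le_pair φ.code ψ.code
    simp only [Formula.Free] at h
    simp only [Formula.code]
    rcases h with h | h
    · have := Formula.lt_code_of_free φ h; omega
    · have := Formula.lt_code_of_free ψ h; omega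
  | .not φ, h => by
    simp only [Formula.Free] at h
    have := Formula.lt_code_of_free φ h
    simp only [Formula.code]; omega
  | .ex y φ, h => by
    simp only [Formula.Free] at h
    have := Formula.lt_code_of_free φ h.2
    have h2 := Nat.right_le_pair y φ.code
    simp only [Formula.code]; omega

end

/-- In the definition of E-flat formulae the counting variable can be bounded. -/
theorem Formula.isEFlat_iff (φ : Formula) : φ.IsEFlat ↔
    ∃ x < φ.code + 2, ∃ (α : Formula) (cs : List (ℕ × Formula)),
      α.IsBasic ∧ (∀ c ∈ cs, c.2.IsBasic) ∧ ¬ α.Free x ∧ φ = Formula.eFlat x α cs := by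
  constructor
  · rintro ⟨x, α, cs, h1, h2, h3, rfl⟩
    -- Without constraints the counting variable is immaterial and is replaced by one too large to
    -- be free in `α`; otherwise it occurs in a cardinality term and so lies below the Gödel number.
    rcases eq_or_ne cs [] with rfl | hcs
    · refine ⟨α.code + 1, Nat.lt_succ_self _, α, [], h1, h2, fun h => ?_, rfl⟩
      have := Formula.lt_code_of_free α h
      omega
    · have h4 := (Formula.code_eFlatBody x cs α).2.1 hcs
      have h5 := Formula.code_exPrefix cs (Formula.eFlatBody x α cs)
      refine ⟨x, ?_, α, cs, h1, h2, h3, rfl⟩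
      change x < (Formula.exPrefix cs (Formula.eFlatBody x α cs)).code + 2
      omega
  · rintro ⟨x, -, α, cs, h⟩
    exact ⟨x, α, cs, h⟩

end ArrayCard

-- Primitive recursiveness of the bounds, the evaluator and the syntactic tests

namespace ArrayCard

open Function

/-! ### Primitive recursive functions -/

section Primrec

variable {α β γ σ : Type*} [Primcodable α] [Primcodable β] [Primcodable γ] [Primcodable σ]

attribute [fun_prop] Primrec

@[fun_prop]
theorem primrec_id : Primrec fun a : α => a := Primrec.id

@[fun_prop]
theorem primrec_const (c : σ) : Primrec fun _ : α => c := Primrec.const c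

@[fun_prop]
theorem primrec_comp {f : β → σ} {g : α → β} (hf : Primrec f) (hg : Primrec g) :
    Primrec fun a => f (g a) := hf.comp hg

@[fun_prop]
theorem primrec_pair {f : α → β} {g : α → γ} (hf : Primrec f) (hg : Primrec g) :
    Primrec fun a => (f a, g a) := hf.pair hg

@[fun_prop]
theorem primrec_fst {f : α → β × γ} (hf : Primrec f) : Primrec fun a => (f a).1 :=
  Primrec.fst.comp hf

@[fun_prop]
theorem primrec_snd {f : α → β × γ} (hf : Primrec f) : Primrec fun a => (f a).2 :=
  Primrec.snd.comp hf

@[fun_prop]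
theorem primrec_add {f g : α → ℕ} (hf : Primrec f) (hg : Primrec g) :
    Primrec fun a => f a + g a := Primrec.nat_add.comp hf hg

@[fun_prop]
theorem primrec_sub {f g : α → ℕ} (hf : Primrec f) (hg : Primrec g) :
    Primrec fun a => f a - g a := Primrec.nat_sub.comp hf hg

@[fun_prop]
theorem primrec_mul {f g : α → ℕ} (hf : Primrec f) (hg : Primrec g) :
    Primrec fun a => f a * g a := Primrec.nat_mul.comp hf hg

@[fun_prop]
theorem primrec_div {f g : α → ℕ} (hf : Primrec f) (hg : Primrec g) :
    Primrec fun a => f a / g a := Primrec.nat_div.comp hf hg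

@[fun_prop]
theorem primrec_mod {f g : α → ℕ} (hf : Primrec f) (hg : Primrec g) :
    Primrec fun a => f a % g a := Primrec.nat_mod.comp hf hg

@[fun_prop]
theorem primrec_iterate {f : α → ℕ} {g : α → β} {h : α → β → β} (hf : Primrec f) (hg : Primrec g)
    (hh : Primrec fun p : α × β => h p.1 p.2) : Primrec fun a => (h a)^[f a] (g a) :=
  Primrec.nat_iterate hf hg hh

@[fun_prop]
theorem primrec_pow {f g : α → ℕ} (hf : Primrec f) (hg : Primrec g) :
    Primrec fun a => f a ^ g a := by
  have h : Primrec fun a => (fun x => x * f a)^[g a] 1 :=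
    primrec_iterate hg (primrec_const 1) (by fun_prop)
  refine h.of_eq fun a => ?_
  induction g a with
  | zero => simp
  | succ k ih => rw [iterate_succ_apply', ih, pow_succ]

@[fun_prop]
theorem primrec_factorial {f : α → ℕ} (hf : Primrec f) : Primrec fun a => (f a).factorial := by
  have h : Primrec fun a => ((fun q : ℕ × ℕ => (q.1 + 1, (q.1 + 1) * q.2))^[f a] (0, 1)).2 :=
    Primrec.snd.comp (primrec_iterate hf (primrec_const (0, 1)) (by fun_prop))
  refine h.of_eq fun a => ?_
  have : ∀ k, (fun q : ℕ × ℕ => (q.1 + 1, (q.1 + 1) * q.2))^[k] (0, 1) = (k, k.factorial) := by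
    intro k
    induction k with
    | zero => rfl
    | succ k ih => rw [iterate_succ_apply', ih]; rfl
  rw [this]

@[fun_prop]
theorem primrec_natPair {f g : α → ℕ} (hf : Primrec f) (hg : Primrec g) :
    Primrec fun a => Nat.pair (f a) (g a) := Primrec₂.natPair.comp hf hg

@[fun_prop]
theorem primrec_unpair {f : α → ℕ} (hf : Primrec f) : Primrec fun a => (f a).unpair :=
  Primrec.unpair.comp hf

@[fun_prop]
theorem primrec_cond {c : α → Bool} {f g : α → σ} (hc : Primrec c) (hf : Primrec f)
    (hg : Primrec g) : Primrec fun a => bif c a then f a else g a := Primrec.cond hc hf hg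

@[fun_prop]
theorem primrec_decide_eq {f g : α → ℕ} (hf : Primrec f) (hg : Primrec g) :
    Primrec fun a => decide (f a = g a) := (PrimrecRel.comp Primrec.eq hf hg).decide

@[fun_prop]
theorem primrec_decide_lt {f g : α → ℕ} (hf : Primrec f) (hg : Primrec g) :
    Primrec fun a => decide (f a < g a) := (PrimrecRel.comp Primrec.nat_lt hf hg).decide

@[fun_prop]
theorem primrec_and {f g : α → Bool} (hf : Primrec f) (hg : Primrec g) :
    Primrec fun a => f a && g a := Primrec.and.comp hf hg

@[fun_prop]
theorem primrec_or {f g : α → Bool} (hf : Primrec f) (hg : Primrec g) :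
    Primrec fun a => f a || g a := Primrec.or.comp hf hg

@[fun_prop]
theorem primrec_not {f : α → Bool} (hf : Primrec f) : Primrec fun a => !f a := Primrec.not.comp hf

@[fun_prop]
theorem primrec_optionGetD {f : α → Option σ} {g : α → σ} (hf : Primrec f) (hg : Primrec g) :
    Primrec fun a => (f a).getD (g a) := Primrec.option_getD.comp hf hg

@[fun_prop]
theorem primrec_cons {f : α → β} {g : α → List β} (hf : Primrec f) (hg : Primrec g) :
    Primrec fun a => f a :: g a := Primrec.list_cons.comp hf hg

@[fun_prop]
theorem primrec_append {f g : α → List β} (hf : Primrec f) (hg : Primrec g) :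
    Primrec fun a => f a ++ g a := Primrec.list_append.comp hf hg

@[fun_prop]
theorem primrec_range {f : α → ℕ} (hf : Primrec f) : Primrec fun a => List.range (f a) :=
  Primrec.list_range.comp hf

@[fun_prop]
theorem primrec_map {f : α → List β} {g : α → β → σ} (hf : Primrec f)
    (hg : Primrec fun p : α × β => g p.1 p.2) : Primrec fun a => (f a).map (g a) :=
  Primrec.list_map hf hg

@[fun_prop]
theorem primrec_listGetD {f : α → List β} {g : α → ℕ} (d : β) (hf : Primrec f) (hg : Primrec g) :
    Primrec fun a => (f a).getD (g a) d := (Primrec.list_getD d).comp hf hg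

@[fun_prop]
theorem primrec_take {f : α → ℕ} {g : α → List β} (hf : Primrec f) (hg : Primrec g) :
    Primrec fun a => (g a).take (f a) := Primrec.list_take.comp hf hg

@[fun_prop]
theorem primrec_drop {f : α → ℕ} {g : α → List β} (hf : Primrec f) (hg : Primrec g) :
    Primrec fun a => (g a).drop (f a) := Primrec.list_drop.comp hf hg

@[fun_prop]
theorem primrec_tail {f : α → List β} (hf : Primrec f) : Primrec fun a => (f a).tail :=
  Primrec.list_tail.comp hf

@[fun_prop]
theorem primrec_length {f : α → List β} (hf : Primrec f) : Primrec fun a => (f a).length :=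
  Primrec.list_length.comp hf

@[fun_prop]
theorem primrec_lookup {f : α → ℕ} {g : α → List (ℕ × β)} (hf : Primrec f) (hg : Primrec g) :
    Primrec fun a => (g a).lookup (f a) := Primrec.listLookup.comp hf hg

@[fun_prop]
theorem primrec_countP {p : β → Bool} {f : α → List β} (hp : Primrec p) (hf : Primrec f) :
    Primrec fun a => (f a).countP p := by
  have : PrimrecPred fun b => p b = true :=
    PrimrecRel.comp Primrec.eq hp (Primrec.const true)
  refine (Primrec.list_length.comp ((Primrec.listFilter this).comp hf)).of_eq fun a => ?_
  simp [List.countP_eq_length_filter]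

@[fun_prop]
theorem primrec_any {p : β → Bool} {f : α → List β} (hp : Primrec p) (hf : Primrec f) :
    Primrec fun a => (f a).any p := by
  have h : Primrec fun a => decide (0 < (f a).countP p) := by fun_prop
  refine h.of_eq fun a => ?_
  rw [Bool.eq_iff_iff, decide_eq_true_iff, List.countP_pos_iff, List.any_eq_true]

@[fun_prop]
theorem primrec_decide_mem {f : α → ℕ} {g : α → List ℕ} (hf : Primrec f) (hg : Primrec g) :
    Primrec fun a => decide (f a ∈ g a) := by
  have h : PrimrecRel fun (L : List ℕ) (b : ℕ) => ∃ a ∈ L, a = b :=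
    PrimrecRel.exists_mem_list Primrec.eq
  exact ((PrimrecRel.comp h hg hf).of_eq fun a => by simp).decide

end Primrec

/-! ### Integer arithmetic -/

section Int

variable {α : Type*} [Primcodable α]

/-- Integers are coded by parity: even codes for nonnegative, odd codes for negative numbers.
Integer operations are reduced below to natural arithmetic on the positive and negative parts. -/
theorem encode_int_natCast (n : ℕ) : Encodable.encode (n : ℤ) = 2 * n := rfl

theorem encode_int_negSucc (n : ℕ) : Encodable.encode (Int.negSucc n) = 2 * n + 1 := rfl

@[fun_prop]
theorem primrec_toNat {f : α → ℤ} (hf : Primrec f) : Primrec fun a => (f a).toNat := by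
  have h : Primrec fun z : ℤ => bif decide (Encodable.encode z % 2 = 0) then
      Encodable.encode z / 2 else 0 :=
    primrec_comp (f := fun k : ℕ => bif decide (k % 2 = 0) then k / 2 else 0) (by fun_prop)
      Primrec.encode
  refine (h.of_eq fun z => ?_ : Primrec Int.toNat).comp hf
  rcases z with n | n
  · change (bif decide (2 * n % 2 = 0) then 2 * n / 2 else 0) = n
    simp
  · change (bif decide ((2 * n + 1) % 2 = 0) then (2 * n + 1) / 2 else 0) = 0
    simp

@[fun_prop]
theorem primrec_negToNat {f : α → ℤ} (hf : Primrec f) : Primrec fun a => (-f a).toNat := by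
  have h : Primrec fun z : ℤ => bif decide (Encodable.encode z % 2 = 0) then
      0 else Encodable.encode z / 2 + 1 :=
    primrec_comp (f := fun k : ℕ => bif decide (k % 2 = 0) then 0 else k / 2 + 1) (by fun_prop)
      Primrec.encode
  refine (h.of_eq fun z => ?_ : Primrec fun z : ℤ => (-z).toNat).comp hf
  rcases z with n | n
  · change (bif decide (2 * n % 2 = 0) then 0 else 2 * n / 2 + 1) = _
    simp
  · change (bif decide ((2 * n + 1) % 2 = 0) then 0 else (2 * n + 1) / 2 + 1) = n + 1
    have h2 : (2 * n + 1) / 2 = n := by omega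
    simp [h2]

@[fun_prop]
theorem primrec_natSub {f g : α → ℕ} (hf : Primrec f) (hg : Primrec g) :
    Primrec fun a => (f a : ℤ) - g a := by
  have h : Primrec fun p : ℕ × ℕ => Encodable.encode ((p.1 : ℤ) - p.2) := by
    have h' : Primrec fun p : ℕ × ℕ => bif decide (p.1 < p.2) then 2 * (p.2 - p.1 - 1) + 1
        else 2 * (p.1 - p.2) := by fun_prop
    refine h'.of_eq fun p => ?_
    by_cases hp : p.1 < p.2
    · obtain ⟨k, hk⟩ := Nat.exists_eq_add_of_lt hp
      have e : (p.1 : ℤ) - p.2 = Int.negSucc k := by rw [Int.negSucc_eq]; omega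
      rw [e, encode_int_negSucc, decide_eq_true hp, cond_true]
      omega
    · have e : (p.1 : ℤ) - p.2 = ((p.1 - p.2 : ℕ) : ℤ) := by omega
      rw [e, encode_int_natCast, decide_eq_false hp, cond_false]
  exact (Primrec.encode_iff.1 h).comp (hf.pair hg)

@[fun_prop]
theorem primrec_natCast {f : α → ℕ} (hf : Primrec f) : Primrec fun a => (f a : ℤ) :=
  (primrec_natSub hf (primrec_const 0)).of_eq fun a => by simp

@[fun_prop]
theorem primrec_intAdd {f g : α → ℤ} (hf : Primrec f) (hg : Primrec g) :
    Primrec fun a => f a + g a := by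
  have : Primrec fun a => (((f a).toNat + (g a).toNat : ℕ) : ℤ) -
      (((-f a).toNat + (-g a).toNat : ℕ) : ℤ) := by fun_prop
  exact this.of_eq fun a => by omega

@[fun_prop]
theorem primrec_intNeg {f : α → ℤ} (hf : Primrec f) : Primrec fun a => -f a := by
  have : Primrec fun a => (((-f a).toNat : ℕ) : ℤ) - (((f a).toNat : ℕ) : ℤ) := by fun_prop
  exact this.of_eq fun a => by omega

/-- The order of integers as a Boolean function. -/
def intLt (a b : ℤ) : Bool := decide (a < b)

/-- Congruence of integers as a Boolean function. -/
def intModEq (n : ℕ) (a b : ℤ) : Bool := decide (a ≡ b [ZMOD n])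

theorem intLt_iff {a b : ℤ} : intLt a b = true ↔ a < b := decide_eq_true_iff

theorem intModEq_iff {n : ℕ} {a b : ℤ} : intModEq n a b = true ↔ a ≡ b [ZMOD n] :=
  decide_eq_true_iff

@[fun_prop]
theorem primrec_intLt {f g : α → ℤ} (hf : Primrec f) (hg : Primrec g) :
    Primrec fun a => intLt (f a) (g a) := by
  have : Primrec fun a => decide ((f a).toNat + (-g a).toNat < (g a).toNat + (-f a).toNat) := by
    fun_prop
  exact this.of_eq fun a => decide_eq_decide.2 (by omega)

@[fun_prop]
theorem primrec_intModEq {f g : α → ℤ} {n : α → ℕ} (hf : Primrec f) (hg : Primrec g)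
    (hn : Primrec n) : Primrec fun a => intModEq (n a) (f a) (g a) := by
  have : Primrec fun a => decide (((f a).toNat + (-g a).toNat) % n a =
      ((g a).toNat + (-f a).toNat) % n a) := by
    fun_prop
  refine this.of_eq fun a => decide_eq_decide.2 ?_
  change _ ≡ _ [MOD n a] ↔ _
  rw [← Int.natCast_modEq_iff, Int.modEq_iff_dvd, Int.modEq_iff_dvd]
  have : (((g a).toNat + (-f a).toNat : ℕ) : ℤ) - ((f a).toNat + (-g a).toNat : ℕ) = g a - f a := by
    omega
  rw [this]

end Int

/-! ### The bounds -/

theorem primrec_lift : Primrec lift := by unfold lift; fun_prop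

theorem primrec_grow : Primrec grow := by unfold grow; fun_prop

theorem primrec_lift_iterate {α : Type*} [Primcodable α] {f g : α → ℕ} (hf : Primrec f)
    (hg : Primrec g) : Primrec fun a => lift^[f a] (g a) :=
  primrec_iterate hf hg (primrec_lift.comp Primrec.snd)

theorem primrec_grow_iterate {α : Type*} [Primcodable α] {f g : α → ℕ} (hf : Primrec f)
    (hg : Primrec g) : Primrec fun a => grow^[f a] (g a) :=
  primrec_iterate hf hg (primrec_grow.comp Primrec.snd)

theorem primrec_pointLevel : Primrec pointLevel :=
  primrec_lift_iterate Primrec.id (primrec_lift_iterate Primrec.id Primrec.id)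

theorem primrec_dimension : Primrec dimension := by
  have h := primrec_pointLevel
  unfold dimension pieceCount cellCount termCount
  fun_prop

theorem primrec_modelBound : Primrec modelBound := by
  have h1 := primrec_pointLevel
  have h2 := primrec_dimension
  refine primrec_grow_iterate Primrec.id (primrec_grow_iterate h2 ?_)
  exact primrec_add h2 (primrec_lift_iterate h2 (primrec_lift.comp h1))

@[fun_prop]
theorem primrec_modelBound_comp {α : Type*} [Primcodable α] {f : α → ℕ} (hf : Primrec f) :
    Primrec fun a => modelBound (f a) := primrec_modelBound.comp hf

@[fun_prop]
theorem primrec_quantBound {α : Type*} [Primcodable α] {f g : α → ℕ} (hf : Primrec f)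
    (hg : Primrec g) : Primrec fun a => quantBound (f a) (g a) :=
  primrec_grow_iterate (primrec_sub hf hg) (primrec_modelBound_comp hf)

/-! ### Decoding of terms and formulae -/

/-- The term with a given Gödel number. -/
noncomputable def termOf (m : ℕ) : Term := (code_surj m).1.choose

/-- The formula with a given Gödel number. -/
noncomputable def formulaOf (m : ℕ) : Formula := (code_surj m).2.choose

theorem code_termOf (m : ℕ) : (termOf m).code = m := (code_surj m).1.choose_spec

theorem code_formulaOf (m : ℕ) : (formulaOf m).code = m := (code_surj m).2.choose_spec

theorem termOf_code (t : Term) : termOf t.code = t := Term.code_inj _ _ (code_termOf _)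

theorem formulaOf_code (φ : Formula) : formulaOf φ.code = φ := Formula.code_inj _ _ (code_formulaOf _)

/-- Gödel numbers among which are those of all immediate subterms and subformulae of the term and of
the formula with Gödel number `m`. -/
def subcodes (m : ℕ) : List ℕ :=
  [m / 7, (m / 7).unpair.1, (m / 7).unpair.2, m / 6, (m / 6).unpair.1, (m / 6).unpair.2,
    (m / 6).unpair.2.unpair.1, (m / 6).unpair.2.unpair.2]

@[fun_prop]
theorem primrec_subcodes {α : Type*} [Primcodable α] {f : α → ℕ} (hf : Primrec f) :
    Primrec fun a => subcodes (f a) := by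
  unfold subcodes; fun_prop

theorem lt_of_mem_subcodes {m k : ℕ} (hm : m ≠ 0) (hk : k ∈ subcodes m) : k < m := by
  have h1 := Nat.unpair_left_le (m / 7)
  have h2 := Nat.unpair_right_le (m / 7)
  have h3 := Nat.unpair_left_le (m / 6)
  have h4 := Nat.unpair_right_le (m / 6)
  have h5 := Nat.unpair_left_le (m / 6).unpair.2
  have h6 := Nat.unpair_right_le (m / 6).unpair.2
  simp only [subcodes, List.mem_cons, List.not_mem_nil, or_false] at hk
  omega

/-! ### Interpretations coded by natural numbers -/

/-- The digit with index `k` of `s` in base `2 * T + 1`, shifted to the interval `[-T, T]`. -/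
def digit (T s k : ℕ) : ℤ := (s / (2 * T + 1) ^ k % (2 * T + 1) : ℕ) - (T : ℤ)

theorem abs_digit_le (T s k : ℕ) : |digit T s k| ≤ T := by
  have := Nat.mod_lt (s / (2 * T + 1) ^ k) (show 2 * T + 1 > 0 by omega)
  unfold digit
  rw [abs_le]
  omega

theorem exists_digits (T : ℕ) (h : ℕ → ℤ) (D : ℕ) (hh : ∀ k < D, |h k| ≤ T) :
    ∃ s < (2 * T + 1) ^ D, ∀ k < D, digit T s k = h k := by
  induction D with
  | zero => exact ⟨0, by simp, by simp⟩
  | succ D ih =>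
    obtain ⟨s, hs, hsd⟩ := ih fun k hk => hh k (by omega)
    have hD := hh D (Nat.lt_succ_self D)
    rw [abs_le] at hD
    obtain ⟨d, hd⟩ : ∃ d : ℕ, (d : ℤ) = h D + T := ⟨(h D + T).toNat, by omega⟩
    have hdb : d < 2 * T + 1 := by omega
    have hpos : 0 < (2 * T + 1) ^ D := by positivity
    refine ⟨s + (2 * T + 1) ^ D * d, ?_, fun k hk => ?_⟩
    · rw [pow_succ]
      nlinarith
    · rcases Nat.lt_succ_iff_lt_or_eq.1 hk with hk | rfl
      · rw [← hsd k hk]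
        obtain ⟨j, rfl⟩ := Nat.exists_eq_add_of_lt hk
        unfold digit
        have : s + (2 * T + 1) ^ (k + j + 1) * d
            = s + (2 * T + 1) ^ k * ((2 * T + 1) * ((2 * T + 1) ^ j * d)) := by ring
        rw [this, Nat.add_mul_div_left _ _ (by positivity), Nat.add_mul_mod_self_left]
      · unfold digit
        rw [Nat.add_mul_div_left _ _ hpos, Nat.div_eq_of_lt hs, zero_add, Nat.mod_eq_of_lt hdb]
        omega

@[fun_prop]
theorem primrec_digit {α : Type*} [Primcodable α] {f g h : α → ℕ} (hf : Primrec f) (hg : Primrec g)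
    (hh : Primrec h) : Primrec fun a => digit (f a) (g a) (h a) := by
  unfold digit; fun_prop

/-- The interpretation coded by a natural number. -/
def interpOf (T s : ℕ) : Interp where
  par p := digit T s (3 * p)
  arr a i := if 0 ≤ i ∧ i < digit T s 0 then digit T s (3 * Nat.pair a i.toNat + 1) else 0
  arr_outside _ _ hi := if_neg hi

/-- The assignment of the variables coded by a natural number, with exceptions given by a list. -/
def assignOf (T s : ℕ) (l : List (ℕ × ℤ)) (y : ℕ) : ℤ :=
  (l.lookup y).getD (digit T s (3 * y + 2))

theorem assignOf_cons (T s : ℕ) (l : List (ℕ × ℤ)) (x : ℕ) (i : ℤ) :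
    assignOf T s ((x, i) :: l) = update (assignOf T s l) x i := by
  funext y
  unfold assignOf
  by_cases h : y = x
  · subst h; simp
  · rw [update_of_ne h, List.lookup_cons]
    have : (y == x) = false := by simpa using h
    rw [this]

/-! ### The evaluator -/

open Classical in
/-- The value of the term and the truth of the formula with a given Gödel number, with quantifiers
restricted to bounded ranges. -/
noncomputable def evalCode (b : (ℕ × ℕ) × ℕ × List (ℕ × ℤ)) : ℤ × Bool :=
  ((termOf b.2.1).reval (BoundedBy b.1.1) (interpOf (modelBound b.1.1) b.1.2)
      (assignOf (modelBound b.1.1) b.1.2 b.2.2),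
    decide ((formulaOf b.2.1).RHolds (BoundedBy b.1.1) (interpOf (modelBound b.1.1) b.1.2)
      (assignOf (modelBound b.1.1) b.1.2 b.2.2)))

/-- The length of the arrays. -/
def arrayLength (b : (ℕ × ℕ) × ℕ × List (ℕ × ℤ)) : ℕ :=
  (digit (modelBound b.1.1) b.1.2 0).toNat

/-- The arguments of the recursive calls of the evaluator. -/
def evalCalls (b : (ℕ × ℕ) × ℕ × List (ℕ × ℤ)) : List ((ℕ × ℕ) × ℕ × List (ℕ × ℤ)) :=
  -- The number `0` codes both the numeral `0` and the formula `0 < 0`. Its subcodes are not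
  -- smaller, so no calls are made; the default result `(0, false)` then gives the right truth
  -- value.
  bif decide (b.2.1 = 0) then [] else
    -- Layout of the results: positions `0` to `7` for the subcodes, then one per point of the array
    -- for a cardinality term, then one per value in the range of a quantifier.
    (subcodes b.2.1).map (fun k => (b.1, k, b.2.2)) ++
    ((List.range (arrayLength b)).map (fun i : ℕ =>
      (b.1, (b.2.1 / 7).unpair.2, ((b.2.1 / 7).unpair.1, (i : ℤ)) :: b.2.2)) ++
    (List.range (2 * quantBound b.1.1 b.2.1 + 1)).map (fun i : ℕ =>
      (b.1, (b.2.1 / 6).unpair.2,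
        ((b.2.1 / 6).unpair.1, (i : ℤ) - (quantBound b.1.1 b.2.1 : ℕ)) :: b.2.2)))

/-- The value of a term, from the values of the recursive calls. -/
def evalTermStep (b : (ℕ × ℕ) × ℕ × List (ℕ × ℤ)) (r : List (ℤ × Bool)) : ℤ :=
  bif decide (b.2.1 % 7 = 0) then ((b.2.1 / 7 : ℕ) : ℤ) else
  bif decide (b.2.1 % 7 = 1) then digit (modelBound b.1.1) b.1.2 (3 * (b.2.1 / 7)) else
  bif decide (b.2.1 % 7 = 2) then (b.2.2.lookup (b.2.1 / 7)).getD
    (digit (modelBound b.1.1) b.1.2 (3 * (b.2.1 / 7) + 2)) else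
  bif decide (b.2.1 % 7 = 3) then (r.getD 1 (0, false)).1 + (r.getD 2 (0, false)).1 else
  bif decide (b.2.1 % 7 = 4) then -(r.getD 0 (0, false)).1 else
  bif decide (b.2.1 % 7 = 5) then
    (bif !intLt (r.getD 2 (0, false)).1 0 &&
        intLt (r.getD 2 (0, false)).1 (digit (modelBound b.1.1) b.1.2 0) then
      digit (modelBound b.1.1) b.1.2
        (3 * Nat.pair (b.2.1 / 7).unpair.1 (r.getD 2 (0, false)).1.toNat + 1) else 0)
  else ((((r.drop 8).take (arrayLength b)).countP fun q => q.2 : ℕ) : ℤ)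

/-- The truth value of a formula, from the values of the recursive calls. -/
def evalFormulaStep (b : (ℕ × ℕ) × ℕ × List (ℕ × ℤ)) (r : List (ℤ × Bool)) : Bool :=
  bif decide (b.2.1 % 6 = 0) then intLt (r.getD 4 (0, false)).1 (r.getD 5 (0, false)).1 else
  -- Equality of integers is tested as congruence modulo `0`.
  bif decide (b.2.1 % 6 = 1) then intModEq 0 (r.getD 4 (0, false)).1 (r.getD 5 (0, false)).1 else
  bif decide (b.2.1 % 6 = 2) then intModEq (b.2.1 / 6).unpair.1 (r.getD 6 (0, false)).1 (r.getD 7 (0, false)).1 else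
  bif decide (b.2.1 % 6 = 3) then (r.getD 4 (0, false)).2 && (r.getD 5 (0, false)).2 else
  bif decide (b.2.1 % 6 = 4) then !(r.getD 3 (0, false)).2 else
  (r.drop (8 + arrayLength b)).any fun q => q.2

theorem primrec_arrayLength : Primrec arrayLength := by unfold arrayLength; fun_prop

theorem primrec_evalCalls : Primrec evalCalls := by
  have h := primrec_arrayLength
  unfold evalCalls
  fun_prop

theorem primrec_evalTermStep : Primrec fun p : ((ℕ × ℕ) × ℕ × List (ℕ × ℤ)) × List (ℤ × Bool) =>
    evalTermStep p.1 p.2 := by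
  have h := primrec_arrayLength
  unfold evalTermStep
  refine primrec_cond (by fun_prop) (by fun_prop) (primrec_cond (by fun_prop) (by fun_prop)
    (primrec_cond (by fun_prop) (by fun_prop) (primrec_cond (by fun_prop) (by fun_prop)
    (primrec_cond (by fun_prop) (by fun_prop) (primrec_cond (by fun_prop) ?_ (by fun_prop))))))
  exact primrec_cond (by fun_prop) (by fun_prop) (by fun_prop)

theorem primrec_evalFormulaStep :
    Primrec fun p : ((ℕ × ℕ) × ℕ × List (ℕ × ℤ)) × List (ℤ × Bool) =>
      evalFormulaStep p.1 p.2 := by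
  have h := primrec_arrayLength
  unfold evalFormulaStep
  exact primrec_cond (by fun_prop) (by fun_prop) (primrec_cond (by fun_prop) (by fun_prop)
    (primrec_cond (by fun_prop) (by fun_prop) (primrec_cond (by fun_prop) (by fun_prop)
    (primrec_cond (by fun_prop) (by fun_prop) (by fun_prop)))))

theorem getD_subcodes (m : ℕ) :
    (subcodes m).getD 0 0 = m / 7 ∧ (subcodes m).getD 1 0 = (m / 7).unpair.1 ∧
    (subcodes m).getD 2 0 = (m / 7).unpair.2 ∧ (subcodes m).getD 3 0 = m / 6 ∧
    (subcodes m).getD 4 0 = (m / 6).unpair.1 ∧ (subcodes m).getD 5 0 = (m / 6).unpair.2 ∧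
    (subcodes m).getD 6 0 = (m / 6).unpair.2.unpair.1 ∧
    (subcodes m).getD 7 0 = (m / 6).unpair.2.unpair.2 :=
  ⟨rfl, rfl, rfl, rfl, rfl, rfl, rfl, rfl⟩

theorem interpOf_arr (T s a : ℕ) (i : ℤ) : (interpOf T s).arr a i =
    if 0 ≤ i ∧ i < digit T s 0 then digit T s (3 * Nat.pair a i.toNat + 1) else 0 :=
  rfl

theorem getD_evalCalls {b : (ℕ × ℕ) × ℕ × List (ℕ × ℤ)} (hm : b.2.1 ≠ 0) {k : ℕ} (hk : k < 8) :
    ((evalCalls b).map evalCode).getD k (0, false) =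
      evalCode (b.1, (subcodes b.2.1).getD k 0, b.2.2) := by
  have hlen : (subcodes b.2.1).length = 8 := rfl
  simp only [evalCalls, decide_eq_false hm, cond_false, List.map_append, List.map_map]
  rw [List.getD_append _ _ _ _ (by simp [hlen, hk]), List.getD_eq_getElem _ _ (by simp [hlen, hk]),
    List.getElem_map, List.getD_eq_getElem _ _ (by simp [hlen, hk])]
  rfl

theorem drop_evalCalls {b : (ℕ × ℕ) × ℕ × List (ℕ × ℤ)} (hm : b.2.1 ≠ 0) :
    ((evalCalls b).map evalCode).drop 8 =
      (List.range (arrayLength b)).map (fun i : ℕ => evalCode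
        (b.1, (b.2.1 / 7).unpair.2, ((b.2.1 / 7).unpair.1, (i : ℤ)) :: b.2.2)) ++
      (List.range (2 * quantBound b.1.1 b.2.1 + 1)).map (fun i : ℕ => evalCode
        (b.1, (b.2.1 / 6).unpair.2,
          ((b.2.1 / 6).unpair.1, (i : ℤ) - (quantBound b.1.1 b.2.1 : ℕ)) :: b.2.2)) := by
  have hlen : ((subcodes b.2.1).map fun k => evalCode (b.1, k, b.2.2)).length = 8 := by
    simp [subcodes]
  simp only [evalCalls, decide_eq_false hm, cond_false, List.map_append, List.map_map]
  exact List.drop_left' hlen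

theorem take_drop_evalCalls {b : (ℕ × ℕ) × ℕ × List (ℕ × ℤ)} (hm : b.2.1 ≠ 0) :
    (((evalCalls b).map evalCode).drop 8).take (arrayLength b) =
      (List.range (arrayLength b)).map (fun i : ℕ => evalCode
        (b.1, (b.2.1 / 7).unpair.2, ((b.2.1 / 7).unpair.1, (i : ℤ)) :: b.2.2)) := by
  rw [drop_evalCalls hm]
  exact List.take_left' (by simp)

theorem drop_drop_evalCalls {b : (ℕ × ℕ) × ℕ × List (ℕ × ℤ)} (hm : b.2.1 ≠ 0) :
    ((evalCalls b).map evalCode).drop (8 + arrayLength b) =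
      (List.range (2 * quantBound b.1.1 b.2.1 + 1)).map (fun i : ℕ => evalCode
        (b.1, (b.2.1 / 6).unpair.2,
          ((b.2.1 / 6).unpair.1, (i : ℤ) - (quantBound b.1.1 b.2.1 : ℕ)) :: b.2.2)) := by
  rw [← List.drop_drop, drop_evalCalls hm]
  exact List.drop_left' (by simp)

theorem evalCode_fst (p : ℕ × ℕ) (t : Term) (l : List (ℕ × ℤ)) :
    (evalCode (p, t.code, l)).1 = t.reval (BoundedBy p.1) (interpOf (modelBound p.1) p.2)
      (assignOf (modelBound p.1) p.2 l) := by
  simp only [evalCode, termOf_code]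

theorem evalCode_snd (p : ℕ × ℕ) (φ : Formula) (l : List (ℕ × ℤ)) :
    (evalCode (p, φ.code, l)).2 = true ↔ φ.RHolds (BoundedBy p.1) (interpOf (modelBound p.1) p.2)
      (assignOf (modelBound p.1) p.2 l) := by
  simp only [evalCode, formulaOf_code, decide_eq_true_iff]

theorem countP_range_eq_ncard (N : ℤ) (P : ℤ → Prop) (q : ℕ → ℤ × Bool)
    (hq : ∀ i : ℕ, (q i).2 = true ↔ P i) :
    (((List.range N.toNat).map q).countP fun a => a.2) =
      Set.ncard {i : ℤ | (0 ≤ i ∧ i < N) ∧ P i} := by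
  classical
  have h1 : {i : ℤ | (0 ≤ i ∧ i < N) ∧ P i} =
      (fun i : ℕ => (i : ℤ)) '' (((Finset.range N.toNat).filter fun i : ℕ => P i) : Set ℕ) := by
    ext i
    simp only [Set.mem_ofPred_eq, Set.mem_image, Finset.coe_filter, Finset.mem_range]
    constructor
    · rintro ⟨⟨h0, h1⟩, h2⟩
      exact ⟨i.toNat, ⟨by omega, by rwa [Int.toNat_of_nonneg h0]⟩, Int.toNat_of_nonneg h0⟩
    · rintro ⟨j, ⟨h1, h2⟩, rfl⟩
      exact ⟨⟨by omega, by omega⟩, h2⟩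
  rw [h1, Set.ncard_image_of_injective _ Nat.cast_injective, Set.ncard_coe_finset,
    List.countP_map, List.countP_eq_length_filter]
  have h2 : (Finset.range N.toNat).filter (fun i : ℕ => P i) =
      ((List.range N.toNat).filter ((fun a => a.2) ∘ q)).toFinset := by
    ext i
    simp [hq]
  rw [h2, List.toFinset_card_of_nodup (List.nodup_range.filter _)]

/-- With `evalFormulaStep_iff`, this says that the semantically defined `evalCode` satisfies the
recursion given by the two step functions. -/
theorem evalTermStep_eq (p : ℕ × ℕ) (l : List (ℕ × ℤ)) (t : Term) :
    evalTermStep (p, t.code, l) ((evalCalls (p, t.code, l)).map evalCode) =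
      t.reval (BoundedBy p.1) (interpOf (modelBound p.1) p.2)
        (assignOf (modelBound p.1) p.2 l) := by
  have hget : ∀ k < 8, t.code ≠ 0 → ((evalCalls (p, t.code, l)).map evalCode).getD k (0, false) =
      evalCode (p, (subcodes t.code).getD k 0, l) := fun k hk hm =>
    getD_evalCalls (b := (p, t.code, l)) hm hk
  have htake : t.code ≠ 0 → _ := fun hm => take_drop_evalCalls (b := (p, t.code, l)) hm
  cases t with
  | num n =>
    simp [evalTermStep, Term.code, Term.reval]
  | par q =>
    have h1 : (7 * q + 1) % 7 = 1 := by omega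
    have h2 : (7 * q + 1) / 7 = q := by omega
    simp [evalTermStep, Term.code, Term.reval, h1, h2, interpOf]
  | var y =>
    have h1 : (7 * y + 2) % 7 = 2 := by omega
    have h2 : (7 * y + 2) / 7 = y := by omega
    simp [evalTermStep, Term.code, Term.reval, h1, h2, assignOf]
  | add t u =>
    have h0 : (Term.add t u).code ≠ 0 := by simp [Term.code]
    have h1 : (7 * Nat.pair t.code u.code + 3) % 7 = 3 := by omega
    have h2 : (7 * Nat.pair t.code u.code + 3) / 7 = Nat.pair t.code u.code := by omega
    have e1 := hget 1 (by norm_num) h0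
    have e2 := hget 2 (by norm_num) h0
    simp only [Term.code] at e1 e2
    simp [evalTermStep, Term.code, Term.reval, h1, e1, e2, h2, getD_subcodes, evalCode_fst,
      -List.getD_eq_getElem?_getD]
  | neg t =>
    have h0 : (Term.neg t).code ≠ 0 := by simp [Term.code]
    have h1 : (7 * t.code + 4) % 7 = 4 := by omega
    have h2 : (7 * t.code + 4) / 7 = t.code := by omega
    have e1 := hget 0 (by norm_num) h0
    simp only [Term.code] at e1
    simp [evalTermStep, Term.code, Term.reval, h1, e1, h2, getD_subcodes, evalCode_fst,
      -List.getD_eq_getElem?_getD]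
  | app a t =>
    have h0 : (Term.app a t).code ≠ 0 := by simp [Term.code]
    have h1 : (7 * Nat.pair a t.code + 5) % 7 = 5 := by omega
    have h2 : (7 * Nat.pair a t.code + 5) / 7 = Nat.pair a t.code := by omega
    have e1 := hget 2 (by norm_num) h0
    simp only [Term.code] at e1
    simp [evalTermStep, Term.code, Term.reval, h1, e1, h2, getD_subcodes, evalCode_fst, interpOf_arr, intLt,
      -List.getD_eq_getElem?_getD, Bool.cond_eq_ite]
  | card x φ =>
    have h0 : (Term.card x φ).code ≠ 0 := by simp [Term.code]
    have h1 : (7 * Nat.pair x φ.code + 6) % 7 = 6 := by omega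
    have h2 : (7 * Nat.pair x φ.code + 6) / 7 = Nat.pair x φ.code := by omega
    have e1 := htake h0
    simp only [Term.code] at e1
    simp only [evalTermStep, Term.code, Term.reval, h1, e1, h2, Nat.unpair_pair]
    norm_num
    have := countP_range_eq_ncard (digit (modelBound p.1) p.2 0)
      (fun i => φ.RHolds (BoundedBy p.1) (interpOf (modelBound p.1) p.2)
        (update (assignOf (modelBound p.1) p.2 l) x i))
      (fun i : ℕ => evalCode (p, φ.code, (x, (i : ℤ)) :: l))
      (fun i => by rw [evalCode_snd, assignOf_cons])
    rw [List.countP_map] at this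
    exact this

theorem evalFormulaStep_iff (p : ℕ × ℕ) (l : List (ℕ × ℤ)) (φ : Formula) :
    evalFormulaStep (p, φ.code, l) ((evalCalls (p, φ.code, l)).map evalCode) = true ↔
      φ.RHolds (BoundedBy p.1) (interpOf (modelBound p.1) p.2)
        (assignOf (modelBound p.1) p.2 l) := by
  have hget : ∀ k < 8, φ.code ≠ 0 → ((evalCalls (p, φ.code, l)).map evalCode).getD k (0, false) =
      evalCode (p, (subcodes φ.code).getD k 0, l) := fun k hk hm =>
    getD_evalCalls (b := (p, φ.code, l)) hm hk
  have hdrop : φ.code ≠ 0 → _ := fun hm => drop_drop_evalCalls (b := (p, φ.code, l)) hm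
  cases φ with
  | lt t u =>
    have h1 : (6 * Nat.pair t.code u.code) % 6 = 0 := by omega
    have h2 : (6 * Nat.pair t.code u.code) / 6 = Nat.pair t.code u.code := by omega
    by_cases h0 : (Formula.lt t u).code = 0
    · have ht : t.code = (Term.num 0).code := by
        have := Nat.left_le_pair t.code u.code
        simp only [Formula.code] at h0
        simp only [Term.code]; omega
      have hu : u.code = (Term.num 0).code := by
        have := Nat.right_le_pair t.code u.code
        simp only [Formula.code] at h0
        simp only [Term.code]; omega
      obtain rfl := Term.code_inj _ _ ht
      obtain rfl := Term.code_inj _ _ hu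
      rw [h0]
      simp [evalFormulaStep, evalCalls, intLt, Formula.RHolds, Term.reval]
    · have e1 := hget 4 (by norm_num) h0
      have e2 := hget 5 (by norm_num) h0
      simp only [Formula.code] at e1 e2
      simp [evalFormulaStep, Formula.code, Formula.RHolds, e1, e2, h2, getD_subcodes, evalCode_fst,
        intLt_iff, -List.getD_eq_getElem?_getD]
  | eq t u =>
    have h0 : (Formula.eq t u).code ≠ 0 := by simp [Formula.code]
    have h1 : (6 * Nat.pair t.code u.code + 1) % 6 = 1 := by omega
    have h2 : (6 * Nat.pair t.code u.code + 1) / 6 = Nat.pair t.code u.code := by omega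
    have e1 := hget 4 (by norm_num) h0
    have e2 := hget 5 (by norm_num) h0
    simp only [Formula.code] at e1 e2
    simp [evalFormulaStep, Formula.code, Formula.RHolds, e1, e2, h1, h2, getD_subcodes, evalCode_fst,
      intModEq_iff, -List.getD_eq_getElem?_getD, Int.modEq_zero_iff]
  | modEq n t u =>
    have h0 : (Formula.modEq n t u).code ≠ 0 := by simp [Formula.code]
    have h1 : (6 * Nat.pair n (Nat.pair t.code u.code) + 2) % 6 = 2 := by omega
    have h2 : (6 * Nat.pair n (Nat.pair t.code u.code) + 2) / 6 =
      Nat.pair n (Nat.pair t.code u.code) := by omega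
    have e1 := hget 6 (by norm_num) h0
    have e2 := hget 7 (by norm_num) h0
    simp only [Formula.code] at e1 e2
    simp [evalFormulaStep, Formula.code, Formula.RHolds, e1, e2, h1, h2, getD_subcodes, evalCode_fst,
      intModEq_iff, -List.getD_eq_getElem?_getD]
  | and φ ψ =>
    have h0 : (Formula.and φ ψ).code ≠ 0 := by simp [Formula.code]
    have h1 : (6 * Nat.pair φ.code ψ.code + 3) % 6 = 3 := by omega
    have h2 : (6 * Nat.pair φ.code ψ.code + 3) / 6 = Nat.pair φ.code ψ.code := by omega
    have e1 := hget 4 (by norm_num) h0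
    have e2 := hget 5 (by norm_num) h0
    simp only [Formula.code] at e1 e2
    simp [evalFormulaStep, Formula.code, Formula.RHolds, e1, e2, h1, h2, getD_subcodes, evalCode_snd,
      -List.getD_eq_getElem?_getD]
  | not φ =>
    have h0 : (Formula.not φ).code ≠ 0 := by simp [Formula.code]
    have h1 : (6 * φ.code + 4) % 6 = 4 := by omega
    have h2 : (6 * φ.code + 4) / 6 = φ.code := by omega
    have e1 := hget 3 (by norm_num) h0
    simp only [Formula.code] at e1
    have h3 := evalCode_snd p φ l
    simp [evalFormulaStep, Formula.code, Formula.RHolds, e1, h1, h2, getD_subcodes, ← h3,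
      -List.getD_eq_getElem?_getD]
  | ex x φ =>
    have h0 : (Formula.ex x φ).code ≠ 0 := by simp [Formula.code]
    have h1 : (6 * Nat.pair x φ.code + 5) % 6 = 5 := by omega
    have h2 : (6 * Nat.pair x φ.code + 5) / 6 = Nat.pair x φ.code := by omega
    have e1 := hdrop h0
    have hstep : evalFormulaStep (p, (Formula.ex x φ).code, l)
        ((evalCalls (p, (Formula.ex x φ).code, l)).map evalCode) =
        (((evalCalls (p, (Formula.ex x φ).code, l)).map evalCode).drop
          (8 + arrayLength (p, (Formula.ex x φ).code, l))).any fun q => q.2 := by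
      simp only [evalFormulaStep, Formula.code, h1]
      norm_num
    have h3 : (Formula.ex x φ).code / 6 = Nat.pair x φ.code := h2
    rw [hstep, e1, List.any_eq_true]
    simp only [h3, Nat.unpair_pair, List.mem_map, List.mem_range, Formula.RHolds]
    constructor
    · rintro ⟨_, ⟨i, hi, rfl⟩, h⟩
      rw [evalCode_snd, assignOf_cons] at h
      exact ⟨_, by rw [BoundedBy, abs_le]; omega, h⟩
    · rintro ⟨i, hi, h⟩
      rw [BoundedBy, abs_le] at hi
      refine ⟨_, ⟨(i + quantBound p.1 (Formula.ex x φ).code).toNat, by omega, rfl⟩, ?_⟩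
      rw [evalCode_snd, assignOf_cons, Int.toNat_of_nonneg (by omega), add_sub_cancel_right]
      exact h

/-- Course-of-values recursion on the Gödel number: the calls go to smaller numbers, and their list
has primitive recursive length because cardinalities and quantifiers range over bounded sets. -/
theorem primrec_evalCode : Primrec evalCode := by
  refine Primrec.nat_omega_rec' evalCode (m := fun b => b.2.1) (l := evalCalls)
    (g := fun b r => some (evalTermStep b r, evalFormulaStep b r)) (by fun_prop)
    primrec_evalCalls (Primrec.option_some.comp
      (primrec_evalTermStep.pair primrec_evalFormulaStep)) ?_ ?_
  · intro b b' hb'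
    by_cases hm : b.2.1 = 0
    · simp [evalCalls, hm] at hb'
    · have h2 : (b.2.1 / 7).unpair.2 ∈ subcodes b.2.1 := by simp [subcodes]
      have h3 : (b.2.1 / 6).unpair.2 ∈ subcodes b.2.1 := by simp [subcodes]
      simp only [evalCalls, decide_eq_false hm, cond_false, List.mem_append, List.mem_map] at hb'
      rcases hb' with ⟨k, hk, rfl⟩ | ⟨_, _, rfl⟩ | ⟨_, _, rfl⟩
      · exact lt_of_mem_subcodes hm hk
      · exact lt_of_mem_subcodes hm h2
      · exact lt_of_mem_subcodes hm h3
  · rintro ⟨p, m, l⟩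
    have h1 := evalTermStep_eq p l (termOf m)
    have h2 := evalFormulaStep_iff p l (formulaOf m)
    rw [code_termOf, ← evalCode_fst, code_termOf] at h1
    rw [code_formulaOf, ← evalCode_snd, code_formulaOf, ← Bool.eq_iff_iff] at h2
    rw [h1, h2]

/-! ### Bounded search for a model -/

mutual

/-- The value of a term depends only on finitely many names. -/
theorem Term.reval_congr {Q : ℕ → ℤ → Prop} {I J : Interp} {n : ℕ} (hp : ∀ p < n, I.par p = J.par p)
    (ha : ∀ a < n, ∀ i, I.arr a i = J.arr a i) (h0 : I.par 0 = J.par 0) :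
    ∀ (t : Term) (v w : ℕ → ℤ), t.code < n → (∀ y < n, v y = w y) →
      t.reval Q I v = t.reval Q J w
  | .num m, v, w, _, _ => by simp only [Term.reval]
  | .par p, v, w, h, _ => by
    simp only [Term.code] at h
    simp only [Term.reval]
    exact hp p (by omega)
  | .var y, v, w, h, hv => by
    simp only [Term.code] at h
    simp only [Term.reval]
    exact hv y (by omega)
  | .add t u, v, w, h, hv => by
    simp only [Term.code] at h
    have h1 := Nat.left_le_pair t.code u.code
    have h2 := Nat.right_le_pair t.code u.code
    simp only [Term.reval]
    rw [Term.reval_congr hp ha h0 t v w (by omega) hv, Term.reval_congr hp ha h0 u v w (by omega) hv]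
  | .neg t, v, w, h, hv => by
    simp only [Term.code] at h
    simp only [Term.reval]
    rw [Term.reval_congr hp ha h0 t v w (by omega) hv]
  | .app a t, v, w, h, hv => by
    simp only [Term.code] at h
    have h1 := Nat.left_le_pair a t.code
    have h2 := Nat.right_le_pair a t.code
    simp only [Term.reval]
    rw [Term.reval_congr hp ha h0 t v w (by omega) hv]
    exact ha a (by omega) _
  | .card x φ, v, w, h, hv => by
    simp only [Term.code] at h
    have h2 := Nat.right_le_pair x φ.code
    simp only [Term.reval, h0]
    congr 2
    ext i
    refine and_congr_right fun _ =>
      Formula.rHolds_congr hp ha h0 φ _ _ (by omega) fun y hy => ?_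
    simp only [update_apply]
    split_ifs
    · rfl
    · exact hv y hy

/-- The truth of a formula depends only on finitely many names. -/
theorem Formula.rHolds_congr {Q : ℕ → ℤ → Prop} {I J : Interp} {n : ℕ}
    (hp : ∀ p < n, I.par p = J.par p)
    (ha : ∀ a < n, ∀ i, I.arr a i = J.arr a i) (h0 : I.par 0 = J.par 0) :
    ∀ (φ : Formula) (v w : ℕ → ℤ), φ.code < n → (∀ y < n, v y = w y) →
      (φ.RHolds Q I v ↔ φ.RHolds Q J w)
  | .lt t u, v, w, h, hv | .eq t u, v, w, h, hv => by
    simp only [Formula.code] at h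
    have h1 := Nat.left_le_pair t.code u.code
    have h2 := Nat.right_le_pair t.code u.code
    simp only [Formula.RHolds]
    rw [Term.reval_congr hp ha h0 t v w (by omega) hv, Term.reval_congr hp ha h0 u v w (by omega) hv]
  | .modEq m t u, v, w, h, hv => by
    simp only [Formula.code] at h
    have h1 := Nat.left_le_pair t.code u.code
    have h2 := Nat.right_le_pair t.code u.code
    have h3 := Nat.right_le_pair m (Nat.pair t.code u.code)
    simp only [Formula.RHolds]
    rw [Term.reval_congr hp ha h0 t v w (by omega) hv, Term.reval_congr hp ha h0 u v w (by omega) hv]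
  | .and φ ψ, v, w, h, hv => by
    simp only [Formula.code] at h
    have h1 := Nat.left_le_pair φ.code ψ.code
    have h2 := Nat.right_le_pair φ.code ψ.code
    simp only [Formula.RHolds]
    rw [Formula.rHolds_congr hp ha h0 φ v w (by omega) hv,
      Formula.rHolds_congr hp ha h0 ψ v w (by omega) hv]
  | .not φ, v, w, h, hv => by
    simp only [Formula.code] at h
    simp only [Formula.RHolds]
    rw [Formula.rHolds_congr hp ha h0 φ v w (by omega) hv]
  | .ex x φ, v, w, h, hv => by
    simp only [Formula.code] at h
    have h2 := Nat.right_le_pair x φ.code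
    simp only [Formula.RHolds]
    refine exists_congr fun i => and_congr_right fun _ =>
      Formula.rHolds_congr hp ha h0 φ _ _ (by omega) fun y hy => ?_
    simp only [update_apply]
    split_ifs
    · rfl
    · exact hv y hy

end

/-- A bound for the number of digits of the codes of the interpretations to be searched. -/
def digitCount (n : ℕ) : ℕ := 3 * (n + modelBound n + 1) ^ 2 + 3

/-- Every small interpretation is coded by a natural number, up to irrelevant names. -/
theorem exists_code_interp {n : ℕ} (J : Interp) (u : ℕ → ℤ) (hp : ∀ p, |J.par p| ≤ modelBound n)
    (ha : ∀ a i, |J.arr a i| ≤ modelBound n) (hu : ∀ y, |u y| ≤ modelBound n) :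
    ∃ s < (2 * modelBound n + 1) ^ digitCount n,
      (∀ p < n, (interpOf (modelBound n) s).par p = J.par p) ∧
      (∀ a < n, ∀ i, (interpOf (modelBound n) s).arr a i = J.arr a i) ∧
      (interpOf (modelBound n) s).par 0 = J.par 0 ∧
      ∀ y < n, assignOf (modelBound n) s [] y = u y := by
  obtain ⟨s, hs, hd⟩ := exists_digits (modelBound n)
    (fun k => if k % 3 = 0 then J.par (k / 3) else if k % 3 = 1 then
      J.arr (k / 3).unpair.1 (k / 3).unpair.2 else u (k / 3)) (digitCount n) fun k _ => by
      split_ifs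
      exacts [hp _, ha _ _, hu _]
  have hle : n ≤ (n + modelBound n + 1) ^ 2 :=
    le_trans (by omega) (Nat.le_self_pow two_ne_zero (n + modelBound n + 1))
  have h0 : digit (modelBound n) s 0 = J.par 0 := by
    rw [hd 0 (by unfold digitCount; omega)]; simp
  refine ⟨s, hs, fun p hpn => ?_, fun a han i => ?_, h0, fun y hy => ?_⟩
  · change digit (modelBound n) s (3 * p) = _
    rw [hd _ (by unfold digitCount; omega)]
    simp
  · rw [interpOf_arr, h0]
    split_ifs with hi
    · have hN := (abs_le.1 (hp 0)).2
      -- A relevant array entry has `a < n` and `i < N ≤ modelBound n`, so the pair of the two is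
      -- below the square occurring in `digitCount`.
      have hmax : max a i.toNat + 1 ≤ n + modelBound n + 1 := by
        have : i.toNat ≤ modelBound n := by omega
        omega
      have h1 := Nat.pair_lt_max_add_one_sq a i.toNat
      have h2 := Nat.pow_le_pow_left hmax 2
      rw [hd _ (by unfold digitCount; omega)]
      have e1 : (3 * Nat.pair a i.toNat + 1) % 3 = 1 := by omega
      have e2 : (3 * Nat.pair a i.toNat + 1) / 3 = Nat.pair a i.toNat := by omega
      simp [e1, e2, hi.1]
    · exact (J.arr_outside a i hi).symm
  · change digit (modelBound n) s (3 * y + 2) = _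
    rw [hd _ (by unfold digitCount; omega)]
    have e1 : (3 * y + 2) % 3 = 2 := by omega
    have e2 : (3 * y + 2) / 3 = y := by omega
    simp [e1, e2]

/-- The parameter `φ.code + 2` exceeds both the Gödel number of `φ` and the counting variable
supplied by `Formula.isEFlat_iff`. -/
theorem Formula.IsEFlat.satisfiable_iff {φ : Formula} (h : φ.IsEFlat) :
    φ.Satisfiable ↔ ∃ s < (2 * modelBound (φ.code + 2) + 1) ^ digitCount (φ.code + 2),
      (evalCode ((φ.code + 2, s), φ.code, [])).2 = true := by
  obtain ⟨x, hx, α, cs, hα, hcs, hαx, rfl⟩ := φ.isEFlat_iff.1 h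
  set φ := Formula.eFlat x α cs with hφ
  have hn : φ.code < φ.code + 2 := by omega
  rw [Formula.satisfiable_eFlat_iff hα hcs hαx hx hn]
  simp only [evalCode_snd]
  constructor
  · rintro ⟨J, u, hp, ha, hu, hJ⟩
    obtain ⟨s, hs, h1, h2, h3, h4⟩ := exists_code_interp J u hp ha hu
    exact ⟨s, hs, (Formula.rHolds_congr h1 h2 h3 φ _ _ hn h4).2 hJ⟩
  · rintro ⟨s, -, hJ⟩
    refine ⟨_, _, fun p => abs_digit_le _ _ _, fun a i => ?_, fun y => abs_digit_le _ _ _, hJ⟩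
    rw [interpOf_arr]
    split_ifs
    · exact abs_digit_le _ _ _
    · simp

theorem primrecPred_search : PrimrecPred fun m : ℕ =>
    ∃ s < (2 * modelBound (m + 2) + 1) ^ digitCount (m + 2),
      (evalCode ((m + 2, s), m, [])).2 = true := by
  have h1 : PrimrecRel fun s m : ℕ => (evalCode ((m + 2, s), m, [])).2 = true :=
    Primrec.eq.comp (Primrec.snd.comp (primrec_evalCode.comp (by fun_prop))) (by fun_prop)
  refine h1.exists_lt.comp (f := fun m => (2 * modelBound (m + 2) + 1) ^ digitCount (m + 2))
    (g := fun m => m) ?_ Primrec.id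
  unfold digitCount
  fun_prop

/-! ### Recognition of basic formulae -/

open Classical in
/-- Whether the term and the formula with a given Gödel number are basic in the scope of given bound
variables, and whether a given variable occurs free in them. -/
noncomputable def syntaxCode (b : ℕ × List ℕ × ℕ) : (Bool × Bool) × Bool × Bool :=
  ((decide ((termOf b.1).IsBasic b.2.1), decide ((formulaOf b.1).IsBasicIn b.2.1)),
    decide ((termOf b.1).Free b.2.2), decide ((formulaOf b.1).Free b.2.2))

/-- The arguments of the recursive calls of `syntaxCode`. -/
def syntaxCalls (b : ℕ × List ℕ × ℕ) : List (ℕ × List ℕ × ℕ) :=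
  bif decide (b.1 = 0) then [] else
    (subcodes b.1).map (fun k => (k, b.2)) ++
      -- Position `8` serves basicness under a quantifier, whose scope adds the bound variable to
      -- the list. Freeness ignores the list and reads position `5`.
      [((b.1 / 6).unpair.2, (b.1 / 6).unpair.1 :: b.2.1, b.2.2)]

/-- The result for the `k`-th recursive call of `syntaxCode`. -/
def syntaxGet (r : List ((Bool × Bool) × Bool × Bool)) (k : ℕ) : (Bool × Bool) × Bool × Bool :=
  -- The default is the correct answer for the numeral `0`, hence for both sides of `0 < 0`, the
  -- formula with number `0`, for which no calls are made.
  r.getD k ((true, true), false, false)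

/-- Whether a term is basic, from the results of the recursive calls. -/
def basicTermStep (b : ℕ × List ℕ × ℕ) (r : List ((Bool × Bool) × Bool × Bool)) : Bool :=
  bif decide (b.1 % 7 < 3) then true else
  bif decide (b.1 % 7 = 3) then (syntaxGet r 1).1.1 && (syntaxGet r 2).1.1 else
  bif decide (b.1 % 7 = 4) then (syntaxGet r 0).1.1 else
  bif decide (b.1 % 7 = 5) then decide ((b.1 / 7).unpair.2 % 7 = 2) &&
    !decide ((b.1 / 7).unpair.2 / 7 ∈ b.2.1) else false

/-- Whether a formula is basic, from the results of the recursive calls. -/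
def basicFormulaStep (b : ℕ × List ℕ × ℕ) (r : List ((Bool × Bool) × Bool × Bool)) : Bool :=
  bif decide (b.1 % 6 < 2) then (syntaxGet r 4).1.1 && (syntaxGet r 5).1.1 else
  bif decide (b.1 % 6 = 2) then (syntaxGet r 6).1.1 && (syntaxGet r 7).1.1 else
  bif decide (b.1 % 6 = 3) then (syntaxGet r 4).1.2 && (syntaxGet r 5).1.2 else
  bif decide (b.1 % 6 = 4) then (syntaxGet r 3).1.2 else (syntaxGet r 8).1.2

/-- Whether a variable is free in a term, from the results of the recursive calls. -/
def freeTermStep (b : ℕ × List ℕ × ℕ) (r : List ((Bool × Bool) × Bool × Bool)) : Bool :=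
  bif decide (b.1 % 7 < 2) then false else
  bif decide (b.1 % 7 = 2) then decide (b.2.2 = b.1 / 7) else
  bif decide (b.1 % 7 = 3) then (syntaxGet r 1).2.1 || (syntaxGet r 2).2.1 else
  bif decide (b.1 % 7 = 4) then (syntaxGet r 0).2.1 else
  bif decide (b.1 % 7 = 5) then (syntaxGet r 2).2.1 else
  !decide (b.2.2 = (b.1 / 7).unpair.1) && (syntaxGet r 2).2.2

/-- Whether a variable is free in a formula, from the results of the recursive calls. -/
def freeFormulaStep (b : ℕ × List ℕ × ℕ) (r : List ((Bool × Bool) × Bool × Bool)) : Bool :=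
  bif decide (b.1 % 6 < 2) then (syntaxGet r 4).2.1 || (syntaxGet r 5).2.1 else
  bif decide (b.1 % 6 = 2) then (syntaxGet r 6).2.1 || (syntaxGet r 7).2.1 else
  bif decide (b.1 % 6 = 3) then (syntaxGet r 4).2.2 || (syntaxGet r 5).2.2 else
  bif decide (b.1 % 6 = 4) then (syntaxGet r 3).2.2 else
  !decide (b.2.2 = (b.1 / 6).unpair.1) && (syntaxGet r 5).2.2

@[fun_prop]
theorem primrec_syntaxGet {α : Type*} [Primcodable α] {f : α → List ((Bool × Bool) × Bool × Bool)}
    (k : ℕ) (hf : Primrec f) : Primrec fun a => syntaxGet (f a) k := by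
  unfold syntaxGet; fun_prop

theorem primrec_syntaxCalls : Primrec syntaxCalls := by
  unfold syntaxCalls; fun_prop

theorem primrec_basicTermStep :
    Primrec fun p : (ℕ × List ℕ × ℕ) × List ((Bool × Bool) × Bool × Bool) =>
      basicTermStep p.1 p.2 := by
  unfold basicTermStep
  exact primrec_cond (by fun_prop) (by fun_prop) (primrec_cond (by fun_prop) (by fun_prop)
    (primrec_cond (by fun_prop) (by fun_prop) (primrec_cond (by fun_prop) (by fun_prop)
    (by fun_prop))))

theorem primrec_basicFormulaStep :
    Primrec fun p : (ℕ × List ℕ × ℕ) × List ((Bool × Bool) × Bool × Bool) =>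
      basicFormulaStep p.1 p.2 := by
  unfold basicFormulaStep
  exact primrec_cond (by fun_prop) (by fun_prop) (primrec_cond (by fun_prop) (by fun_prop)
    (primrec_cond (by fun_prop) (by fun_prop) (primrec_cond (by fun_prop) (by fun_prop)
    (by fun_prop))))

theorem primrec_freeTermStep :
    Primrec fun p : (ℕ × List ℕ × ℕ) × List ((Bool × Bool) × Bool × Bool) =>
      freeTermStep p.1 p.2 := by
  unfold freeTermStep
  exact primrec_cond (by fun_prop) (by fun_prop) (primrec_cond (by fun_prop) (by fun_prop)
    (primrec_cond (by fun_prop) (by fun_prop) (primrec_cond (by fun_prop) (by fun_prop)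
    (primrec_cond (by fun_prop) (by fun_prop) (by fun_prop)))))

theorem primrec_freeFormulaStep :
    Primrec fun p : (ℕ × List ℕ × ℕ) × List ((Bool × Bool) × Bool × Bool) =>
      freeFormulaStep p.1 p.2 := by
  unfold freeFormulaStep
  exact primrec_cond (by fun_prop) (by fun_prop) (primrec_cond (by fun_prop) (by fun_prop)
    (primrec_cond (by fun_prop) (by fun_prop) (primrec_cond (by fun_prop) (by fun_prop)
    (by fun_prop))))

theorem syntaxCode_basicTerm (t : Term) (B : List ℕ) (x : ℕ) :
    (syntaxCode (t.code, B, x)).1.1 = true ↔ t.IsBasic B := by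
  simp only [syntaxCode, termOf_code, decide_eq_true_iff]

theorem syntaxCode_basicFormula (φ : Formula) (B : List ℕ) (x : ℕ) :
    (syntaxCode (φ.code, B, x)).1.2 = true ↔ φ.IsBasicIn B := by
  simp only [syntaxCode, formulaOf_code, decide_eq_true_iff]

theorem syntaxCode_freeTerm (t : Term) (B : List ℕ) (x : ℕ) :
    (syntaxCode (t.code, B, x)).2.1 = true ↔ t.Free x := by
  simp only [syntaxCode, termOf_code, decide_eq_true_iff]

theorem syntaxCode_freeFormula (φ : Formula) (B : List ℕ) (x : ℕ) :
    (syntaxCode (φ.code, B, x)).2.2 = true ↔ φ.Free x := by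
  simp only [syntaxCode, formulaOf_code, decide_eq_true_iff]

theorem syntaxGet_syntaxCalls {m : ℕ} (hm : m ≠ 0) (p : List ℕ × ℕ) {k : ℕ} (hk : k < 8) :
    syntaxGet ((syntaxCalls (m, p)).map syntaxCode) k = syntaxCode ((subcodes m).getD k 0, p) := by
  have hlen : (subcodes m).length = 8 := rfl
  simp only [syntaxGet, syntaxCalls, decide_eq_false hm, cond_false, List.map_append, List.map_map]
  rw [List.getD_append _ _ _ _ (by simp [hlen, hk]), List.getD_eq_getElem _ _ (by simp [hlen, hk]),
    List.getElem_map, List.getD_eq_getElem _ _ (by simp [hlen, hk])]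
  rfl

theorem syntaxGet_syntaxCalls_last {m : ℕ} (hm : m ≠ 0) (p : List ℕ × ℕ) :
    syntaxGet ((syntaxCalls (m, p)).map syntaxCode) 8 =
      syntaxCode ((m / 6).unpair.2, (m / 6).unpair.1 :: p.1, p.2) := by
  simp only [syntaxGet, syntaxCalls, decide_eq_false hm, cond_false]
  rfl

theorem Term.isBasic_app_iff (B : List ℕ) (a : ℕ) (t : Term) :
    (Term.app a t).IsBasic B ↔ t.code % 7 = 2 ∧ t.code / 7 ∉ B := by
  cases t <;> simp only [Term.IsBasic, Term.code, reduceCtorEq, false_and, exists_false, false_iff]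
  case var y =>
    have h1 : (7 * y + 2) % 7 = 2 := by omega
    have h2 : (7 * y + 2) / 7 = y := by omega
    simp [h1, h2]
  all_goals omega

theorem syntaxStep_term (t : Term) (B : List ℕ) (x : ℕ) :
    (basicTermStep (t.code, B, x) ((syntaxCalls (t.code, B, x)).map syntaxCode) = true ↔
      t.IsBasic B) ∧
    (freeTermStep (t.code, B, x) ((syntaxCalls (t.code, B, x)).map syntaxCode) = true ↔
      t.Free x) := by
  have hget : ∀ k < 8, t.code ≠ 0 → _ := fun k hk hm =>
    syntaxGet_syntaxCalls (m := t.code) hm (B, x) hk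
  cases t with
  | num n =>
    have h1 : (7 * n) % 7 = 0 := by omega
    simp [basicTermStep, freeTermStep, Term.code, Term.IsBasic, Term.Free]
  | par q =>
    have h1 : (7 * q + 1) % 7 = 1 := by omega
    simp [basicTermStep, freeTermStep, Term.code, Term.IsBasic, Term.Free, h1]
  | var y =>
    have h1 : (7 * y + 2) % 7 = 2 := by omega
    have h2 : (7 * y + 2) / 7 = y := by omega
    simp [basicTermStep, freeTermStep, Term.code, Term.IsBasic, Term.Free, h1, h2]
  | add t u =>
    have h0 : (Term.add t u).code ≠ 0 := by simp [Term.code]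
    have h1 : (7 * Nat.pair t.code u.code + 3) % 7 = 3 := by omega
    have h2 : (7 * Nat.pair t.code u.code + 3) / 7 = Nat.pair t.code u.code := by omega
    have e1 := hget 1 (by norm_num) h0
    have e2 := hget 2 (by norm_num) h0
    simp only [Term.code] at e1 e2
    simp [basicTermStep, freeTermStep, Term.code, Term.IsBasic, Term.Free, h1, h2, e1, e2,
      getD_subcodes, syntaxCode_basicTerm, syntaxCode_freeTerm, -List.getD_eq_getElem?_getD]
  | neg t =>
    have h0 : (Term.neg t).code ≠ 0 := by simp [Term.code]
    have h1 : (7 * t.code + 4) % 7 = 4 := by omega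
    have h2 : (7 * t.code + 4) / 7 = t.code := by omega
    have e1 := hget 0 (by norm_num) h0
    simp only [Term.code] at e1
    simp [basicTermStep, freeTermStep, Term.code, Term.IsBasic, Term.Free, h1, h2, e1,
      getD_subcodes, syntaxCode_basicTerm, syntaxCode_freeTerm, -List.getD_eq_getElem?_getD]
  | app a t =>
    have h0 : (Term.app a t).code ≠ 0 := by simp [Term.code]
    have h1 : (7 * Nat.pair a t.code + 5) % 7 = 5 := by omega
    have h2 : (7 * Nat.pair a t.code + 5) / 7 = Nat.pair a t.code := by omega
    have e1 := hget 2 (by norm_num) h0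
    rw [Term.isBasic_app_iff]
    simp only [Term.code] at e1
    simp [basicTermStep, freeTermStep, Term.code, Term.Free, h1, h2, e1,
      getD_subcodes, syntaxCode_freeTerm, -List.getD_eq_getElem?_getD]
  | card y φ =>
    have h0 : (Term.card y φ).code ≠ 0 := by simp [Term.code]
    have h1 : (7 * Nat.pair y φ.code + 6) % 7 = 6 := by omega
    have h2 : (7 * Nat.pair y φ.code + 6) / 7 = Nat.pair y φ.code := by omega
    have e1 := hget 2 (by norm_num) h0
    simp only [Term.code] at e1
    simp [basicTermStep, freeTermStep, Term.code, Term.IsBasic, Term.Free, h1, h2, e1,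
      getD_subcodes, syntaxCode_freeFormula, -List.getD_eq_getElem?_getD]

theorem syntaxStep_formula (φ : Formula) (B : List ℕ) (x : ℕ) :
    (basicFormulaStep (φ.code, B, x) ((syntaxCalls (φ.code, B, x)).map syntaxCode) = true ↔
      φ.IsBasicIn B) ∧
    (freeFormulaStep (φ.code, B, x) ((syntaxCalls (φ.code, B, x)).map syntaxCode) = true ↔
      φ.Free x) := by
  have hget : ∀ k < 8, φ.code ≠ 0 → _ := fun k hk hm =>
    syntaxGet_syntaxCalls (m := φ.code) hm (B, x) hk
  have hlast : φ.code ≠ 0 → _ := fun hm =>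
    syntaxGet_syntaxCalls_last (m := φ.code) hm (B, x)
  cases φ with
  | lt t u =>
    have h2 : (6 * Nat.pair t.code u.code) / 6 = Nat.pair t.code u.code := by omega
    by_cases h0 : (Formula.lt t u).code = 0
    · have ht : t.code = (Term.num 0).code := by
        have := Nat.left_le_pair t.code u.code
        simp only [Formula.code] at h0
        simp only [Term.code]; omega
      have hu : u.code = (Term.num 0).code := by
        have := Nat.right_le_pair t.code u.code
        simp only [Formula.code] at h0
        simp only [Term.code]; omega
      obtain rfl := Term.code_inj _ _ ht
      obtain rfl := Term.code_inj _ _ hu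
      rw [h0]
      simp [basicFormulaStep, freeFormulaStep, syntaxCalls, syntaxGet, Formula.IsBasicIn,
        Formula.Free, Term.IsBasic, Term.Free]
    · have e1 := hget 4 (by norm_num) h0
      have e2 := hget 5 (by norm_num) h0
      simp only [Formula.code] at e1 e2
      simp [basicFormulaStep, freeFormulaStep, Formula.code, Formula.IsBasicIn, Formula.Free, h2,
        e1, e2, getD_subcodes, syntaxCode_basicTerm, syntaxCode_freeTerm,
        -List.getD_eq_getElem?_getD]
  | eq t u =>
    have h0 : (Formula.eq t u).code ≠ 0 := by simp [Formula.code]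
    have h1 : (6 * Nat.pair t.code u.code + 1) % 6 = 1 := by omega
    have h2 : (6 * Nat.pair t.code u.code + 1) / 6 = Nat.pair t.code u.code := by omega
    have e1 := hget 4 (by norm_num) h0
    have e2 := hget 5 (by norm_num) h0
    simp only [Formula.code] at e1 e2
    simp [basicFormulaStep, freeFormulaStep, Formula.code, Formula.IsBasicIn, Formula.Free, h1, h2,
      e1, e2, getD_subcodes, syntaxCode_basicTerm, syntaxCode_freeTerm, -List.getD_eq_getElem?_getD]
  | modEq n t u =>
    have h0 : (Formula.modEq n t u).code ≠ 0 := by simp [Formula.code]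
    have h1 : (6 * Nat.pair n (Nat.pair t.code u.code) + 2) % 6 = 2 := by omega
    have h2 : (6 * Nat.pair n (Nat.pair t.code u.code) + 2) / 6 =
      Nat.pair n (Nat.pair t.code u.code) := by omega
    have e1 := hget 6 (by norm_num) h0
    have e2 := hget 7 (by norm_num) h0
    simp only [Formula.code] at e1 e2
    simp [basicFormulaStep, freeFormulaStep, Formula.code, Formula.IsBasicIn, Formula.Free, h1, h2,
      e1, e2, getD_subcodes, syntaxCode_basicTerm, syntaxCode_freeTerm, -List.getD_eq_getElem?_getD]
  | and φ ψ =>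
    have h0 : (Formula.and φ ψ).code ≠ 0 := by simp [Formula.code]
    have h1 : (6 * Nat.pair φ.code ψ.code + 3) % 6 = 3 := by omega
    have h2 : (6 * Nat.pair φ.code ψ.code + 3) / 6 = Nat.pair φ.code ψ.code := by omega
    have e1 := hget 4 (by norm_num) h0
    have e2 := hget 5 (by norm_num) h0
    simp only [Formula.code] at e1 e2
    simp [basicFormulaStep, freeFormulaStep, Formula.code, Formula.IsBasicIn, Formula.Free, h1, h2,
      e1, e2, getD_subcodes, syntaxCode_basicFormula, syntaxCode_freeFormula,
      -List.getD_eq_getElem?_getD]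
  | not φ =>
    have h0 : (Formula.not φ).code ≠ 0 := by simp [Formula.code]
    have h1 : (6 * φ.code + 4) % 6 = 4 := by omega
    have h2 : (6 * φ.code + 4) / 6 = φ.code := by omega
    have e1 := hget 3 (by norm_num) h0
    simp only [Formula.code] at e1
    simp [basicFormulaStep, freeFormulaStep, Formula.code, Formula.IsBasicIn, Formula.Free, h1, h2,
      e1, getD_subcodes, syntaxCode_basicFormula, syntaxCode_freeFormula,
      -List.getD_eq_getElem?_getD]
  | ex y φ =>
    have h0 : (Formula.ex y φ).code ≠ 0 := by simp [Formula.code]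
    have h1 : (6 * Nat.pair y φ.code + 5) % 6 = 5 := by omega
    have h2 : (6 * Nat.pair y φ.code + 5) / 6 = Nat.pair y φ.code := by omega
    have e1 := hget 5 (by norm_num) h0
    have e2 := hlast h0
    simp only [Formula.code] at e1 e2
    simp [basicFormulaStep, freeFormulaStep, Formula.code, Formula.IsBasicIn, Formula.Free, h1, h2,
      e1, e2, getD_subcodes, syntaxCode_basicFormula, syntaxCode_freeFormula,
      -List.getD_eq_getElem?_getD]

theorem primrec_syntaxCode : Primrec syntaxCode := by
  refine Primrec.nat_omega_rec' syntaxCode (m := fun b => b.1) (l := syntaxCalls)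
    (g := fun b r => some ((basicTermStep b r, basicFormulaStep b r),
      freeTermStep b r, freeFormulaStep b r)) (by fun_prop)
    primrec_syntaxCalls (Primrec.option_some.comp
      ((primrec_basicTermStep.pair primrec_basicFormulaStep).pair
        (primrec_freeTermStep.pair primrec_freeFormulaStep))) ?_ ?_
  · intro b b' hb'
    by_cases hm : b.1 = 0
    · simp [syntaxCalls, hm] at hb'
    · have h3 : (b.1 / 6).unpair.2 ∈ subcodes b.1 := by simp [subcodes]
      simp only [syntaxCalls, decide_eq_false hm, cond_false, List.mem_append, List.mem_map,
        List.mem_singleton] at hb'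
      rcases hb' with ⟨k, hk, rfl⟩ | rfl
      · exact lt_of_mem_subcodes hm hk
      · exact lt_of_mem_subcodes hm h3
  · rintro ⟨m, B, x⟩
    have h1 := syntaxStep_term (termOf m) B x
    have h2 := syntaxStep_formula (formulaOf m) B x
    rw [← syntaxCode_basicTerm _ B x, ← syntaxCode_freeTerm _ B x, ← Bool.eq_iff_iff,
      ← Bool.eq_iff_iff, code_termOf] at h1
    rw [← syntaxCode_basicFormula _ B x, ← syntaxCode_freeFormula _ B x, ← Bool.eq_iff_iff,
      ← Bool.eq_iff_iff, code_formulaOf] at h2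
    rw [h1.1, h1.2, h2.1, h2.2]

/-! ### Recognition of E-flat formulae -/

/-- The formula is a conjunction `α ∧ ♯{x | β₁} = z₁ ∧ ⋯ ∧ ♯{x | β_K} = z_K` of the kind occurring
in E-flat formulae, where the list is `[z_K, …, z₁]`. -/
def Formula.IsEFlatBody (x : ℕ) : List ℕ → Formula → Prop
  | [], φ => φ.IsBasic ∧ ¬ φ.Free x
  | z :: zs, φ => ∃ ψ β : Formula, φ = .and ψ (.eq (.card x β) (.var z)) ∧ β.IsBasic ∧
      ψ.IsEFlatBody x zs

/-- The formula becomes the body of an E-flat formula by removing some existential quantifiers and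
adding their variables to a list. -/
inductive Formula.IsEFlatPrefix (x : ℕ) : List ℕ → Formula → Prop
  | body {zs : List ℕ} {φ : Formula} : φ.IsEFlatBody x zs → φ.IsEFlatPrefix x zs
  | ex {zs : List ℕ} {z : ℕ} {ψ : Formula} : ψ.IsEFlatPrefix x (z :: zs) →
      (Formula.ex z ψ).IsEFlatPrefix x zs

/-- Constraints are peeled off from the outermost conjunction, which is the last one; hence the
reversed list. Stripping the prefix from outside produces the variables in exactly this order. -/
theorem Formula.isEFlatBody_iff (x : ℕ) : ∀ (zs : List ℕ) (φ : Formula),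
    φ.IsEFlatBody x zs ↔ ∃ (α : Formula) (cs : List (ℕ × Formula)), α.IsBasic ∧
      (∀ c ∈ cs, c.2.IsBasic) ∧ ¬ α.Free x ∧ zs = (cs.map Prod.fst).reverse ∧
      φ = Formula.eFlatBody x α cs
  | [], φ => by
    constructor
    · rintro ⟨h1, h2⟩
      exact ⟨φ, [], h1, by simp, h2, rfl, rfl⟩
    · rintro ⟨α, cs, h1, -, h2, h3, rfl⟩
      obtain rfl : cs = [] := by simpa using h3
      exact ⟨h1, h2⟩
  | z :: zs, φ => by
    constructor
    · rintro ⟨ψ, β, rfl, hβ, hψ⟩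
      obtain ⟨α, cs, h1, h2, h3, rfl, rfl⟩ := (Formula.isEFlatBody_iff x zs ψ).1 hψ
      refine ⟨α, cs ++ [(z, β)], h1, ?_, h3, by simp, by simp [Formula.eFlatBody]⟩
      intro c hc
      rcases List.mem_append.1 hc with hc | hc
      · exact h2 c hc
      · rw [List.mem_singleton.1 hc]; exact hβ
    · rintro ⟨α, cs, h1, h2, h3, h4, rfl⟩
      rcases List.eq_nil_or_concat' cs with rfl | ⟨cs, c, rfl⟩
      · simp at h4
      · simp only [List.map_append, List.map_cons, List.map_nil, List.reverse_append,
          List.reverse_cons, List.reverse_nil, List.nil_append, List.singleton_append,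
          List.cons.injEq] at h4
        refine ⟨Formula.eFlatBody x α cs, c.2, by simp [Formula.eFlatBody, h4.1], h2 c (by simp),
          (Formula.isEFlatBody_iff x zs _).2 ⟨α, cs, h1, fun c hc => h2 c (by simp [hc]), h3,
            h4.2, rfl⟩⟩

theorem Formula.isEFlatPrefix_foldr {x : ℕ} {ψ : Formula} : ∀ (ws zs : List ℕ),
    ψ.IsEFlatBody x (ws.reverse ++ zs) → (ws.foldr Formula.ex ψ).IsEFlatPrefix x zs
  | [], zs, h => .body h
  | w :: ws, zs, h => .ex (Formula.isEFlatPrefix_foldr ws (w :: zs) (by simpa using h))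

theorem Formula.IsEFlatPrefix.exists_foldr {x : ℕ} {zs : List ℕ} {φ : Formula}
    (h : φ.IsEFlatPrefix x zs) : ∃ (ws : List ℕ) (ψ : Formula),
      φ = ws.foldr Formula.ex ψ ∧ ψ.IsEFlatBody x (ws.reverse ++ zs) := by
  induction h with
  | body h => exact ⟨[], _, rfl, h⟩
  | @ex zs z ψ _ ih =>
    obtain ⟨ws, χ, rfl, h⟩ := ih
    exact ⟨z :: ws, χ, rfl, by simpa using h⟩

theorem Formula.isEFlatPrefix_nil_iff (x : ℕ) (φ : Formula) :
    φ.IsEFlatPrefix x [] ↔ ∃ (α : Formula) (cs : List (ℕ × Formula)),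
      α.IsBasic ∧ (∀ c ∈ cs, c.2.IsBasic) ∧ ¬ α.Free x ∧ φ = Formula.eFlat x α cs := by
  constructor
  · intro h
    obtain ⟨ws, ψ, rfl, hψ⟩ := h.exists_foldr
    obtain ⟨α, cs, h1, h2, h3, h4, rfl⟩ := (Formula.isEFlatBody_iff x _ ψ).1 hψ
    refine ⟨α, cs, h1, h2, h3, ?_⟩
    rw [List.append_nil, List.reverse_inj] at h4
    rw [h4, List.foldr_map]
    rfl
  · rintro ⟨α, cs, h1, h2, h3, rfl⟩
    have := Formula.isEFlatPrefix_foldr (x := x) (cs.map Prod.fst) []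
      ((Formula.isEFlatBody_iff x _ _).2 ⟨α, cs, h1, h2, h3, List.append_nil _, rfl⟩)
    rwa [List.foldr_map] at this

/-- A genuine alternative: `α` may itself begin with quantifiers, so the prefix may end before the
first formula that is not existential. -/
theorem Formula.isEFlatPrefix_iff (x : ℕ) (zs : List ℕ) (φ : Formula) :
    φ.IsEFlatPrefix x zs ↔ φ.IsEFlatBody x zs ∨ ∃ z ψ, φ = .ex z ψ ∧
      ψ.IsEFlatPrefix x (z :: zs) := by
  constructor
  · rintro (h | h)
    · exact .inl h
    · exact .inr ⟨_, _, rfl, h⟩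
  · rintro (h | ⟨z, ψ, rfl, h⟩)
    · exact .body h
    · exact .ex h

/-- The Gödel number of the presumed body of the last cardinality constraint. -/
def constraintCode (m : ℕ) : ℕ := (((m / 6).unpair.2 / 6).unpair.1 / 7).unpair.2

open Classical in
/-- Whether the formula with a given Gödel number satisfies `Formula.IsEFlatBody` and
`Formula.IsEFlatPrefix`. -/
noncomputable def shapeCode (b : ℕ × List ℕ × ℕ) : Bool × Bool :=
  (decide ((formulaOf b.1).IsEFlatBody b.2.2 b.2.1),
    decide ((formulaOf b.1).IsEFlatPrefix b.2.2 b.2.1))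

/-- The arguments of the recursive calls of `shapeCode`. -/
def shapeCalls (b : ℕ × List ℕ × ℕ) : List (ℕ × List ℕ × ℕ) :=
  bif decide (b.1 = 0) then [] else
    [((b.1 / 6).unpair.1, b.2.1.tail, b.2.2),
      ((b.1 / 6).unpair.2, (b.1 / 6).unpair.1 :: b.2.1, b.2.2)]

/-- Whether a formula satisfies `Formula.IsEFlatBody`, from the results of the recursive calls. -/
noncomputable def bodyStep (b : ℕ × List ℕ × ℕ) (r : List (Bool × Bool)) : Bool :=
  bif decide (b.2.1.length = 0) then
    (syntaxCode (b.1, [], b.2.2)).1.2 && !(syntaxCode (b.1, [], b.2.2)).2.2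
  else
    decide (b.1 % 6 = 3) &&
    -- The second conjunct is compared with the constraint rebuilt from its presumed parts, so no
    -- separate inspection of its shape is needed.
    (decide ((b.1 / 6).unpair.2 =
      6 * Nat.pair (7 * Nat.pair b.2.2 (constraintCode b.1) + 6) (7 * b.2.1.getD 0 0 + 2) + 1) &&
    ((syntaxCode (constraintCode b.1, [], b.2.2)).1.2 && (r.getD 0 (false, false)).1))

/-- Whether a formula satisfies `Formula.IsEFlatPrefix`, from the results of the recursive calls. -/
noncomputable def prefixStep (b : ℕ × List ℕ × ℕ) (r : List (Bool × Bool)) : Bool :=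
  bodyStep b r || (decide (b.1 % 6 = 5) && (r.getD 1 (false, false)).2)

theorem primrec_shapeCalls : Primrec shapeCalls := by unfold shapeCalls; fun_prop

theorem primrec_bodyStep : Primrec fun p : (ℕ × List ℕ × ℕ) × List (Bool × Bool) =>
    bodyStep p.1 p.2 := by
  have h : ∀ {f : (ℕ × List ℕ × ℕ) × List (Bool × Bool) → ℕ}
      {g : (ℕ × List ℕ × ℕ) × List (Bool × Bool) → List ℕ × ℕ}, Primrec f → Primrec g →
      Primrec fun p => syntaxCode (f p, g p) := fun hf hg => primrec_syntaxCode.comp (hf.pair hg)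
  unfold bodyStep constraintCode
  refine primrec_cond (by fun_prop) ?_ (primrec_and (by fun_prop) (primrec_and (by fun_prop) ?_))
  · have h1 := h (f := fun p => p.1.1) (g := fun p => ([], p.1.2.2)) (by fun_prop) (by fun_prop)
    exact primrec_and (primrec_snd (primrec_fst h1)) (primrec_not (primrec_snd (primrec_snd h1)))
  · exact primrec_and (primrec_snd (primrec_fst (h (by fun_prop) (by fun_prop)))) (by fun_prop)

theorem primrec_prefixStep : Primrec fun p : (ℕ × List ℕ × ℕ) × List (Bool × Bool) =>
    prefixStep p.1 p.2 :=
  primrec_or primrec_bodyStep (by fun_prop)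

theorem shapeCode_body (φ : Formula) (zs : List ℕ) (x : ℕ) :
    (shapeCode (φ.code, zs, x)).1 = true ↔ φ.IsEFlatBody x zs := by
  simp only [shapeCode, formulaOf_code, decide_eq_true_iff]

theorem shapeCode_prefix (φ : Formula) (zs : List ℕ) (x : ℕ) :
    (shapeCode (φ.code, zs, x)).2 = true ↔ φ.IsEFlatPrefix x zs := by
  simp only [shapeCode, formulaOf_code, decide_eq_true_iff]

theorem bodyStep_iff (φ : Formula) (zs : List ℕ) (x : ℕ) :
    bodyStep (φ.code, zs, x) ((shapeCalls (φ.code, zs, x)).map shapeCode) = true ↔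
      φ.IsEFlatBody x zs := by
  rcases zs with _ | ⟨z, zs⟩
  · simp [bodyStep, Formula.IsEFlatBody, syntaxCode_basicFormula, syntaxCode_freeFormula,
      Formula.IsBasic, ← Bool.not_eq_true]
  · have hget : φ.code ≠ 0 → ((shapeCalls (φ.code, z :: zs, x)).map shapeCode).getD 0
        (false, false) = shapeCode ((φ.code / 6).unpair.1, zs, x) := fun hm => by
      simp only [shapeCalls, decide_eq_false hm, cond_false]; rfl
    have hstep : bodyStep (φ.code, z :: zs, x) ((shapeCalls (φ.code, z :: zs, x)).map shapeCode) =
        true ↔ φ.code % 6 = 3 ∧ (φ.code / 6).unpair.2 =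
          6 * Nat.pair (7 * Nat.pair x (constraintCode φ.code) + 6) (7 * z + 2) + 1 ∧
        (syntaxCode (constraintCode φ.code, [], x)).1.2 = true ∧
        (((shapeCalls (φ.code, z :: zs, x)).map shapeCode).getD 0 (false, false)).1 = true := by
      simp only [bodyStep, List.length_cons, Nat.add_eq_zero_iff, one_ne_zero, and_false,
        decide_false, cond_false, Bool.and_eq_true, decide_eq_true_iff, List.getD_cons_zero]
    rw [hstep]
    constructor
    · rintro ⟨h1, h2, h3, h4⟩
      rw [hget (by omega), ← code_formulaOf (φ.code / 6).unpair.1, shapeCode_body] at h4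
      rw [← code_formulaOf (constraintCode φ.code), syntaxCode_basicFormula] at h3
      refine ⟨_, _, Formula.code_inj _ _ ?_, h3, h4⟩
      simp only [Formula.code, Term.code, code_formulaOf]
      rw [← h2, Nat.pair_unpair]
      omega
    · rintro ⟨ψ, β, rfl, hβ, hψ⟩
      have h0 : (Formula.and ψ (.eq (.card x β) (.var z))).code ≠ 0 := by simp [Formula.code]
      have e1 : ∀ k, (6 * k + 3) / 6 = k := fun k => by omega
      have e2 : ∀ k, (6 * k + 1) / 6 = k := fun k => by omega
      have e3 : ∀ k, (7 * k + 6) / 7 = k := fun k => by omega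
      have hc : constraintCode (Formula.and ψ (.eq (.card x β) (.var z))).code = β.code := by
        simp [constraintCode, Formula.code, Term.code, e1, e2, e3]
      have h1 : (Formula.and ψ (.eq (.card x β) (.var z))).code / 6 =
          Nat.pair ψ.code (Formula.eq (.card x β) (.var z)).code := by
        simp only [Formula.code, e1]
      rw [hget h0, hc, h1, Nat.unpair_pair, syntaxCode_basicFormula, shapeCode_body]
      refine ⟨?_, ?_, hβ, hψ⟩
      · rw [Formula.code]; omega
      · simp only [Formula.code, Term.code]

theorem prefixStep_iff (φ : Formula) (zs : List ℕ) (x : ℕ) :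
    prefixStep (φ.code, zs, x) ((shapeCalls (φ.code, zs, x)).map shapeCode) = true ↔
      φ.IsEFlatPrefix x zs := by
  have hget : φ.code ≠ 0 → ((shapeCalls (φ.code, zs, x)).map shapeCode).getD 1
      (false, false) = shapeCode ((φ.code / 6).unpair.2, (φ.code / 6).unpair.1 :: zs, x) :=
    fun hm => by simp only [shapeCalls, decide_eq_false hm, cond_false]; rfl
  rw [prefixStep, Bool.or_eq_true, bodyStep_iff, Bool.and_eq_true, decide_eq_true_iff,
    Formula.isEFlatPrefix_iff]
  refine or_congr_right ⟨?_, ?_⟩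
  · rintro ⟨h1, h2⟩
    dsimp only at h1
    rw [hget (by omega), ← code_formulaOf (φ.code / 6).unpair.2, shapeCode_prefix] at h2
    refine ⟨_, _, Formula.code_inj _ _ ?_, h2⟩
    simp only [Formula.code, code_formulaOf, Nat.pair_unpair]
    omega
  · rintro ⟨z, ψ, rfl, h⟩
    have h0 : (Formula.ex z ψ).code ≠ 0 := by simp [Formula.code]
    have h1 : (Formula.ex z ψ).code / 6 = Nat.pair z ψ.code := by
      rw [Formula.code]; omega
    rw [hget h0, h1, Nat.unpair_pair, shapeCode_prefix]
    exact ⟨by dsimp only; rw [Formula.code]; omega, h⟩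

theorem primrec_shapeCode : Primrec shapeCode := by
  refine Primrec.nat_omega_rec' shapeCode (m := fun b => b.1) (l := shapeCalls)
    (g := fun b r => some (bodyStep b r, prefixStep b r)) (by fun_prop) primrec_shapeCalls
    (Primrec.option_some.comp (primrec_bodyStep.pair primrec_prefixStep)) ?_ ?_
  · intro b b' hb'
    by_cases hm : b.1 = 0
    · simp [shapeCalls, hm] at hb'
    · have h3 : (b.1 / 6).unpair.1 ∈ subcodes b.1 := by simp [subcodes]
      have h4 : (b.1 / 6).unpair.2 ∈ subcodes b.1 := by simp [subcodes]
      simp only [shapeCalls, decide_eq_false hm, cond_false, List.mem_cons, List.not_mem_nil,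
        or_false] at hb'
      rcases hb' with rfl | rfl
      exacts [lt_of_mem_subcodes hm h3, lt_of_mem_subcodes hm h4]
  · rintro ⟨m, zs, x⟩
    have h1 := bodyStep_iff (formulaOf m) zs x
    have h2 := prefixStep_iff (formulaOf m) zs x
    rw [← shapeCode_body, ← Bool.eq_iff_iff, code_formulaOf] at h1
    rw [← shapeCode_prefix, ← Bool.eq_iff_iff, code_formulaOf] at h2
    rw [h1, h2]

theorem primrecPred_isEFlat : PrimrecPred fun φ : Formula => φ.IsEFlat := by
  have h : PrimrecRel fun x m : ℕ => (shapeCode (m, [], x)).2 = true :=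
    Primrec.eq.comp (Primrec.snd.comp (primrec_shapeCode.comp (by fun_prop))) (by fun_prop)
  refine (h.exists_lt.comp (f := fun φ : Formula => Encodable.encode φ + 2)
    (g := fun φ : Formula => Encodable.encode φ) (Primrec.nat_add.comp Primrec.encode
      (Primrec.const 2)) Primrec.encode).of_eq fun φ => ?_
  rw [Formula.isEFlat_iff]
  refine exists_congr fun x => and_congr_right fun _ => ?_
  rw [Formula.encode_eq, shapeCode_prefix, Formula.isEFlatPrefix_nil_iff]

/-- The bounded search is known to be correct only for E-flat formulae, which suffices because it is
conjoined with the test for being E-flat. -/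
theorem computablePred_isEFlat_and_satisfiable :
    ComputablePred fun φ : Formula => φ.IsEFlat ∧ φ.Satisfiable := by
  refine ((primrecPred_isEFlat.and (primrecPred_search.comp
    (f := fun φ : Formula => Encodable.encode φ) Primrec.encode)).of_eq fun φ => ?_).computablePred
  exact and_congr_right fun h => by rw [h.satisfiable_iff]; rfl

end ArrayCard

theorem mainTheorem1 :
    ComputablePred fun φ : ArrayCard.Formula => φ.IsEFlat ∧ φ.Satisfiable :=
  ArrayCard.computablePred_isEFlat_and_satisfiable
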